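/- **The algorithm.** Let $p$ be a polynomial that can only be evaluated, of known degree $n\ge 1$; let $k\ge 1$ and $\epsilon\in(0,1/2]$. For positive reals $e_0,L,r,b,\kappa,\nu$ put $$\epsilon'=\frac{e_0}{8r},\quad \delta=\frac{\epsilon'}{16\,b^k\kappa},\quad \delta'=\delta^{k+1},\quad \alpha=\frac{\delta'\epsilon'^2}{2\nu^2},\quad N=\lceil 16\,r L\rceil .$$ Let $\tilde g_0=n$, $\ \tilde g_1(x)=\frac{1}{p(x)}\cdot\frac{p(x+\alpha)-p(x)}{\alpha}$ and $\tilde g_{l+1}(x)=\frac{(-1)^l}{l!}\,\frac1{\delta^l}\sum_{i=0}^{l}(-1)^i\binom li\,\tilde g_1(x+(l-i)\delta)$ for $l\ge1$. Start with $x=1$ and do at most $N$ rounds of the following: compute $u=\frac1{4r}\,\tilde g_{k-1}(x)/\tilde g_k(x)$; if $u\le\epsilon'$, stop and output $x$; otherwise round $u$ down to a multiple of $\epsilon'/\nu$ and subtract the result from $x$. After $N$ rounds output $x$. The *exact version* has $e_0=\epsilon$, $L=\ln(1/\epsilon)$, $r=n^{1/k}$, $b=2e$, $\kappa=k$, $\nu=n$.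 The *dyadic version* replaces each of $1/\epsilon,\ n^{1/k},\ 2e,\ k,\ n$ by the least power of two that is at least as large (so $e_0$ is the inverse of the rounded $1/\epsilon$), and has $L=\log_2(1/e_0)$; its parameters have finite binary expansions. **Theorem.** (1) There is an absolute constant $C$ such that for all $n,k\ge 1$, all $\epsilon\in(0,1/2]$ and every monic real-rooted polynomial $p$ of degree $n$ with all roots in $[0,1/2]$ and largest root $\lambda_1$, both versions of the algorithm output a number $\lambda$ with $0\le\lambda-\lambda_1\le\epsilon$, and make at most $C\,k\,n^{1/k}\log(1/\epsilon)$ evaluations of $p$. (2) Let numbers be represented as fractions of integers, and let $\langle x\rangle$ be the number of bits of such a representation. Consider integer random access machines on which reading, writing, addition, subtraction and testing are charged the bit lengths of the numbers (and addresses) involved, multiplication and division of integers of $b$ bits in total are charged $b\log b\log\log b$, and a subroutine evaluating $p$ can be called, which is charged $T(\langle x\rangle)$ at the argument $x$. There are one program, independent of all data, and an absolute constant $c$ such that for all constants $D,B$ there is a constant $C$ for which the following holds. Let $n,k,p$ be as in (1), let $\epsilon\in(0,1/2]$ be rational with $\langle\epsilon\rangle\le B\log_2(1/\epsilon)$, and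 suppose that a subroutine computes $p(x)$ exactly, as a fraction, for every fraction $x$, in time $T(\langle x\rangle)$, which includes reading $x$ and writing $p(x)$ (so $T(m)\ge m$ and $\langle p(x)\rangle\le T(\langle x\rangle)$), where $T$ is nondecreasing and $T(2m)\le D\,T(m)$ for all $m$. Then the program, given $n,k,\epsilon$, halts with exactly the output of the dyadic version of the algorithm, after at most $C\,G\,(\log(2+G))^c$ bit operations, where $$G=k\,n^{1/k}\log(1/\epsilon)\;T\big(k^2+k\lceil\log_2(n/\epsilon)\rceil\big).$$ That is, the total running time is $\tilde O\big(k\,n^{1/k}\log(1/\epsilon)\,T(k^2+k\log(n/\epsilon))\big)$. -/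

import Mathlib

namespace HigherOrderNewton

/-! ### Computations over the reals with an evaluation oracle -/

/-- A computation over the reals whose only access to the polynomial is through an oracle:
it either stops with a value or asks for the value of the polynomial at a real point. -/
inductive OracleComp (A : Type) : Type
  | done (a : A) : OracleComp A
  | ask (x : ℝ) (next : ℝ → OracleComp A) : OracleComp A

namespace OracleComp

/-- Sequential composition. -/
def bind {A B : Type} : OracleComp A → (A → OracleComp B) → OracleComp B
  | done a, f => f a
  | ask x next, f => ask x (fun y => (next y).bind f)

instance : Monad OracleComp where
  pure := done
  bind := bind

/-- Ask for one value. -/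
def query (x : ℝ) : OracleComp ℝ := ask x done

/-- The result of the computation when the oracle is the function `f`. -/
def run {A : Type} (f : ℝ → ℝ) : OracleComp A → A
  | done a => a
  | ask x next => (next (f x)).run f

/-- The number of oracle calls made when the oracle is the function `f`. -/
def queries {A : Type} (f : ℝ → ℝ) : OracleComp A → ℕ
  | done _ => 0
  | ask x next => (next (f x)).queries f + 1

/-- The sum of the results of `F 0`, ..., `F (m - 1)`. -/
def sum (F : ℕ → OracleComp ℝ) : ℕ → OracleComp ℝ
  | 0 => pure 0
  | m + 1 => do
    let s ← sum F m
    let y ← F m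
    pure (s + y)

end OracleComp

/-! ### The accelerated Newton iteration -/

/-- The parameters of the iteration: the number of rounds, the number playing the role of
`n ^ (1 / k)` in the update, the stopping threshold, the two finite-difference steps, and the
accuracy to which updates are rounded down. -/
structure Params where
  rounds : ℕ
  root : ℝ
  threshold : ℝ
  delta : ℝ
  alpha : ℝ
  grid : ℝ

/-- The parameters as functions of the numbers `err` (error bound), `L` (logarithm of its inverse),
`r` (the `k`-th root of the degree), `b` (the base `2 e`), `κ` (the depth) and `ν` (the degree):
`ε' = err / (8 r)`, `δ = ε' / (16 b ^ k κ)`, `δ' = δ ^ (k + 1)`, `α = δ' ε' ^ 2 / (2 ν ^ 2)`,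
accuracy `ε' / ν`, and `⌈16 r L⌉` rounds. -/
noncomputable def mkParams (k : ℕ) (err L r b κ ν : ℝ) : Params :=
  let threshold := err / (8 * r)
  let delta := threshold / (16 * b ^ k * κ)
  let delta' := delta ^ (k + 1)
  { rounds := ⌈16 * r * L⌉₊
    root := r
    threshold := threshold
    delta := delta
    alpha := delta' * threshold ^ 2 / (2 * ν ^ 2)
    grid := threshold / ν }

/-- The exact real parameters. -/
noncomputable def exactParams (n k : ℕ) (ε : ℝ) : Params :=
  mkParams k ε (Real.log (1 / ε)) ((n : ℝ) ^ (1 / (k : ℝ))) (2 * Real.exp 1) k n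

/-- The least power of two that is at least `y` (for `y > 0`). -/
noncomputable def up2 (y : ℝ) : ℝ := (2 : ℝ) ^ ⌈Real.logb 2 y⌉

/-- The parameters obtained by rounding each of `1 / ε`, `n ^ (1 / k)`, `2 e`, `k`, `n` up to a
power of two; the logarithm is the binary one. All of them have finite binary expansions. -/
noncomputable def dyadicParams (n k : ℕ) (ε : ℝ) : Params :=
  mkParams k (1 / up2 (1 / ε)) (Real.logb 2 (up2 (1 / ε))) (up2 ((n : ℝ) ^ (1 / (k : ℝ))))
    (up2 (2 * Real.exp 1)) (up2 k) (up2 n)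

/-- `g̃_1 (x) = (1 / p (x)) * ((p (x + α) - p (x)) / α)`. -/
noncomputable def gTildeOne (P : Params) (x : ℝ) : OracleComp ℝ := do
  let y ← OracleComp.query (x + P.alpha)
  let z ← OracleComp.query x
  pure (1 / z * ((y - z) / P.alpha))

/-- `g̃_(l + 1) (x) = ((-1) ^ l / l!) * (1 / δ ^ l) * ∑_{i ≤ l} (-1) ^ i (l choose i)
g̃_1 (x + (l - i) δ)`, which for `l = 0` is `g̃_1 (x)`; and `g̃_0 = n`, the zeroth moment of the
`n` numbers `1 / (x - λ_i)`. -/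
noncomputable def gTilde (n : ℕ) (P : Params) : ℕ → ℝ → OracleComp ℝ
  | 0, _ => pure (n : ℝ)
  | l + 1, x => do
    let s ← OracleComp.sum (fun i => do
      let y ← gTildeOne P (x + ((l : ℝ) - (i : ℝ)) * P.delta)
      pure ((-1) ^ i * (l.choose i : ℝ) * y)) (l + 1)
    pure ((-1) ^ l / (l.factorial : ℝ) * (1 / P.delta ^ l * s))

/-- At most the given number of rounds, from the current iterate `x`. A round computes
`u = g̃_(k-1) (x) / (4 r g̃_k (x))`, stops with output `x` if `u` is at most the threshold, and
otherwise rounds `u` down to a multiple of the accuracy and subtracts it from `x`. -/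
noncomputable def iterate (n k : ℕ) (P : Params) : ℕ → ℝ → OracleComp ℝ
  | 0, x => pure x
  | t + 1, x => do
    let a ← gTilde n P (k - 1) x
    let b ← gTilde n P k x
    let u : ℝ := 1 / (4 * P.root) * (a / b)
    if u ≤ P.threshold then pure x
    else iterate n k P t (x - P.grid * (⌊u / P.grid⌋ : ℝ))

/-- The higher-order Newton iteration of depth `k`, for degree `n`, started at `x = 1`. -/
noncomputable def newton (n k : ℕ) (P : Params) : OracleComp ℝ :=
  iterate n k P P.rounds 1

/-! ### A machine model that counts bit operations

Integer random access machines. Every elementary operation is charged in bit operations: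
reading, writing, adding, subtracting and testing are linear in the lengths of the numbers (and
addresses) involved, multiplication and division are charged the Schönhage–Strassen bound. -/

/-- Length of an integer in bits, sign included. -/
def bits (z : ℤ) : ℕ := Nat.size z.natAbs + 1

/-- The Schönhage–Strassen bound `b log b log log b`. -/
def fastCost (b : ℕ) : ℕ := b * Nat.size b * Nat.size (Nat.size b)

/-- Finitely many registers are used by a program; `mem` is its addressable memory. -/
structure State where
  reg : ℕ → ℤ
  mem : ℤ → ℤ

def State.setReg (σ : State) (i : ℕ) (z : ℤ) : State :=
  { σ with reg := Function.update σ.reg i z }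

def State.setMem (σ : State) (a z : ℤ) : State :=
  { σ with mem := Function.update σ.mem a z }

inductive Expr : Type
  | const (c : ℤ)
  | reg (i : ℕ)
  | mem (address : Expr)
  | add (e f : Expr)
  | sub (e f : Expr)
  | mul (e f : Expr)
  | div (e f : Expr)

namespace Expr

/-- Value of an expression; division is integer division. -/
def eval (σ : State) : Expr → ℤ
  | const c => c
  | reg i => σ.reg i
  | mem a => σ.mem (a.eval σ)
  | add e f => e.eval σ + f.eval σ
  | sub e f => e.eval σ - f.eval σ
  | mul e f => e.eval σ * f.eval σ
  | div e f => e.eval σ / f.eval σ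

/-- Number of bit operations charged for evaluating an expression. -/
def cost (σ : State) : Expr → ℕ
  | const c => bits c
  | reg i => bits (σ.reg i)
  | mem a => a.cost σ + bits (a.eval σ) + bits (σ.mem (a.eval σ))
  | add e f => e.cost σ + f.cost σ + bits (e.eval σ) + bits (f.eval σ)
  | sub e f => e.cost σ + f.cost σ + bits (e.eval σ) + bits (f.eval σ)
  | mul e f => e.cost σ + f.cost σ + fastCost (bits (e.eval σ) + bits (f.eval σ))
  | div e f => e.cost σ + f.cost σ + fastCost (bits (e.eval σ) + bits (f.eval σ))

end Expr

/-- Programs. `query e f i j` calls the evaluation subroutine at the fraction `e / f` and puts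
numerator and denominator of the answer into registers `i` and `j`. Tests ask whether an
expression is positive. -/
inductive Prog : Type
  | skip
  | assign (i : ℕ) (e : Expr)
  | store (address e : Expr)
  | query (e f : Expr) (i j : ℕ)
  | seq (c d : Prog)
  | ite (e : Expr) (c d : Prog)
  | while (e : Expr) (c : Prog)

/-- `Exec ev T c σ σ' t`: with the evaluation subroutine `ev`, charged `T m` for an argument of
`m` bits, the program `c` started in state `σ` halts in state `σ'` after `t` bit operations. -/
inductive Exec (ev : ℤ → ℤ → ℤ × ℤ) (T : ℕ → ℕ) : Prog → State → State → ℕ → Prop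
  | skip (σ : State) : Exec ev T .skip σ σ 1
  | assign (σ : State) (i : ℕ) (e : Expr) :
      Exec ev T (.assign i e) σ (σ.setReg i (e.eval σ)) (e.cost σ + bits (e.eval σ))
  | store (σ : State) (a e : Expr) :
      Exec ev T (.store a e) σ (σ.setMem (a.eval σ) (e.eval σ))
        (a.cost σ + e.cost σ + bits (a.eval σ) + bits (e.eval σ))
  | query (σ : State) (e f : Expr) (i j : ℕ) (hf : 0 < f.eval σ) :
      Exec ev T (.query e f i j) σ
        ((σ.setReg i (ev (e.eval σ) (f.eval σ)).1).setReg j (ev (e.eval σ) (f.eval σ)).2)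
        (e.cost σ + f.cost σ + T (bits (e.eval σ) + bits (f.eval σ))
          + bits (ev (e.eval σ) (f.eval σ)).1 + bits (ev (e.eval σ) (f.eval σ)).2)
  | seq {c d : Prog} {σ σ' σ'' : State} {s t : ℕ} (hc : Exec ev T c σ σ' s)
      (hd : Exec ev T d σ' σ'' t) : Exec ev T (.seq c d) σ σ'' (s + t)
  | ite_pos {e : Expr} {c d : Prog} {σ σ' : State} {t : ℕ} (he : 0 < e.eval σ)
      (hc : Exec ev T c σ σ' t) :
      Exec ev T (.ite e c d) σ σ' (e.cost σ + bits (e.eval σ) + t)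
  | ite_neg {e : Expr} {c d : Prog} {σ σ' : State} {t : ℕ} (he : ¬ 0 < e.eval σ)
      (hd : Exec ev T d σ σ' t) :
      Exec ev T (.ite e c d) σ σ' (e.cost σ + bits (e.eval σ) + t)
  | while_pos {e : Expr} {c : Prog} {σ σ' σ'' : State} {s t : ℕ} (he : 0 < e.eval σ)
      (hc : Exec ev T c σ σ' s) (hw : Exec ev T (.while e c) σ' σ'' t) :
      Exec ev T (.while e c) σ σ'' (e.cost σ + bits (e.eval σ) + s + t)
  | while_neg {e : Expr} {c : Prog} {σ : State} (he : ¬ 0 < e.eval σ) :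
      Exec ev T (.while e c) σ σ (e.cost σ + bits (e.eval σ))

/-- The initial state: `n`, `k` and numerator and denominator of `ε` in registers 0 to 3. -/
def initState (n k : ℕ) (ε : ℚ) : State where
  reg := fun i =>
    match i with
    | 0 => (n : ℤ)
    | 1 => (k : ℤ)
    | 2 => ε.num
    | 3 => (ε.den : ℤ)
    | _ => 0
  mem := fun _ => 0

/-- `ev` is a subroutine that evaluates `p` exactly at every fraction `u / v` with `v > 0`, the
answer being a fraction with positive denominator, within `T (⟨u⟩ + ⟨v⟩)` bit operations. Its
running time covers reading the argument and writing the answer. -/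
structure IsEvaluator (p : Polynomial ℝ) (ev : ℤ → ℤ → ℤ × ℤ) (T : ℕ → ℕ) : Prop where
  den_pos : ∀ u v : ℤ, 0 < v → 0 < (ev u v).2
  correct : ∀ u v : ℤ, 0 < v → p.eval ((u : ℝ) / (v : ℝ)) = ((ev u v).1 : ℝ) / ((ev u v).2 : ℝ)
  reads : ∀ m : ℕ, m ≤ T m
  writes : ∀ u v : ℤ, 0 < v → bits (ev u v).1 + bits (ev u v).2 ≤ T (bits u + bits v)

/-- `k n ^ (1 / k) log (1 / ε) T (k ^ 2 + k log (n / ε))`. -/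
noncomputable def timeBound (T : ℕ → ℕ) (n k : ℕ) (ε : ℝ) : ℝ :=
  (k : ℝ) * (n : ℝ) ^ (1 / (k : ℝ)) * Real.log (1 / ε)
    * (T (k ^ 2 + k * ⌈Real.logb 2 ((n : ℝ) / ε)⌉₊) : ℝ)

end HigherOrderNewton

namespace HigherOrderNewton

open Finset

/-! ### Running oracle computations -/

namespace OracleComp

/-! Let `g_m(x) = ∑ (x - λ_i)^(-m)` (`recipSum`) and let `d = x - λ_1 > 0`. No reciprocal exceeds
`1/d`, hence `d g_k ≤ g_(k-1)`. Conversely, AM-GM together with `n ≤ r^k` and `d^(-k) ≤ g_k` gives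
`g_(k-1) ≤ r d g_k` (`recipSum_le_mul_succ`). The ideal update `g_(k-1) / (4 r g_k)` therefore lies
between `d/(4r)` and `d/4`. It never jumps over `λ_1`, it shrinks `d` by a factor `1 - Ω(1/r)`, and
a small update certifies a small `d`. After `16 r log(1/err)` rounds the distance is below the
tolerance.

The sums need only be known up to a factor `1 ± 1/16` (`gTilde_accuracy`). The quotient
`p(x+α)/p(x)` is `∏ (1 + α/(x-λ_i))`, so the difference quotient is `g_1` up to a tiny error. Finite
differences of `1/t` are known in closed form, so differencing `g_1` gives sums of `1/∏_j (x - λ_i +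
jδ)`, which are close to `g_m` because `k² δ` is small compared with `d`. The error in `g_1` is
amplified by at most `2^l/(l! δ^l)`, and `α` is chosen to beat that. `round_bounds` and
`newton_bounds` finish the output guarantee; each round costs at most `4k` evaluations.

For the bit complexity, every dyadic parameter is an integer power of two or the inverse of one.
Iterates are `X/GP`, all evaluation points are `q/A` with a common denominator, and `log₂ A = O(k² +
k log(n/ε))` (`Exponents.alphaExp_le`). Let `W` bound the cost of one evaluation and the lengths of
all numbers entering a round. A finite difference is a sum of at most `k` fractions of length
`O(W)`; adding them along a balanced binary tree (`runs_treeSum`) costs `k W` up to logarithmic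
factors. Since real comparisons and floors become integer tests and divisions, the machine
reproduces the dyadic iteration exactly (`runs_rounds`). Multiplying by the number of rounds and
using the doubling property of `T` gives the bound. -/

theorem run_pure {A : Type} (f : ℝ → ℝ) (a : A) : (pure a : OracleComp A).run f = a := rfl

theorem queries_pure {A : Type} (f : ℝ → ℝ) (a : A) : (pure a : OracleComp A).queries f = 0 := rfl

theorem run_query (f : ℝ → ℝ) (x : ℝ) : (query x).run f = f x := rfl

theorem queries_query (f : ℝ → ℝ) (x : ℝ) : (query x).queries f = 1 := rfl

theorem run_bind {A B : Type} (f : ℝ → ℝ) (c : OracleComp A) (g : A → OracleComp B) :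
    (c >>= g).run f = (g (c.run f)).run f := by
  change (OracleComp.bind c g).run f = _
  induction c with
  | done a => rfl
  | ask x next ih => exact ih (f x)

theorem queries_bind {A B : Type} (f : ℝ → ℝ) (c : OracleComp A) (g : A → OracleComp B) :
    (c >>= g).queries f = c.queries f + (g (c.run f)).queries f := by
  change (OracleComp.bind c g).queries f = _
  induction c with
  | done a => simp [OracleComp.bind, queries, run]
  | ask x next ih =>
    have := ih (f x)
    simp only [OracleComp.bind, queries, run, this]
    omega

theorem run_sum (f : ℝ → ℝ) (F : ℕ → OracleComp ℝ) (m : ℕ) :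
    (sum F m).run f = ∑ i ∈ range m, (F i).run f := by
  induction m with
  | zero => rfl
  | succ m ih => simp [sum, run_bind, run_pure, ih, sum_range_succ]

theorem queries_sum (f : ℝ → ℝ) (F : ℕ → OracleComp ℝ) (m : ℕ) :
    (sum F m).queries f = ∑ i ∈ range m, (F i).queries f := by
  induction m with
  | zero => rfl
  | succ m ih => simp [sum, queries_bind, queries_pure, ih, sum_range_succ]

end OracleComp

open OracleComp

theorem run_gTildeOne (P : Params) (f : ℝ → ℝ) (x : ℝ) :
    (gTildeOne P x).run f = 1 / f x * ((f (x + P.alpha) - f x) / P.alpha) := by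
  simp only [gTildeOne, run_bind, run_query, run_pure]

theorem queries_gTildeOne (P : Params) (f : ℝ → ℝ) (x : ℝ) :
    (gTildeOne P x).queries f = 2 := by
  simp only [gTildeOne, queries_bind, queries_query, queries_pure]

theorem run_gTilde_zero (n : ℕ) (P : Params) (f : ℝ → ℝ) (x : ℝ) :
    (gTilde n P 0 x).run f = n := rfl

theorem run_gTilde_succ (n : ℕ) (P : Params) (f : ℝ → ℝ) (l : ℕ) (x : ℝ) :
    (gTilde n P (l + 1) x).run f = (-1) ^ l / (l.factorial : ℝ) * (1 / P.delta ^ l *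
      ∑ i ∈ range (l + 1), (-1) ^ i * (l.choose i : ℝ) *
        (gTildeOne P (x + ((l : ℝ) - (i : ℝ)) * P.delta)).run f) := by
  simp only [gTilde, run_bind, run_sum, run_pure]

theorem queries_gTilde (n : ℕ) (P : Params) (f : ℝ → ℝ) (l : ℕ) (x : ℝ) :
    (gTilde n P l x).queries f = 2 * l := by
  cases l with
  | zero => rfl
  | succ l =>
    simp [gTilde, queries_bind, queries_sum, queries_pure, queries_gTildeOne, mul_comm]

/-- The update computed in one round. -/
noncomputable def update (n k : ℕ) (P : Params) (f : ℝ → ℝ) (x : ℝ) : ℝ :=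
  1 / (4 * P.root) * ((gTilde n P (k - 1) x).run f / (gTilde n P k x).run f)

theorem run_iterate_succ (n k : ℕ) (P : Params) (f : ℝ → ℝ) (t : ℕ) (x : ℝ) :
    (iterate n k P (t + 1) x).run f = if update n k P f x ≤ P.threshold then x else
      (iterate n k P t (x - P.grid * (⌊update n k P f x / P.grid⌋ : ℝ))).run f := by
  by_cases h : update n k P f x ≤ P.threshold
  · rw [if_pos h]
    simp only [update] at h
    simp only [iterate, run_bind]
    rw [if_pos h, run_pure]
  · rw [if_neg h]
    simp only [update] at h
    simp only [iterate, run_bind]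
    rw [if_neg h]
    rfl

theorem queries_iterate_le (n k : ℕ) (P : Params) (f : ℝ → ℝ) (t : ℕ) (x : ℝ) :
    (iterate n k P t x).queries f ≤ t * (4 * k) := by
  induction t generalizing x with
  | zero => simp [iterate, queries_pure]
  | succ t ih =>
    simp only [iterate, queries_bind, queries_gTilde]
    split_ifs
    · simp only [queries_pure]
      have : t * (4 * k) ≥ 0 := Nat.zero_le _
      rw [add_mul]; omega
    · have := ih (x - P.grid * (⌊update n k P f x / P.grid⌋ : ℝ))
      simp only [update] at this
      rw [add_mul]; omega

/-! ### Finite differences of reciprocals -/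

/-- Two neighbouring products of `l + 1` factors share all but one factor each. Over the common
denominator with `l + 2` factors the difference has numerator `y - (y + (l+1)δ) = -(l+1)δ`, which
supplies the next factor of `l! δ^l`. -/
theorem fwdDiff_iter_one_div (δ : ℝ) (hδ : 0 < δ) (l : ℕ) : ∀ y : ℝ, 0 < y →
    (fwdDiff δ)^[l] (fun t : ℝ => 1 / t) y
      = (-1) ^ l * l.factorial * δ ^ l / ∏ j ∈ range (l + 1), (y + j * δ) := by
  induction l with
  | zero => intro y hy; simp
  | succ l ih =>
    intro y hy
    rw [Function.iterate_succ', Function.comp, fwdDiff, ih y hy, ih (y + δ) (by positivity)]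
    have h1 : ∏ j ∈ range (l + 1), (y + δ + j * δ) = ∏ j ∈ range (l + 1), (y + (j + 1 : ℕ) * δ) :=
      prod_congr rfl fun j _ => by push_cast; ring
    have h2 : ∏ j ∈ range (l + 1 + 1), (y + j * δ)
        = (∏ j ∈ range (l + 1), (y + (j + 1 : ℕ) * δ)) * y := by
      rw [prod_range_succ']; simp
    have h3 : ∏ j ∈ range (l + 1 + 1), (y + j * δ)
        = (∏ j ∈ range (l + 1), (y + j * δ)) * (y + (l + 1 : ℕ) * δ) := prod_range_succ _ _
    have p1 : 0 < ∏ j ∈ range (l + 1), (y + (j + 1 : ℕ) * δ) := prod_pos fun j _ => by positivity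
    have p2 : 0 < ∏ j ∈ range (l + 1), (y + (j : ℝ) * δ) := prod_pos fun j _ => by positivity
    rw [h1]
    have e1 : (1 : ℝ) / ∏ j ∈ range (l + 1), (y + (j + 1 : ℕ) * δ)
        = y / ∏ j ∈ range (l + 1 + 1), (y + j * δ) := by
      rw [h2, mul_comm _ y, div_mul_cancel_left₀ hy.ne', one_div]
    have e2 : (1 : ℝ) / ∏ j ∈ range (l + 1), (y + j * δ)
        = (y + (l + 1 : ℕ) * δ) / ∏ j ∈ range (l + 1 + 1), (y + j * δ) := by
      rw [h3, div_mul_cancel_right₀ (by positivity), one_div]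
    have e3 : ∀ c d : ℝ, c / d = c * (1 / d) := fun c d => by ring
    rw [e3 _ (∏ j ∈ range (l + 1), (y + (j + 1 : ℕ) * δ)), e1,
      e3 _ (∏ j ∈ range (l + 1), (y + j * δ)), e2, Nat.factorial_succ]
    push_cast
    ring

theorem sum_choose_one_div (δ : ℝ) (hδ : 0 < δ) (l : ℕ) (y : ℝ) (hy : 0 < y) :
    ∑ i ∈ range (l + 1), (-1 : ℝ) ^ i * (l.choose i : ℝ) * (1 / (y + ((l : ℝ) - (i : ℝ)) * δ))
      = (-1) ^ l * l.factorial * δ ^ l / ∏ j ∈ range (l + 1), (y + j * δ) := by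
  rw [← fwdDiff_iter_one_div δ hδ l y hy, fwdDiff_iter_eq_sum_shift, ← sum_range_reflect]
  refine sum_congr rfl fun i hi => ?_
  have hi' : i ≤ l := by simpa [Nat.lt_succ_iff] using hi
  have e : l + 1 - 1 - i = l - i := by omega
  rw [e, Nat.choose_symm hi', Nat.cast_sub hi']
  simp only [zsmul_eq_mul, nsmul_eq_mul]
  push_cast
  congr 3
  ring

/-! ### Inequalities for power sums of reciprocals -/

/-- Weighted AM-GM for `k` copies of `a` and one of `s`. The inductive step multiplies by `s` and
adds `(k+1) a^k (a-s)² ≥ 0`. -/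
theorem mul_pow_le_amgm (a s : ℝ) (ha : 0 ≤ a) (hs : 0 ≤ s) (k : ℕ) :
    (k + 1) * (a ^ k * s) ≤ k * a ^ (k + 1) + s ^ (k + 1) := by
  induction k with
  | zero => simp
  | succ k ih =>
    have h1 : 0 ≤ (k + 1 : ℝ) * a ^ k * (a - s) ^ 2 := by positivity
    have h2 := mul_le_mul_of_nonneg_left ih hs
    push_cast
    have e1 : s ^ (k + 1 + 1) = s * s ^ (k + 1) := by ring
    have e2 : a ^ (k + 1 + 1) = a ^ k * a ^ 2 := by ring
    have e3 : a ^ (k + 1) = a ^ k * a := by ring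
    rw [e1, e2, e3]; rw [e3] at h2
    nlinarith

/-- The sum of the `m`-th powers of the reciprocals of the distances from `x` to the `z i`. -/
noncomputable def recipSum {n : ℕ} (z : Fin n → ℝ) (m : ℕ) (x : ℝ) : ℝ :=
  ∑ i, (1 / (x - z i)) ^ m

section recipSum

variable {n : ℕ} (z : Fin n → ℝ) (x d : ℝ) (hd : 0 < d) (h : ∀ i, d ≤ x - z i)
  (i₀ : Fin n) (h₀ : x - z i₀ = d)

include hd h

theorem pow_le_recipSum (i₀ : Fin n) (h₀ : x - z i₀ = d) (m : ℕ) :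
    (1 / d) ^ m ≤ recipSum z m x := by
  rw [← h₀]
  refine single_le_sum (f := fun i => (1 / (x - z i)) ^ m) (fun i _ => ?_) (mem_univ i₀)
  have := hd.trans_le (h i)
  positivity

theorem recipSum_le (m : ℕ) : recipSum z m x ≤ n * (1 / d) ^ m := by
  have : ∀ i ∈ (univ : Finset (Fin n)), (1 / (x - z i)) ^ m ≤ (1 / d) ^ m := fun i _ => by
    have := hd.trans_le (h i)
    gcongr
    exact h i
  have := sum_le_card_nsmul _ _ _ this
  rwa [card_univ, Fintype.card_fin, nsmul_eq_mul] at this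

theorem mul_recipSum_succ_le (m : ℕ) : d * recipSum z (m + 1) x ≤ recipSum z m x := by
  rw [recipSum, recipSum, mul_sum]
  refine sum_le_sum fun i _ => ?_
  have h1 := hd.trans_le (h i)
  rw [pow_succ, ← mul_assoc, mul_comm d, mul_assoc]
  refine mul_le_of_le_one_right (by positivity) ?_
  rw [mul_one_div, div_le_one h1]
  exact h i

/-- AM-GM is applied to each reciprocal against `s = 1/(rd)` and summed. The `n` extra terms
`s^(k+1)` amount to at most `d^(-(k+1))`, by the choice of `r`, and this is a single term of the
larger power sum. The exponent `k + 1` here is the depth of the iteration. -/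
theorem recipSum_le_mul_succ (i₀ : Fin n) (h₀ : x - z i₀ = d) (k : ℕ) (r : ℝ) (hr : 0 < r)
    (hrn : (n : ℝ) ≤ r ^ (k + 1)) :
    recipSum z k x ≤ r * d * recipSum z (k + 1) x := by
  have key : ∀ i, (k + 1) * ((1 / (x - z i)) ^ k * (1 / (r * d))) ≤
      k * (1 / (x - z i)) ^ (k + 1) + (1 / (r * d)) ^ (k + 1) := fun i => by
    have h1 := hd.trans_le (h i)
    exact mul_pow_le_amgm _ _ (by positivity) (by positivity) k
  have hs := sum_le_sum fun i (_ : i ∈ (univ : Finset (Fin n))) => key i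
  rw [← mul_sum, ← sum_mul, sum_add_distrib, ← mul_sum] at hs
  simp only [sum_const, card_univ, Fintype.card_fin, nsmul_eq_mul] at hs
  change (k + 1) * (recipSum z k x * (1 / (r * d))) ≤ k * recipSum z (k + 1) x + _ at hs
  have h2 : (n : ℝ) * (1 / (r * d)) ^ (k + 1) ≤ (1 / d) ^ (k + 1) := by
    rw [div_pow, div_pow, mul_pow, one_pow]
    rw [mul_one_div, div_le_div_iff₀ (by positivity) (by positivity), one_mul]
    gcongr
  have h3 := pow_le_recipSum z x d hd h i₀ h₀ (k + 1)
  have h4 : (k + 1) * (recipSum z k x * (1 / (r * d))) ≤ (k + 1) * recipSum z (k + 1) x := by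
    linarith
  have h5 := le_of_mul_le_mul_left h4 (by positivity)
  rw [mul_one_div, div_le_iff₀ (by positivity)] at h5
  linarith

end recipSum

/-! ### Accuracy of the approximations -/

/-- What the analysis of the iteration needs of the parameters. -/
structure Params.Good (P : Params) (n k : ℕ) (err : ℝ) : Prop where
  err_pos : 0 < err
  err_le : err ≤ 1 / 2
  one_le_root : 1 ≤ P.root
  le_root_pow : (n : ℝ) ≤ P.root ^ k
  threshold_eq : P.threshold = err / (8 * P.root)
  grid_pos : 0 < P.grid
  grid_le : P.grid ≤ P.threshold
  delta_pos : 0 < P.delta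
  delta_le : P.delta ≤ 1 / 16
  mul_delta_le : (k : ℝ) ^ 2 * P.delta ≤ P.threshold / 32
  alpha_pos : 0 < P.alpha
  mul_alpha_le : P.alpha * (n : ℝ) ^ 2 ≤ P.delta ^ (k + 1) * P.threshold ^ 2 / 2
  le_rounds : 16 * P.root * Real.log (1 / err) ≤ P.rounds

theorem Params.Good.threshold_pos {P : Params} {n k : ℕ} {err : ℝ} (hP : P.Good n k err) :
    0 < P.threshold := by
  have := hP.err_pos
  have := hP.one_le_root
  rw [hP.threshold_eq]; positivity

theorem Params.Good.threshold_le {P : Params} {n k : ℕ} {err : ℝ} (hP : P.Good n k err) :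
    P.threshold ≤ 1 / 16 := by
  have h1 := hP.err_le
  have h2 := hP.one_le_root
  rw [hP.threshold_eq, div_le_iff₀ (by positivity)]
  linarith

theorem one_add_sum_le_prod {ι : Type*} (s : Finset ι) {a : ι → ℝ} (ha : ∀ i, 0 ≤ a i) :
    1 + ∑ i ∈ s, a i ≤ ∏ i ∈ s, (1 + a i) := by
  classical
  induction s using Finset.induction_on with
  | empty => simp
  | insert i s hi ih =>
    rw [sum_insert hi, prod_insert hi]
    have h0 : 0 ≤ ∑ j ∈ s, a j := sum_nonneg fun j _ => ha j
    nlinarith [ha i, mul_nonneg (ha i) h0, mul_le_mul_of_nonneg_left ih (ha i)]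

/-- The quotient `f(x+α)/f(x)` is `∏ (1 + α/(x - z_i))`, which lies between `1 + α g_1` and `exp(α
g_1)`. The error after division by `α` is thus at most `α g_1²`, and `g_1 ≤ n/threshold`. -/
theorem gTildeOne_bounds {n : ℕ} (z : Fin n → ℝ) (f : ℝ → ℝ) (hf : ∀ x, f x = ∏ i, (x - z i))
    {P : Params} {k : ℕ} {err : ℝ} (hP : P.Good n k err) (x : ℝ)
    (hx : ∀ i, P.threshold ≤ x - z i) :
    recipSum z 1 x ≤ (gTildeOne P x).run f ∧
      (gTildeOne P x).run f ≤ recipSum z 1 x + P.delta ^ (k + 1) / 2 := by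
  have ht := hP.threshold_pos
  have hα := hP.alpha_pos
  have hy : ∀ i, 0 < x - z i := fun i => ht.trans_le (hx i)
  have hfx : 0 < f x := by rw [hf]; exact prod_pos fun i _ => hy i
  have hrun : (gTildeOne P x).run f = ((∏ i, (1 + P.alpha * (1 / (x - z i)))) - 1) / P.alpha := by
    rw [run_gTildeOne]
    have e : f (x + P.alpha) = f x * ∏ i, (1 + P.alpha * (1 / (x - z i))) := by
      rw [hf, hf, ← prod_mul_distrib]
      refine prod_congr rfl fun i _ => ?_
      have := hy i
      field_simp
      ring
    rw [e]
    field_simp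
  have hsum : ∑ i, P.alpha * (1 / (x - z i)) = P.alpha * recipSum z 1 x := by
    simp [recipSum, mul_sum]
  have hnn : ∀ i, 0 ≤ P.alpha * (1 / (x - z i)) := fun i => by
    have := hy i
    positivity
  have hlow : 1 + P.alpha * recipSum z 1 x ≤ ∏ i, (1 + P.alpha * (1 / (x - z i))) := by
    rw [← hsum]
    exact one_add_sum_le_prod _ hnn
  have hup : ∏ i, (1 + P.alpha * (1 / (x - z i))) ≤ Real.exp (P.alpha * recipSum z 1 x) := by
    rw [← hsum, Real.exp_sum]
    refine prod_le_prod (fun i _ => by linarith [hnn i]) fun i _ => ?_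
    linarith [Real.add_one_le_exp (P.alpha * (1 / (x - z i)))]
  have hG0 : 0 ≤ recipSum z 1 x := sum_nonneg fun i _ => by
    have := hy i
    positivity
  have hG : recipSum z 1 x ≤ n * (1 / P.threshold) := by
    simpa using recipSum_le z x _ ht hx 1
  have hG2 : P.alpha * recipSum z 1 x ^ 2 ≤ P.delta ^ (k + 1) / 2 := by
    have h1 : recipSum z 1 x ^ 2 ≤ (n * (1 / P.threshold)) ^ 2 := by gcongr
    calc P.alpha * recipSum z 1 x ^ 2 ≤ P.alpha * (n * (1 / P.threshold)) ^ 2 := by gcongr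
      _ = P.alpha * n ^ 2 / P.threshold ^ 2 := by field_simp
      _ ≤ (P.delta ^ (k + 1) * P.threshold ^ 2 / 2) / P.threshold ^ 2 := by
        gcongr; exact hP.mul_alpha_le
      _ = _ := by field_simp
  have hδ : P.delta ^ (k + 1) ≤ 1 := by
    have := hP.delta_le
    exact pow_le_one₀ hP.delta_pos.le (by linarith)
  -- This smallness is what the quadratic bound for the exponential needs.
  have hαG : P.alpha * recipSum z 1 x ≤ 1 := by
    have h1 : (n : ℝ) ≤ (n : ℝ) ^ 2 := by exact_mod_cast Nat.le_self_pow two_ne_zero n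
    have ht1 := hP.threshold_le
    calc P.alpha * recipSum z 1 x ≤ P.alpha * (n * (1 / P.threshold)) := by gcongr
      _ ≤ P.alpha * (n ^ 2 * (1 / P.threshold)) := by gcongr
      _ = P.alpha * n ^ 2 / P.threshold := by field_simp
      _ ≤ (P.delta ^ (k + 1) * P.threshold ^ 2 / 2) / P.threshold := by
        gcongr; exact hP.mul_alpha_le
      _ = P.delta ^ (k + 1) * (P.threshold / 2) := by field_simp
      _ ≤ 1 := mul_le_one₀ hδ (by positivity) (by linarith)
  have hexp : Real.exp (P.alpha * recipSum z 1 x)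
      ≤ 1 + P.alpha * recipSum z 1 x + (P.alpha * recipSum z 1 x) ^ 2 := by
    have := Real.abs_exp_sub_one_sub_id_le (x := P.alpha * recipSum z 1 x)
      (by rw [abs_of_nonneg (by positivity)]; exact hαG)
    linarith [le_abs_self (Real.exp (P.alpha * recipSum z 1 x) - 1 - P.alpha * recipSum z 1 x)]
  rw [hrun]
  constructor
  · rw [le_div_iff₀ hα]; linarith
  · rw [div_le_iff₀ hα]
    nlinarith
end HigherOrderNewton

namespace HigherOrderNewton

open Finset OracleComp

/-! ### Accuracy of the finite differences and the effect of one round. -/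

theorem two_pow_le_two_mul_factorial (l : ℕ) : 2 ^ l ≤ 2 * l.factorial := by
  induction l with
  | zero => simp
  | succ l ih =>
    rcases l with _ | l
    · simp
    · rw [pow_succ, Nat.factorial_succ]
      nlinarith [Nat.factorial_pos (l + 1)]

/-- Dividing by `y^(l+1)` leaves `∏ (1 + jδ/y)`, which is at least 1 and at most `exp(k² δ/d) ≤
exp(1/32)`; and `1 - t ≤ exp(-t)`. -/
theorem recip_prod_bounds (y d δ : ℝ) (k l : ℕ) (hd : 0 < d) (hy : d ≤ y) (hδ : 0 < δ)
    (hk : (k : ℝ) ^ 2 * δ ≤ d / 32) (hl : l < k) :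
    (1 - 1 / 32) * (1 / y) ^ (l + 1) ≤ 1 / ∏ j ∈ range (l + 1), (y + j * δ) ∧
      1 / ∏ j ∈ range (l + 1), (y + j * δ) ≤ (1 / y) ^ (l + 1) := by
  have hy0 : 0 < y := hd.trans_le hy
  have e : ∏ j ∈ range (l + 1), (y + j * δ)
      = y ^ (l + 1) * ∏ j ∈ range (l + 1), (1 + j * δ / y) := by
    rw [← card_range (l + 1), ← prod_const, card_range, ← prod_mul_distrib]
    refine prod_congr rfl fun j _ => by field_simp
  have h1 : 1 ≤ ∏ j ∈ range (l + 1), (1 + j * δ / y) :=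
    le_trans (le_add_of_nonneg_right (sum_nonneg fun j _ => by positivity))
      (one_add_sum_le_prod _ fun j => by positivity)
  have h2 : ∏ j ∈ range (l + 1), (1 + j * δ / y) ≤ Real.exp (1 / 32) := by
    calc ∏ j ∈ range (l + 1), (1 + j * δ / y)
        ≤ ∏ j ∈ range (l + 1), Real.exp (j * δ / y) :=
          prod_le_prod (fun j _ => by positivity) fun j _ => by
            linarith [Real.add_one_le_exp (j * δ / y)]
      _ = Real.exp (∑ j ∈ range (l + 1), j * δ / y) := (Real.exp_sum _ _).symm
      _ ≤ Real.exp (1 / 32) := by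
        apply Real.exp_le_exp.mpr
        have : ∀ j ∈ range (l + 1), (j : ℝ) * δ / y ≤ k * δ / d := fun j hj => by
          have : (j : ℝ) ≤ k := by
            have := mem_range.mp hj
            exact_mod_cast (by omega : j ≤ k)
          gcongr
        have h3 := sum_le_card_nsmul _ _ _ this
        rw [card_range, nsmul_eq_mul] at h3
        refine h3.trans ?_
        have hlk : ((l + 1 : ℕ) : ℝ) ≤ k := by exact_mod_cast hl
        calc ((l + 1 : ℕ) : ℝ) * (k * δ / d) ≤ k * (k * δ / d) := by gcongr
          _ = k ^ 2 * δ / d := by ring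
          _ ≤ (d / 32) / d := by gcongr
          _ = 1 / 32 := by field_simp
  have h4 : (1 - 1 / 32) * Real.exp (1 / 32) ≤ 1 := by
    have := Real.one_sub_le_exp_neg (1 / 32 : ℝ)
    rw [Real.exp_neg] at this
    calc (1 - 1 / 32) * Real.exp (1 / 32) ≤ (Real.exp (1 / 32))⁻¹ * Real.exp (1 / 32) := by
          gcongr
      _ = 1 := inv_mul_cancel₀ (Real.exp_pos _).ne'
  have hp : 0 < y ^ (l + 1) := by positivity
  have hprod := zero_lt_one.trans_le h1
  rw [e, one_div_pow]
  constructor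
  · rw [le_div_iff₀ (by positivity)]
    calc (1 - 1 / 32) * (1 / y ^ (l + 1)) * (y ^ (l + 1) * ∏ j ∈ range (l + 1), (1 + j * δ / y))
        = (1 - 1 / 32) * ∏ j ∈ range (l + 1), (1 + j * δ / y) := by
          rw [mul_assoc, ← mul_assoc _ (y ^ (l + 1)), one_div_mul_cancel hp.ne', one_mul]
      _ ≤ (1 - 1 / 32) * Real.exp (1 / 32) := by gcongr
      _ ≤ 1 := h4
  · exact one_div_le_one_div_of_le hp (le_mul_of_one_le_right hp.le h1)

section accuracy

variable {n : ℕ} (z : Fin n → ℝ) (f : ℝ → ℝ) (hf : ∀ x, f x = ∏ i, (x - z i))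
  {P : Params} {k : ℕ} {err : ℝ} (hP : P.Good n k err) (x d : ℝ)
  (hx : ∀ i, d ≤ x - z i) (i₀ : Fin n) (h₀ : x - z i₀ = d) (hd : P.threshold ≤ d) (hd1 : d ≤ 1)

include hf hP hx h₀ hd hd1

/-- The errors are at most `g_m/32` from replacing powers by products and `1/256` from the inexact
`g̃_1`. -/
theorem gTilde_accuracy (m : ℕ) (hm : m ≤ k) :
    |(gTilde n P m x).run f - recipSum z m x| ≤ recipSum z m x / 16 := by
  have ht := hP.threshold_pos
  have hδ := hP.delta_pos
  have hd0 : 0 < d := ht.trans_le hd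
  -- Since `d ≤ 1`, the absolute error `1/256` is also a relative error.
  have hG1 : 1 ≤ recipSum z m x := by
    refine le_trans ?_ (pow_le_recipSum z x d hd0 hx i₀ h₀ m)
    exact one_le_pow₀ (by rw [le_div_iff₀ hd0]; linarith)
  rcases m with _ | l
  · simp [run_gTilde_zero, recipSum]; positivity
  set g : ℕ → ℝ := fun i => (gTildeOne P (x + ((l : ℝ) - (i : ℝ)) * P.delta)).run f with hg
  set e : ℕ → ℝ := fun i => g i - recipSum z 1 (x + ((l : ℝ) - (i : ℝ)) * P.delta) with he
  have hE : ∀ i ∈ range (l + 1), |(-1) ^ i * (l.choose i : ℝ) * e i|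
      ≤ (l.choose i : ℝ) * (P.delta ^ (k + 1) / 2) := fun i hi => by
    have hi' : (i : ℝ) ≤ l := by
      have := mem_range.mp hi
      exact_mod_cast (by omega : i ≤ l)
    have := gTildeOne_bounds z f hf hP (x + ((l : ℝ) - (i : ℝ)) * P.delta) fun j => by
      have h1 := hx j
      have h2 : 0 ≤ ((l : ℝ) - i) * P.delta := mul_nonneg (by linarith) hδ.le
      linarith
    rw [abs_mul, abs_mul, abs_pow, abs_neg, abs_one, one_pow, one_mul, Nat.abs_cast]
    gcongr
    rw [abs_of_nonneg (by linarith [this.1])]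
    linarith [this.2]
  have hsumE : |∑ i ∈ range (l + 1), (-1) ^ i * (l.choose i : ℝ) * e i|
      ≤ 2 ^ l * (P.delta ^ (k + 1) / 2) := by
    refine (abs_sum_le_sum_abs _ _).trans ((sum_le_sum hE).trans ?_)
    rw [← sum_mul, ← Nat.cast_sum, Nat.sum_range_choose]
    push_cast
    rfl
  have hmain : ∑ i ∈ range (l + 1), (-1) ^ i * (l.choose i : ℝ) *
      recipSum z 1 (x + ((l : ℝ) - (i : ℝ)) * P.delta)
      = (-1) ^ l * l.factorial * P.delta ^ l *
        ∑ j, 1 / ∏ t ∈ range (l + 1), ((x - z j) + t * P.delta) := by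
    simp only [recipSum, pow_one, mul_sum]
    rw [sum_comm]
    refine sum_congr rfl fun j _ => ?_
    have := sum_choose_one_div P.delta hδ l (x - z j) (hd0.trans_le (hx j))
    rw [mul_one_div, ← this]
    refine sum_congr rfl fun i _ => ?_
    congr 2
    ring
  have hsplit : ∑ i ∈ range (l + 1), (-1) ^ i * (l.choose i : ℝ) * g i
      = (-1) ^ l * l.factorial * P.delta ^ l *
        (∑ j, 1 / ∏ t ∈ range (l + 1), ((x - z j) + t * P.delta))
        + ∑ i ∈ range (l + 1), (-1) ^ i * (l.choose i : ℝ) * e i := by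
    rw [← hmain, ← sum_add_distrib]
    exact sum_congr rfl fun i _ => by simp only [he]; ring
  have hfac : (0 : ℝ) < l.factorial := by exact_mod_cast l.factorial_pos
  have hrun : (gTilde n P (l + 1) x).run f
      = (∑ j, 1 / ∏ t ∈ range (l + 1), ((x - z j) + t * P.delta))
        + (-1) ^ l / (l.factorial * P.delta ^ l) *
          ∑ i ∈ range (l + 1), (-1) ^ i * (l.choose i : ℝ) * e i := by
    rw [run_gTilde_succ]
    change (-1) ^ l / (l.factorial : ℝ) * (1 / P.delta ^ l *
      ∑ i ∈ range (l + 1), (-1) ^ i * (l.choose i : ℝ) * g i) = _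
    rw [hsplit]
    generalize (∑ j, 1 / ∏ t ∈ range (l + 1), ((x - z j) + t * P.delta)) = H
    have h1 : ((-1 : ℝ) ^ l) * (-1) ^ l = 1 := by rw [← mul_pow]; simp
    field_simp
    linear_combination (l.factorial * P.delta ^ l * H) * h1
  have herr : |(-1) ^ l / (l.factorial * P.delta ^ l) *
      ∑ i ∈ range (l + 1), (-1) ^ i * (l.choose i : ℝ) * e i| ≤ 1 / 256 := by
    rw [abs_mul, abs_div, abs_pow, abs_neg, abs_one, one_pow,
      abs_of_pos (by positivity : 0 < (l.factorial : ℝ) * P.delta ^ l)]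
    -- The binomial weights sum to `2^l`, which is absorbed by `l!`. Of `δ^(k+1)/δ^l` at least `δ²`
    -- remains because `l + 1 ≤ k`.
    have h2 : (2 : ℝ) ^ l ≤ 2 * l.factorial := by exact_mod_cast two_pow_le_two_mul_factorial l
    have h3 : P.delta ^ (k + 1) ≤ P.delta ^ l * P.delta ^ 2 := by
      rw [← pow_add]
      exact pow_le_pow_of_le_one hδ.le (by linarith [hP.delta_le]) (by omega)
    calc 1 / (l.factorial * P.delta ^ l) * |∑ i ∈ range (l + 1), (-1) ^ i * (l.choose i : ℝ) * e i|
        ≤ 1 / (l.factorial * P.delta ^ l) * (2 ^ l * (P.delta ^ (k + 1) / 2)) := by gcongr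
      _ ≤ 1 / (l.factorial * P.delta ^ l) *
          ((2 * l.factorial) * (P.delta ^ l * P.delta ^ 2 / 2)) := by gcongr
      _ = P.delta ^ 2 := by field_simp
      _ ≤ (1 / 16) ^ 2 := by have := hP.delta_le; gcongr
      _ = 1 / 256 := by norm_num
  have hb := fun j : Fin n => recip_prod_bounds (x - z j) d P.delta k l hd0 (hx j) hδ
    (hP.mul_delta_le.trans (by linarith)) hm
  have hlow : (1 - 1 / 32) * recipSum z (l + 1) x
      ≤ ∑ j, 1 / ∏ t ∈ range (l + 1), ((x - z j) + t * P.delta) := by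
    rw [recipSum, mul_sum]
    exact sum_le_sum fun j _ => (hb j).1
  have hup : ∑ j, 1 / ∏ t ∈ range (l + 1), ((x - z j) + t * P.delta) ≤ recipSum z (l + 1) x :=
    sum_le_sum fun j _ => (hb j).2
  rw [hrun, abs_le]
  rw [abs_le] at herr
  constructor <;> linarith [herr.1, herr.2]

theorem gTilde_pos (m : ℕ) (hm : m ≤ k) : 0 < (gTilde n P m x).run f := by
  have h := gTilde_accuracy z f hf hP x d hx i₀ h₀ hd hd1 m hm
  have hd0 : 0 < d := hP.threshold_pos.trans_le hd
  have h1 := pow_le_recipSum z x d hd0 hx i₀ h₀ m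
  have h2 : 0 < (1 / d) ^ m := by positivity
  rw [abs_le] at h
  linarith [h.1]

/-- The ratio of the exact sums lies in `[d, r d]`; the relative errors of numerator and denominator
change it by at most the factor `(1 + 1/16)/(1 - 1/16) = 17/15` either way. -/
theorem update_bounds (hk : 1 ≤ k) :
    15 / 17 * (d / (4 * P.root)) ≤ update n k P f x ∧ update n k P f x ≤ 17 / 15 * (d / 4) := by
  obtain ⟨k, rfl⟩ : ∃ j, k = j + 1 := ⟨k - 1, by omega⟩
  have hd0 : 0 < d := hP.threshold_pos.trans_le hd
  have hr : 0 < P.root := by linarith [hP.one_le_root]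
  have ha := abs_le.mp (gTilde_accuracy z f hf hP x d hx i₀ h₀ hd hd1 k (by omega))
  have hb := abs_le.mp (gTilde_accuracy z f hf hP x d hx i₀ h₀ hd hd1 (k + 1) le_rfl)
  have hbp := gTilde_pos z f hf hP x d hx i₀ h₀ hd hd1 (k + 1) le_rfl
  have h1 := mul_recipSum_succ_le z x d hd0 hx k
  have h2 := recipSum_le_mul_succ z x d hd0 hx i₀ h₀ k P.root hr hP.le_root_pow
  rw [update, Nat.add_sub_cancel]
  set a := (gTilde n P k x).run f
  set b := (gTilde n P (k + 1) x).run f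
  have h3 : 15 / 17 * d ≤ a / b := by
    rw [le_div_iff₀ hbp]
    nlinarith [mul_le_mul_of_nonneg_left hb.2 hd0.le]
  have h4 : a / b ≤ 17 / 15 * (P.root * d) := by
    rw [div_le_iff₀ hbp]
    have h5 : 0 < P.root * d := by positivity
    nlinarith [mul_le_mul_of_nonneg_left hb.1 h5.le]
  constructor
  · calc 15 / 17 * (d / (4 * P.root)) = 1 / (4 * P.root) * (15 / 17 * d) := by ring
      _ ≤ _ := by gcongr
  · calc 1 / (4 * P.root) * (a / b) ≤ 1 / (4 * P.root) * (17 / 15 * (P.root * d)) := by gcongr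
      _ = _ := by field_simp

/-- A round that stops is close to the root; a round that does not stop stays to the right of it
and gets closer. -/
theorem round_bounds (hk : 1 ≤ k) :
    (update n k P f x ≤ P.threshold → d ≤ err) ∧
    (P.threshold < update n k P f x →
      P.threshold ≤ d - P.grid * (⌊update n k P f x / P.grid⌋ : ℝ) ∧
      0 ≤ P.grid * (⌊update n k P f x / P.grid⌋ : ℝ) ∧
      d - P.grid * (⌊update n k P f x / P.grid⌋ : ℝ) ≤ d * (1 - 1 / (16 * P.root))) := by
  obtain ⟨h1, h2⟩ := update_bounds z f hf hP x d hx i₀ h₀ hd hd1 hk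
  have hr : 0 < P.root := by linarith [hP.one_le_root]
  have ht := hP.threshold_pos
  have hg := hP.grid_pos
  set u := update n k P f x
  constructor
  · intro h
    have h3 := h1.trans h
    rw [hP.threshold_eq] at h3
    -- With the threshold `err/(8r)` this yields `d ≤ (17/30) err`.
    have h4 : 15 / 17 * (d / (4 * P.root)) = (15 / 17 * 2 * d) / (8 * P.root) := by
      field_simp; ring
    rw [h4, div_le_div_iff_of_pos_right (by positivity)] at h3
    have := ht.trans_le hd
    linarith
  · intro h
    have hle := Int.floor_le (u / P.grid)
    have hlt := Int.lt_floor_add_one (u / P.grid)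
    have h1u : 1 ≤ u / P.grid := by
      rw [le_div_iff₀ hg]; linarith [hP.grid_le]
    have hf1 : (1 : ℝ) ≤ ⌊u / P.grid⌋ := by
      exact_mod_cast Int.le_floor.mpr (by exact_mod_cast h1u)
    have hup : P.grid * (⌊u / P.grid⌋ : ℝ) ≤ u := by
      rw [le_div_iff₀ hg] at hle; linarith
    -- The update exceeds one grid unit, so the floor is at least 1 and rounding down loses at most
    -- half of the update.
    have hlow : u / 2 ≤ P.grid * (⌊u / P.grid⌋ : ℝ) := by
      rw [div_lt_iff₀ hg] at hlt
      nlinarith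
    have hd0 := ht.trans_le hd
    refine ⟨by linarith, by linarith, ?_⟩
    have : d * (1 - 1 / (16 * P.root)) = d - d / (4 * P.root) / 4 := by field_simp; ring
    have h5 : 0 < d / (4 * P.root) := by positivity
    rw [this]
    linarith

end accuracy

/-! ### Convergence of the iteration. -/

/-- An alternative is needed in the conclusion because a run that stops early contracts no further;
in that case the stopping test itself bounds the error. -/
theorem iterate_bounds {n : ℕ} (z : Fin n → ℝ) (f : ℝ → ℝ) (hf : ∀ x, f x = ∏ i, (x - z i))
    {P : Params} {k : ℕ} {err : ℝ} (hP : P.Good n k err) (hk : 1 ≤ k) (i₀ : Fin n)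
    (hi₀ : ∀ i, z i ≤ z i₀) (t : ℕ) : ∀ x : ℝ, P.threshold ≤ x - z i₀ → x - z i₀ ≤ 1 →
    0 ≤ (iterate n k P t x).run f - z i₀ ∧
    ((iterate n k P t x).run f - z i₀ ≤ err ∨
      (iterate n k P t x).run f - z i₀ ≤ (x - z i₀) * (1 - 1 / (16 * P.root)) ^ t) := by
  induction t with
  | zero =>
    intro x hx hx1
    have := hP.threshold_pos
    simp only [iterate, run_pure, pow_zero, mul_one]
    exact ⟨by linarith, Or.inr le_rfl⟩
  | succ t ih =>
    intro x hx hx1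
    obtain ⟨h1, h2⟩ := round_bounds z f hf hP x (x - z i₀) (fun i => by linarith [hi₀ i]) i₀ rfl
      hx hx1 hk
    have ht := hP.threshold_pos
    rw [run_iterate_succ]
    by_cases h : update n k P f x ≤ P.threshold
    · rw [if_pos h]
      exact ⟨by linarith, Or.inl (h1 h)⟩
    · rw [if_neg h]
      obtain ⟨h3, h4, h5⟩ := h2 (not_le.mp h)
      set s := P.grid * (⌊update n k P f x / P.grid⌋ : ℝ)
      obtain ⟨h6, h7⟩ := ih (x - s) (by linarith) (by linarith)
      refine ⟨h6, h7.imp_right fun h8 => h8.trans ?_⟩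
      have hr := hP.one_le_root
      have hq : 0 ≤ 1 - 1 / (16 * P.root) := by
        rw [sub_nonneg, div_le_one (by positivity)]; linarith
      rw [pow_succ', ← mul_assoc]
      gcongr
      linarith

theorem newton_bounds {n : ℕ} (z : Fin n → ℝ) (f : ℝ → ℝ) (hf : ∀ x, f x = ∏ i, (x - z i))
    {P : Params} {k : ℕ} {err : ℝ} (hP : P.Good n k err) (hk : 1 ≤ k) (i₀ : Fin n)
    (hi₀ : ∀ i, z i ≤ z i₀) (hz0 : 0 ≤ z i₀) (hz1 : z i₀ ≤ 1 / 2) :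
    0 ≤ (newton n k P).run f - z i₀ ∧ (newton n k P).run f - z i₀ ≤ err := by
  have ht := hP.threshold_le
  obtain ⟨h1, h2⟩ := iterate_bounds z f hf hP hk i₀ hi₀ P.rounds 1 (by linarith) (by linarith)
  refine ⟨h1, h2.elim id fun h => h.trans ?_⟩
  have hr := hP.one_le_root
  have he := hP.err_pos
  have hq : 0 ≤ 1 - 1 / (16 * P.root) := by
    rw [sub_nonneg, div_le_one (by positivity)]; linarith
  -- From `1 - t ≤ exp(-t)` and at least `16 r log(1/err)` rounds.
  have h3 : (1 - 1 / (16 * P.root)) ^ P.rounds ≤ err := by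
    calc (1 - 1 / (16 * P.root)) ^ P.rounds
        ≤ Real.exp (-(1 / (16 * P.root))) ^ P.rounds := by
          gcongr
          exact Real.one_sub_le_exp_neg _
      _ = Real.exp (-(P.rounds / (16 * P.root))) := by
          rw [← Real.exp_nat_mul]; congr 1; ring
      _ ≤ Real.exp (-Real.log (1 / err)) := by
          gcongr
          rw [le_div_iff₀ (by positivity)]
          linarith [hP.le_rounds]
      _ = err := by rw [one_div, Real.log_inv, neg_neg, Real.exp_log he]
  calc (1 - z i₀) * (1 - 1 / (16 * P.root)) ^ P.rounds ≤ 1 * err := by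
        gcongr
        linarith
    _ = err := one_mul _

end HigherOrderNewton

namespace HigherOrderNewton

open Finset OracleComp

/-! ### The two choices of parameters, and the output guarantee. -/

/-- Roots are listed with multiplicity, so a split monic polynomial has exactly `n` of them. -/
theorem exists_roots_fun (p : Polynomial ℝ) (n : ℕ) (hn : p.natDegree = n) (hm : p.Monic)
    (hs : p.Splits) :
    ∃ z : Fin n → ℝ, (∀ x, p.eval x = ∏ i, (x - z i)) ∧ ∀ x, p.IsRoot x ↔ ∃ i, z i = x := by
  have hc : p.roots.toList.length = n := by
    rw [Multiset.length_toList, ← hn, hs.natDegree_eq_card_roots]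
  subst hc
  have h1 : ∀ x, p.eval x = ∏ i : Fin p.roots.toList.length, (x - p.roots.toList.get i) := by
    intro x
    rw [hs.eval_eq_prod_roots_of_monic hm, ← List.prod_ofFn,
      show (fun i => x - p.roots.toList.get i) = (fun y => x - y) ∘ p.roots.toList.get from rfl,
      ← List.map_ofFn, List.ofFn_get, ← Multiset.prod_coe, ← Multiset.map_coe,
      Multiset.coe_toList]
  refine ⟨p.roots.toList.get, h1, fun x => ?_⟩
  rw [Polynomial.IsRoot, h1, prod_eq_zero_iff]
  simp only [mem_univ, true_and, sub_eq_zero]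
  exact exists_congr fun i => eq_comm

theorem le_up2 {y : ℝ} (hy : 0 < y) : y ≤ up2 y := by
  have h := Int.le_ceil (Real.logb 2 y)
  rw [up2, ← Real.rpow_intCast]
  calc y = (2 : ℝ) ^ Real.logb 2 y := (Real.rpow_logb (by norm_num) (by norm_num) hy).symm
    _ ≤ _ := Real.rpow_le_rpow_of_exponent_le (by norm_num) h

theorem up2_le {y : ℝ} (hy : 0 < y) : up2 y ≤ 2 * y := by
  have h := (Int.ceil_lt_add_one (Real.logb 2 y)).le
  rw [up2, ← Real.rpow_intCast]
  calc (2 : ℝ) ^ ((⌈Real.logb 2 y⌉ : ℤ) : ℝ) ≤ (2 : ℝ) ^ (Real.logb 2 y + 1) :=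
        Real.rpow_le_rpow_of_exponent_le (by norm_num) h
    _ = 2 * y := by
      rw [Real.rpow_add (by norm_num), Real.rpow_logb (by norm_num) (by norm_num) hy,
        Real.rpow_one, mul_comm]

/-- Only inequalities on `L, r, b, κ, ν` are required, and they survive rounding up. This treats the
exact and the dyadic version at once. -/
theorem mkParams_good {n k : ℕ} {err L r b κ ν : ℝ} (hn : 1 ≤ n) (hk : 1 ≤ k) (he : 0 < err)
    (he2 : err ≤ 1 / 2) (hL : Real.log (1 / err) ≤ L) (hr : 1 ≤ r) (hrn : (n : ℝ) ≤ r ^ k)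
    (hb : 4 ≤ b) (hκ : (k : ℝ) ≤ κ) (hν : (n : ℝ) ≤ ν) : (mkParams k err L r b κ ν).Good n k err := by
  have hn' : (1 : ℝ) ≤ n := by exact_mod_cast hn
  have hk' : (1 : ℝ) ≤ k := by exact_mod_cast hk
  have hr0 : 0 < r := by linarith
  have hν0 : 0 < ν := by linarith
  have hκ0 : 0 < κ := by linarith
  have hb0 : 0 < b := by linarith
  have ht : 0 < err / (8 * r) := by positivity
  have ht1 : err / (8 * r) ≤ 1 / 16 := by
    rw [div_le_div_iff₀ (by positivity) (by norm_num)]; linarith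
  -- From `4^k = 2^k 2^k`; this gives `2 k² ≤ b^k κ`, hence `k² δ ≤ ε'/32`.
  have hbk : 2 * (k : ℝ) ≤ b ^ k := by
    have h1 : (k : ℝ) ≤ 2 ^ k := by exact_mod_cast Nat.lt_two_pow_self.le
    have h2 : (2 : ℝ) ≤ 2 ^ k := by
      simpa using pow_le_pow_right₀ (by norm_num : (1 : ℝ) ≤ 2) hk
    calc 2 * (k : ℝ) ≤ 2 ^ k * 2 ^ k := by gcongr
      _ = 4 ^ k := by rw [← mul_pow]; norm_num
      _ ≤ b ^ k := by gcongr
  have hbk1 : 1 ≤ b ^ k := by linarith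
  refine
    { err_pos := he
      err_le := he2
      one_le_root := hr
      le_root_pow := hrn
      threshold_eq := rfl
      grid_pos := by dsimp only [mkParams]; positivity
      grid_le := div_le_self ht.le (by linarith)
      delta_pos := by dsimp only [mkParams]; positivity
      delta_le := ?_
      mul_delta_le := ?_
      alpha_pos := by dsimp only [mkParams]; positivity
      mul_alpha_le := ?_
      le_rounds := ?_ }
  · dsimp only [mkParams]
    refine (div_le_self ht.le ?_).trans ht1
    have : 1 ≤ b ^ k * κ := one_le_mul_of_one_le_of_one_le hbk1 (by linarith)
    linarith
  · dsimp only [mkParams]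
    rw [← mul_div_assoc, div_le_div_iff₀ (by positivity) (by norm_num)]
    have h1 : 2 * (k : ℝ) ^ 2 ≤ b ^ k * κ := by
      calc 2 * (k : ℝ) ^ 2 = 2 * k * k := by ring
        _ ≤ b ^ k * κ := by gcongr
    nlinarith
  · dsimp only [mkParams]
    rw [div_mul_eq_mul_div, div_le_div_iff₀ (by positivity) (by norm_num)]
    have h1 : (n : ℝ) ^ 2 ≤ ν ^ 2 := by gcongr
    have h2 : 0 ≤ (err / (8 * r) / (16 * b ^ k * κ)) ^ (k + 1) * (err / (8 * r)) ^ 2 := by positivity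
    nlinarith [mul_le_mul_of_nonneg_left h1 h2]
  · dsimp only [mkParams]
    refine le_trans ?_ (Nat.le_ceil _)
    gcongr

theorem one_le_rpow_inv {n k : ℕ} (hn : 1 ≤ n) : (1 : ℝ) ≤ (n : ℝ) ^ (1 / (k : ℝ)) :=
  Real.one_le_rpow (by exact_mod_cast hn) (by positivity)

theorem rpow_inv_pow {n k : ℕ} (hk : 1 ≤ k) : ((n : ℝ) ^ (1 / (k : ℝ))) ^ k = n := by
  rw [one_div, Real.rpow_inv_natCast_pow (by positivity) (by omega)]

theorem four_le_two_mul_exp : 4 ≤ 2 * Real.exp 1 := by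
  linarith [Real.add_one_le_exp (1 : ℝ)]

theorem exactParams_good {n k : ℕ} {ε : ℝ} (hn : 1 ≤ n) (hk : 1 ≤ k) (hε : 0 < ε)
    (hε2 : ε ≤ 1 / 2) : (exactParams n k ε).Good n k ε :=
  mkParams_good hn hk hε hε2 le_rfl (one_le_rpow_inv hn) (rpow_inv_pow hk).ge
    four_le_two_mul_exp le_rfl le_rfl

theorem dyadicParams_good {n k : ℕ} {ε : ℝ} (hn : 1 ≤ n) (hk : 1 ≤ k) (hε : 0 < ε)
    (hε2 : ε ≤ 1 / 2) : (dyadicParams n k ε).Good n k (1 / up2 (1 / ε)) := by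
  have h1 := le_up2 (one_div_pos.mpr hε)
  have h2 : 2 ≤ 1 / ε := by rw [le_div_iff₀ hε]; linarith
  have hu : 0 < up2 (1 / ε) := by linarith
  have hr := le_up2 (zero_lt_one.trans_le (one_le_rpow_inv (k := k) hn))
  have hr1 := one_le_rpow_inv (k := k) hn
  refine mkParams_good hn hk (by positivity) ?_ ?_ (hr1.trans hr) ?_
    (four_le_two_mul_exp.trans (le_up2 (by positivity))) (le_up2 (by exact_mod_cast hk))
    (le_up2 (by exact_mod_cast hn))
  · exact one_div_le_one_div_of_le (by norm_num) (h2.trans h1)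
  -- The binary logarithm exceeds the natural one, since `log 2 < 1`.
  · rw [one_div_one_div, Real.logb]
    refine le_div_self (Real.log_nonneg (by linarith)) (Real.log_pos (by norm_num)) ?_
    linarith [Real.log_two_lt_d9]
  · calc (n : ℝ) = ((n : ℝ) ^ (1 / (k : ℝ))) ^ k := (rpow_inv_pow hk).symm
      _ ≤ _ := by gcongr

theorem half_le_log {ε : ℝ} (hε : 0 < ε) (hε2 : ε ≤ 1 / 2) : 1 / 2 ≤ Real.log (1 / ε) := by
  have h2 : 2 ≤ 1 / ε := by rw [le_div_iff₀ hε]; linarith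
  linarith [Real.log_two_gt_d9, Real.log_le_log (by norm_num) h2]

/-- The product `16 · 2 · 4` contributes 128; the ceiling adds at most `1 ≤ 2 ρ l`. -/
theorem mkParams_rounds_le {k : ℕ} {err L r b κ ν ρ l : ℝ} (hr : 0 ≤ r) (hL : 0 ≤ L)
    (hrρ : r ≤ 2 * ρ) (hLl : L ≤ 4 * l) (hρ : 1 ≤ ρ) (hl : 1 / 2 ≤ l) :
    ((mkParams k err L r b κ ν).rounds : ℝ) ≤ 130 * (ρ * l) := by
  have h1 := (Nat.ceil_lt_add_one (by positivity : 0 ≤ 16 * r * L)).le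
  have h2 : r * L ≤ 2 * ρ * (4 * l) := by gcongr
  have h3 : (1 : ℝ) * (1 / 2) ≤ ρ * l := by gcongr
  change ((⌈16 * r * L⌉₊ : ℕ) : ℝ) ≤ _
  linarith

theorem logb_up2_le {ε : ℝ} (hε : 0 < ε) (hε2 : ε ≤ 1 / 2) :
    Real.logb 2 (up2 (1 / ε)) ≤ 4 * Real.log (1 / ε) := by
  have h1 := half_le_log hε hε2
  have h2 : 2 ≤ 1 / ε := by rw [le_div_iff₀ hε]; linarith
  have hu := le_up2 (one_div_pos.mpr hε)
  have h3 : Real.log (up2 (1 / ε)) ≤ 2 * Real.log (1 / ε) := by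
    rw [two_mul, ← Real.log_mul (by positivity) (by positivity)]
    refine Real.log_le_log (by linarith) ((up2_le (by positivity)).trans ?_)
    gcongr
  rw [Real.logb, div_le_iff₀ (Real.log_pos (by norm_num))]
  nlinarith [Real.log_two_gt_d9]

theorem rounds_le {n k : ℕ} {ε : ℝ} (hn : 1 ≤ n) (hε : 0 < ε)
    (hε2 : ε ≤ 1 / 2) {P : Params} (hP : P = exactParams n k ε ∨ P = dyadicParams n k ε) :
    (P.rounds : ℝ) ≤ 130 * ((n : ℝ) ^ (1 / (k : ℝ)) * Real.log (1 / ε)) := by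
  have h1 := half_le_log hε hε2
  have h2 : 2 ≤ 1 / ε := by rw [le_div_iff₀ hε]; linarith
  have hr1 := one_le_rpow_inv (k := k) hn
  have hu := le_up2 (one_div_pos.mpr hε)
  have hru := le_up2 (zero_lt_one.trans_le hr1)
  rcases hP with rfl | rfl
  · exact mkParams_rounds_le (by linarith) (by linarith) (by linarith) (by linarith) hr1 h1
  · exact mkParams_rounds_le (by linarith) (Real.logb_nonneg (by norm_num) (by linarith))
      (up2_le (by linarith)) (logb_up2_le hε hε2) hr1 h1

theorem newton_guarantee : ∃ C : ℝ, ∀ (n k : ℕ) (ε : ℝ) (p : Polynomial ℝ) (lam : ℝ),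
      1 ≤ n → 1 ≤ k → 0 < ε → ε ≤ 1 / 2 →
      p.Monic → p.natDegree = n → p.Splits → (∀ x, p.IsRoot x → x ∈ Set.Icc (0 : ℝ) (1 / 2)) →
      IsGreatest {x : ℝ | p.IsRoot x} lam →
      ∀ P : Params, (P = exactParams n k ε ∨ P = dyadicParams n k ε) →
        0 ≤ (newton n k P).run (fun x => p.eval x) - lam ∧
        (newton n k P).run (fun x => p.eval x) - lam ≤ ε ∧
        ((newton n k P).queries (fun x => p.eval x) : ℝ)
          ≤ C * ((k : ℝ) * (n : ℝ) ^ (1 / (k : ℝ)) * Real.log (1 / ε)) := by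
  -- There are at most `130 n^(1/k) log(1/ε)` rounds, with at most `4k` evaluations each.
  refine ⟨520, fun n k ε p lam hn hk hε hε2 hm hdeg hs hroots hlam P hP => ?_⟩
  obtain ⟨z, hz, hzr⟩ := exists_roots_fun p n hdeg hm hs
  obtain ⟨i₀, rfl⟩ := (hzr lam).mp hlam.1
  have hi₀ : ∀ i, z i ≤ z i₀ := fun i => hlam.2 ((hzr _).mpr ⟨i, rfl⟩)
  obtain ⟨hz0, hz1⟩ := hroots _ hlam.1
  have hmain : 0 ≤ (newton n k P).run (fun x => p.eval x) - z i₀ ∧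
      (newton n k P).run (fun x => p.eval x) - z i₀ ≤ ε := by
    rcases hP with rfl | rfl
    · exact newton_bounds z _ hz (exactParams_good hn hk hε hε2) hk i₀ hi₀ hz0 hz1
    · obtain ⟨h1, h2⟩ := newton_bounds z _ hz (dyadicParams_good hn hk hε hε2) hk i₀ hi₀ hz0 hz1
      refine ⟨h1, h2.trans ?_⟩
      rw [one_div_le (by linarith [le_up2 (one_div_pos.mpr hε), one_div_pos.mpr hε]) hε]
      exact le_up2 (one_div_pos.mpr hε)
  refine ⟨hmain.1, hmain.2, ?_⟩
  have hq := queries_iterate_le n k P (fun x => p.eval x) P.rounds 1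
  have hr := rounds_le hn hε hε2 hP
  calc ((newton n k P).queries (fun x => p.eval x) : ℝ) ≤ ((P.rounds * (4 * k) : ℕ) : ℝ) := by
        exact_mod_cast hq
    _ = P.rounds * (4 * k) := by push_cast; ring
    _ ≤ 130 * ((n : ℝ) ^ (1 / (k : ℝ)) * Real.log (1 / ε)) * (4 * k) := by gcongr
    _ = _ := by ring

end HigherOrderNewton

namespace HigherOrderNewton

/-! ### Lengths of integers -/

theorem one_le_bits (z : ℤ) : 1 ≤ bits z := Nat.le_add_left _ _

theorem bits_le_of_lt {z : ℤ} {m : ℕ} (h : z.natAbs < 2 ^ m) : bits z ≤ m + 1 :=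
  Nat.add_le_add_right (Nat.size_le.mpr h) 1

theorem bits_mono {a b : ℤ} (h : a.natAbs ≤ b.natAbs) : bits a ≤ bits b :=
  Nat.add_le_add_right (Nat.size_le_size h) 1

theorem bits_mono_of_nonneg {a b : ℤ} (ha : 0 ≤ a) (h : a ≤ b) : bits a ≤ bits b :=
  bits_mono (by omega)

theorem bits_neg (a : ℤ) : bits (-a) = bits a := by simp [bits]

/-- This sharp form keeps the numerator of a sum of two fractions at length `2w + 1`; subadditivity
alone would give `4w`, and the total length would double at every level of the summation tree. -/
theorem bits_add_le_max (a b : ℤ) : bits (a + b) ≤ max (bits a) (bits b) + 1 := by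
  have ha := Nat.lt_size_self a.natAbs
  have hb := Nat.lt_size_self b.natAbs
  have h1 : 2 ^ a.natAbs.size ≤ 2 ^ max a.natAbs.size b.natAbs.size :=
    Nat.pow_le_pow_right (by norm_num) (le_max_left _ _)
  have h2 : 2 ^ b.natAbs.size ≤ 2 ^ max a.natAbs.size b.natAbs.size :=
    Nat.pow_le_pow_right (by norm_num) (le_max_right _ _)
  have h3 := bits_le_of_lt (z := a + b) (m := max a.natAbs.size b.natAbs.size + 1) (by
    rw [pow_succ]
    have := Int.natAbs_add_le a b
    omega)
  simp only [bits] at *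
  omega

theorem bits_add_le (a b : ℤ) : bits (a + b) ≤ bits a + bits b := by
  have := bits_add_le_max a b
  have := one_le_bits a
  have := one_le_bits b
  omega

theorem bits_sub_le (a b : ℤ) : bits (a - b) ≤ bits a + bits b := by
  rw [sub_eq_add_neg, ← bits_neg b]
  exact bits_add_le _ _

theorem bits_mul_le (a b : ℤ) : bits (a * b) ≤ bits a + bits b := by
  have ha := Nat.lt_size_self a.natAbs
  have hb := Nat.lt_size_self b.natAbs
  have h := bits_le_of_lt (z := a * b) (m := a.natAbs.size + b.natAbs.size) (by
    rw [Int.natAbs_mul, pow_add]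
    exact Nat.mul_lt_mul'' ha hb)
  simp only [bits] at *
  omega

theorem bits_ediv_le (a b : ℤ) : bits (a / b) ≤ bits a :=
  bits_mono (Int.natAbs_ediv_le_natAbs a b)

theorem bits_two_pow (j : ℕ) : bits (2 ^ j) = j + 2 := by
  have : ((2 : ℤ) ^ j).natAbs = 2 ^ j := by simp [Int.natAbs_pow]
  rw [bits, this, Nat.size_pow]

theorem bits_le_of_le_two_pow {z : ℤ} {m : ℕ} (h0 : 0 ≤ z) (h : z ≤ 2 ^ m) : bits z ≤ m + 2 :=
  (bits_mono_of_nonneg h0 h).trans (bits_two_pow m).le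

/-! ### Bounds for the cost of expressions -/

namespace Expr

/-- The total length of the numbers at the leaves of an expression. -/
def width (σ : State) : Expr → ℕ
  | const c => bits c
  | reg i => bits (σ.reg i)
  | mem a => a.width σ + bits (σ.mem (a.eval σ))
  | add e f => e.width σ + f.width σ
  | sub e f => e.width σ + f.width σ
  | mul e f => e.width σ + f.width σ
  | div e f => e.width σ + f.width σ

/-- The number of operations and leaves of an expression. -/
def nodes : Expr → ℕ
  | const _ => 1
  | reg _ => 1
  | mem a => a.nodes + 1
  | add e f => e.nodes + f.nodes + 1
  | sub e f => e.nodes + f.nodes + 1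
  | mul e f => e.nodes + f.nodes + 1
  | div e f => e.nodes + f.nodes + 1

/-- No operation produces a result longer than its operands together; for sums this uses that every
length is at least 1. So `width` controls all intermediate values. -/
theorem bits_eval_le_width (σ : State) (e : Expr) : bits (e.eval σ) ≤ e.width σ := by
  induction e with
  | const c => exact le_rfl
  | reg i => exact le_rfl
  | mem a ih => exact Nat.le_add_left _ _
  | add e f he hf => exact (bits_add_le _ _).trans (Nat.add_le_add he hf)
  | sub e f he hf => exact (bits_sub_le _ _).trans (Nat.add_le_add he hf)
  | mul e f he hf => exact (bits_mul_le _ _).trans (Nat.add_le_add he hf)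
  | div e f he hf => exact (bits_ediv_le _ _).trans (he.trans (Nat.le_add_right _ _))

end Expr

/-- Up to length `w`, multiplication is slower than addition by a factor of at most `Λ`. -/
def SlowTo (w Λ : ℕ) : Prop := 1 ≤ Λ ∧ ∀ b ≤ w, fastCost b ≤ b * Λ

theorem SlowTo.mono {w w' Λ : ℕ} (h : SlowTo w Λ) (hw : w' ≤ w) : SlowTo w' Λ :=
  ⟨h.1, fun b hb => h.2 b (hb.trans hw)⟩

theorem SlowTo.le {w Λ : ℕ} (h : SlowTo w Λ) : w ≤ w * Λ := Nat.le_mul_of_pos_right w h.1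

/-- Both factors `log b` and `log log b` are bounded by `size w + 1`. -/
theorem slowTo_sq_size (w : ℕ) : SlowTo w ((Nat.size w + 1) ^ 2) := by
  refine ⟨Nat.one_le_pow _ _ (Nat.succ_pos _), fun b hb => ?_⟩
  have h1 : Nat.size b ≤ Nat.size w + 1 := (Nat.size_le_size hb).trans (Nat.le_succ _)
  have h2 : Nat.size (Nat.size b) ≤ Nat.size w + 1 :=
    (Nat.size_le.mpr Nat.lt_two_pow_self).trans h1
  rw [fastCost, mul_assoc, pow_two]
  gcongr

/-- Each node is charged at most one unit `w Λ`. All later running times are counted in such units.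
-/
theorem Expr.cost_le {σ : State} {w Λ : ℕ} (hs : SlowTo w Λ) (e : Expr) (hw : e.width σ ≤ w) :
    e.cost σ ≤ e.nodes * (w * Λ) := by
  have hΛ := hs.le
  have key : ∀ e f : Expr, e.width σ + f.width σ ≤ w →
      bits (e.eval σ) + bits (f.eval σ) ≤ w * Λ ∧
      fastCost (bits (e.eval σ) + bits (f.eval σ)) ≤ w * Λ := fun e f h => by
    have h1 := e.bits_eval_le_width σ
    have h2 := f.bits_eval_le_width σ
    have h3 := hs.2 _ (by omega : bits (e.eval σ) + bits (f.eval σ) ≤ w)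
    have h4 : (bits (e.eval σ) + bits (f.eval σ)) * Λ ≤ w * Λ :=
      Nat.mul_le_mul_right _ (by omega)
    omega
  induction e with
  | const c => simp only [width, cost, nodes] at *; omega
  | reg i => simp only [width, cost, nodes] at *; omega
  | mem a ih =>
    have h1 := a.bits_eval_le_width σ
    simp only [width, cost, nodes] at *
    have := ih (by omega)
    rw [add_mul]; omega
  | add e f he hf =>
    simp only [width, cost, nodes] at *
    have := he (by omega)
    have := hf (by omega)
    have := key e f hw
    rw [add_mul, add_mul]; omega
  | sub e f he hf =>
    simp only [width, cost, nodes] at *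
    have := he (by omega)
    have := hf (by omega)
    have := key e f hw
    rw [add_mul, add_mul]; omega
  | mul e f he hf =>
    simp only [width, cost, nodes] at *
    have := he (by omega)
    have := hf (by omega)
    have := key e f hw
    rw [add_mul, add_mul]; omega
  | div e f he hf =>
    simp only [width, cost, nodes] at *
    have := he (by omega)
    have := hf (by omega)
    have := key e f hw
    rw [add_mul, add_mul]; omega

theorem Expr.cost_add_bits_le {σ : State} {w Λ : ℕ} (hs : SlowTo w Λ) (e : Expr)
    (hw : e.width σ ≤ w) : e.cost σ + bits (e.eval σ) ≤ (e.nodes + 1) * (w * Λ) := by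
  have h1 := e.cost_le hs hw
  have h2 := e.bits_eval_le_width σ
  have h3 := hs.le
  rw [add_mul]; omega

/-! ### Total correctness with a bound for the running time -/

/-- The program `c`, started in `σ`, halts after at most `b` bit operations in a state with
property `Q`. -/
def Runs (ev : ℤ → ℤ → ℤ × ℤ) (T : ℕ → ℕ) (c : Prog) (σ : State) (b : ℕ) (Q : State → Prop) :
    Prop :=
  ∃ σ' t, Exec ev T c σ σ' t ∧ t ≤ b ∧ Q σ'

section rules

variable {ev : ℤ → ℤ → ℤ × ℤ} {T : ℕ → ℕ} {c d : Prog} {σ : State} {a b m : ℕ}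
  {Q R : State → Prop} {w Λ : ℕ} {e f : Expr} {i j : ℕ}

theorem Runs.mono (h : Runs ev T c σ a R) (hab : a ≤ b) (hQ : ∀ σ', R σ' → Q σ') :
    Runs ev T c σ b Q :=
  let ⟨σ', t, h1, h2, h3⟩ := h
  ⟨σ', t, h1, h2.trans hab, hQ σ' h3⟩

theorem Runs.seq (h : Runs ev T c σ a R) (h' : ∀ σ', R σ' → Runs ev T d σ' b Q) (hm : a + b ≤ m) :
    Runs ev T (.seq c d) σ m Q :=
  let ⟨σ', _, h1, h2, h3⟩ := h
  let ⟨σ'', _, h4, h5, h6⟩ := h' σ' h3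
  ⟨σ'', _, .seq h1 h4, (Nat.add_le_add h2 h5).trans hm, h6⟩

/-- The unspent budget is carried along as `m - a` units, so bounding straight-line code reduces to
linear arithmetic on numerals. -/
theorem Runs.seq_mul (h : Runs ev T c σ (a * w) R) (hm : a ≤ m)
    (h' : ∀ σ', R σ' → Runs ev T d σ' ((m - a) * w) Q) : Runs ev T (.seq c d) σ (m * w) Q :=
  h.seq h' (by rw [← add_mul]; exact Nat.mul_le_mul_right _ (by omega))

theorem Runs.assign (hs : SlowTo w Λ) (hw : e.width σ ≤ w) (hm : e.nodes + 1 ≤ m)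
    (hQ : Q (σ.setReg i (e.eval σ))) : Runs ev T (.assign i e) σ (m * (w * Λ)) Q :=
  ⟨_, _, .assign σ i e, (e.cost_add_bits_le hs hw).trans (Nat.mul_le_mul_right _ hm), hQ⟩

theorem Runs.assign_seq (hs : SlowTo w Λ) (hw : e.width σ ≤ w) (hm : e.nodes + 1 ≤ m)
    (h : Runs ev T d (σ.setReg i (e.eval σ)) ((m - (e.nodes + 1)) * (w * Λ)) Q) :
    Runs ev T (.seq (.assign i e) d) σ (m * (w * Λ)) Q :=
  (Runs.assign hs hw le_rfl rfl).seq_mul hm fun _ h' => h' ▸ h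

theorem Runs.store (hs : SlowTo w Λ) (he : e.width σ ≤ w) (hf : f.width σ ≤ w)
    (hm : e.nodes + f.nodes + 2 ≤ m) (hQ : Q (σ.setMem (e.eval σ) (f.eval σ))) :
    Runs ev T (.store e f) σ (m * (w * Λ)) Q := by
  refine ⟨_, _, .store σ e f, le_trans ?_ (Nat.mul_le_mul_right _ hm), hQ⟩
  have h1 := e.cost_add_bits_le hs he
  have h2 := f.cost_add_bits_le hs hf
  calc _ = (e.cost σ + bits (e.eval σ)) + (f.cost σ + bits (f.eval σ)) := by ring
    _ ≤ _ := Nat.add_le_add h1 h2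
    _ = _ := by ring

theorem Runs.store_seq (hs : SlowTo w Λ) (he : e.width σ ≤ w) (hf : f.width σ ≤ w)
    (hm : e.nodes + f.nodes + 2 ≤ m)
    (h : Runs ev T d (σ.setMem (e.eval σ) (f.eval σ)) ((m - (e.nodes + f.nodes + 2)) * (w * Λ)) Q) :
    Runs ev T (.seq (.store e f) d) σ (m * (w * Λ)) Q :=
  (Runs.store hs he hf le_rfl rfl).seq_mul hm fun _ h' => h' ▸ h

theorem Runs.query_seq (hs : SlowTo w Λ) (he : e.width σ ≤ w) (hf : f.width σ ≤ w)
    (hpos : 0 < f.eval σ) (hT : T (bits (e.eval σ) + bits (f.eval σ)) ≤ w)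
    (hev : bits (ev (e.eval σ) (f.eval σ)).1 + bits (ev (e.eval σ) (f.eval σ)).2 ≤ w)
    (hm : e.nodes + f.nodes + 2 ≤ m)
    (h : Runs ev T d ((σ.setReg i (ev (e.eval σ) (f.eval σ)).1).setReg j
      (ev (e.eval σ) (f.eval σ)).2) ((m - (e.nodes + f.nodes + 2)) * (w * Λ)) Q) :
    Runs ev T (.seq (.query e f i j) d) σ (m * (w * Λ)) Q := by
  refine Runs.seq_mul (R := Eq _) ⟨_, _, .query σ e f i j hpos, ?_, rfl⟩ hm
    fun _ h' => h' ▸ h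
  have h1 := e.cost_le hs he
  have h2 := f.cost_le hs hf
  have h3 := hs.le
  simp only [add_mul]
  omega

theorem Runs.ite (hs : SlowTo w Λ) (he : e.width σ ≤ w) (hm : e.nodes + 1 ≤ m)
    (hc : 0 < e.eval σ → Runs ev T c σ ((m - (e.nodes + 1)) * (w * Λ)) Q)
    (hd : ¬ 0 < e.eval σ → Runs ev T d σ ((m - (e.nodes + 1)) * (w * Λ)) Q) :
    Runs ev T (.ite e c d) σ (m * (w * Λ)) Q := by
  have h1 := e.cost_add_bits_le hs he
  have h2 : m * (w * Λ) = (e.nodes + 1) * (w * Λ) + (m - (e.nodes + 1)) * (w * Λ) := by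
    rw [← add_mul]; congr 1; omega
  rw [h2]
  by_cases h : 0 < e.eval σ
  · obtain ⟨σ', t, h3, h4, h5⟩ := hc h
    exact ⟨σ', _, .ite_pos h h3, Nat.add_le_add h1 h4, h5⟩
  · obtain ⟨σ', t, h3, h4, h5⟩ := hd h
    exact ⟨σ', _, .ite_neg h h3, Nat.add_le_add h1 h4, h5⟩

/-- The rule for loops with an invariant `I j` when at most `j` repetitions are left. -/
theorem Runs.while (I : ℕ → State → Prop) (tc bc : ℕ)
    (htest : ∀ j σ, I j σ → e.cost σ + bits (e.eval σ) ≤ tc)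
    (hstep : ∀ j σ, I j σ → 0 < e.eval σ → ∃ j', j = j' + 1 ∧ Runs ev T c σ bc (I j'))
    (hQ : ∀ j σ, I j σ → ¬ 0 < e.eval σ → Q σ) (j : ℕ) :
    ∀ σ, I j σ → Runs ev T (.while e c) σ (tc + j * (bc + tc)) Q := by
  induction j with
  | zero =>
    intro σ h
    by_cases he : 0 < e.eval σ
    -- With no repetition left the test cannot be positive, as 0 is not a successor.
    · obtain ⟨j', h1, -⟩ := hstep 0 σ h he
      omega
    · exact ⟨σ, _, .while_neg he, by have := htest 0 σ h; omega, hQ 0 σ h he⟩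
  | succ j ih =>
    intro σ h
    have ht := htest _ σ h
    by_cases he : 0 < e.eval σ
    · obtain ⟨j', h1, σ', t, h2, h3, h4⟩ := hstep _ σ h he
      obtain rfl : j = j' := by omega
      obtain ⟨σ'', t', h5, h6, h7⟩ := ih σ' h4
      refine ⟨σ'', _, .while_pos he h2 h5, ?_, h7⟩
      rw [Nat.succ_mul]; omega
    · refine ⟨σ, _, .while_neg he, ?_, hQ _ σ h he⟩
      omega

/-- The rule for loops with the costs measured in multiples of the cost of one operation. -/
theorem Runs.while_mul (I : ℕ → State → Prop) (hs : SlowTo w Λ) (b : ℕ)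
    (htest : ∀ j σ, I j σ → e.width σ ≤ w)
    (hstep : ∀ j σ, I j σ → 0 < e.eval σ → ∃ j', j = j' + 1 ∧ Runs ev T c σ (b * (w * Λ)) (I j'))
    (hQ : ∀ j σ, I j σ → ¬ 0 < e.eval σ → Q σ) (j : ℕ) (σ : State) (h : I j σ)
    (hm : (j + 1) * (b + (e.nodes + 1)) ≤ m) :
    Runs ev T (.while e c) σ (m * (w * Λ)) Q := by
  refine (Runs.while I ((e.nodes + 1) * (w * Λ)) (b * (w * Λ))
    (fun j σ h => e.cost_add_bits_le hs (htest j σ h)) hstep hQ j σ h).mono ?_ fun _ h => h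
  refine le_trans ?_ (Nat.mul_le_mul_right _ hm)
  have h1 : (e.nodes + 1) * (w * Λ) + j * (b * (w * Λ) + (e.nodes + 1) * (w * Λ))
      = (j * (b + (e.nodes + 1)) + (e.nodes + 1)) * (w * Λ) := by ring
  rw [h1, add_mul j, one_mul]
  exact Nat.mul_le_mul_right _ (Nat.add_le_add_left (Nat.le_add_left _ _) _)

end rules

/-! ### States -/

@[simp] theorem State.setReg_reg (σ : State) (i j : ℕ) (z : ℤ) :
    (σ.setReg i z).reg j = if j = i then z else σ.reg j := by
  simp [State.setReg, Function.update_apply]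

@[simp] theorem State.setReg_mem (σ : State) (i : ℕ) (z : ℤ) : (σ.setReg i z).mem = σ.mem := rfl

@[simp] theorem State.setMem_reg (σ : State) (a z : ℤ) : (σ.setMem a z).reg = σ.reg := rfl

@[simp] theorem State.setMem_mem (σ : State) (a b z : ℤ) :
    (σ.setMem a z).mem b = if b = a then z else σ.mem b := by
  simp [State.setMem, Function.update_apply]

/-- The registers below `m` are the same. -/
def State.Agree (m : ℕ) (σ σ' : State) : Prop := ∀ r < m, σ.reg r = σ'.reg r

theorem State.Agree.refl (m : ℕ) (σ : State) : σ.Agree m σ := fun _ _ => rfl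

theorem State.Agree.trans {m : ℕ} {σ σ' σ'' : State} (h : σ.Agree m σ') (h' : σ'.Agree m σ'') :
    σ.Agree m σ'' := fun r hr => (h r hr).trans (h' r hr)

/-- After the setup, subprograms change only registers above a bound: constants lie below 18, the
round counter and the iterate in 18 and 19, the results of a round in 21 to 25, the output and
scratch space of `gProg` from 26 on. Frame conditions are then comparisons of numbers. -/
theorem State.Agree.mono {m m' : ℕ} {σ σ' : State} (h : σ.Agree m σ') (hm : m' ≤ m) :
    σ.Agree m' σ' := fun r hr => h r (hr.trans_le hm)

theorem State.Agree.setReg {m : ℕ} {σ σ' : State} (h : σ.Agree m σ') {i : ℕ} (hi : m ≤ i) (z : ℤ) :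
    (σ.setReg i z).Agree m σ' := fun r hr => by
  rw [State.setReg_reg, if_neg (by omega)]
  exact h r hr

theorem State.Agree.setMem {m : ℕ} {σ σ' : State} (h : σ.Agree m σ') (a z : ℤ) :
    (σ.setMem a z).Agree m σ' := h

end HigherOrderNewton

namespace HigherOrderNewton

open HigherOrderNewton.Expr

variable {ev : ℤ → ℤ → ℤ × ℤ} {T : ℕ → ℕ}

/-! ### Powers -/

/-- Finds the least power of two `2 ^ j` with `reg p ≤ reg q * 2 ^ j`. -/
def upLoop (p q a b : ℕ) : Prog :=
  .seq (.assign a (.const 1)) <| .seq (.assign b (.const 0)) <|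
    .while (.sub (.reg p) (.mul (.reg q) (.reg a))) <|
      .seq (.assign a (.add (.reg a) (.reg a))) (.assign b (.add (.reg b) (.const 1)))

/-- Each repetition doubles register `a`; minimality of `J` fixes the number of repetitions. -/
theorem runs_upLoop {p q a b : ℕ} (hab : a ≠ b) (hpa : p ≠ a) (hqa : q ≠ a) (hpb : p ≠ b)
    (hqb : q ≠ b) {w Λ W J : ℕ} (hs : SlowTo w Λ) (hw : 4 * W ≤ w) {σ : State} {x y : ℤ}
    (hx : σ.reg p = x) (hy : σ.reg q = y) (hxW : bits x ≤ W) (hyW : bits y ≤ W) (hJW : J + 2 ≤ W)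
    (hJ : x ≤ y * 2 ^ J) (hJ' : ∀ j < J, y * 2 ^ j < x) :
    Runs ev T (upLoop p q a b) σ ((18 + 14 * J) * (w * Λ)) fun σ' =>
      σ'.mem = σ.mem ∧ (∀ r, r ≠ a → r ≠ b → σ'.reg r = σ.reg r) ∧ σ'.reg a = 2 ^ J ∧
      σ'.reg b = J := by
  have hb1 : bits 1 = 2 := rfl
  have hb0 : bits 0 = 1 := rfl
  have hbj : ∀ j ≤ J, bits (2 ^ j) ≤ W := fun j hj => by rw [bits_two_pow]; omega
  have hbj' : ∀ j ≤ J, bits (j : ℤ) ≤ W := fun j hj =>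
    (bits_mono_of_nonneg (by positivity) (by exact_mod_cast Nat.lt_two_pow_self.le)).trans (hbj j hj)
  refine Runs.assign_seq hs (by simp only [width]; omega) (by simp only [nodes]; omega) ?_
  refine Runs.assign_seq hs (by simp only [width]; omega) (by simp only [nodes]; omega) ?_
  refine Runs.while_mul (fun j σ' => ∃ i, i + j = J ∧ σ'.mem = σ.mem ∧
    (∀ r, r ≠ a → r ≠ b → σ'.reg r = σ.reg r) ∧ σ'.reg a = 2 ^ i ∧ σ'.reg b = i)
    hs 8 ?_ ?_ ?_ J _ ?_ ?_
  · rintro j σ' ⟨i, hi, hm, hr, ha, hb⟩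
    have := hbj i (by omega)
    simp only [width, hr p hpa hpb, hr q hqa hqb, ha, hx, hy]
    omega
  · rintro j σ' ⟨i, hi, hm, hr, ha, hb⟩ hpos
    simp only [eval, hr p hpa hpb, hr q hqa hqb, ha, hx, hy, sub_pos] at hpos
    have hij : i < J := by
      by_contra hc
      obtain rfl : i = J := by omega
      exact hJ.not_gt hpos
    refine ⟨j - 1, by omega, ?_⟩
    have h1 := hbj i hij.le
    have h2 := hbj' i hij.le
    refine Runs.assign_seq hs (by simp only [width, ha]; omega) (by simp only [nodes]; omega) ?_
    refine Runs.assign hs (by simp [width, hb, hab.symm]; omega) (by simp only [nodes]; omega) ?_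
    refine ⟨i + 1, by omega, hm, fun r h1 h2 => ?_, ?_, ?_⟩
    · simp [h1, h2, hr r h1 h2]
    · simp [eval, ha, hab, pow_succ, mul_two]
    · simp [eval, hb, hab.symm]
  · rintro j σ' ⟨i, hi, hm, hr, ha, hb⟩ hpos
    simp only [eval, hr p hpa hpb, hr q hqa hqb, ha, hx, hy, sub_pos] at hpos
    obtain rfl : i = J := by
      by_contra hc
      exact hpos (hJ' i (by omega))
    exact ⟨hm, hr, ha, hb⟩
  · refine ⟨0, by simp, rfl, fun r h1 h2 => ?_, ?_, ?_⟩
    · simp [h1, h2]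
    · simp [eval, hab]
    · simp [eval]
  · simp only [nodes]; omega

/-- Computes the power of register `p` with exponent in register `q`. -/
def powLoop (p q a b : ℕ) : Prog :=
  .seq (.assign a (.const 1)) <| .seq (.assign b (.reg q)) <|
    .while (.reg b) <|
      .seq (.assign a (.mul (.reg a) (.reg p))) (.assign b (.sub (.reg b) (.const 1)))

theorem runs_powLoop {p q a b : ℕ} (hab : a ≠ b) (hpa : p ≠ a) (hqa : q ≠ a) (hpb : p ≠ b)
    {w Λ W J : ℕ} (hs : SlowTo w Λ) (hw : 4 * W ≤ w) {σ : State} {x : ℤ}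
    (hx : σ.reg p = x) (hJ : σ.reg q = J) (hW : 2 ≤ W) (hxW : bits x ≤ W) (hJW : bits (J : ℤ) ≤ W)
    (hpow : ∀ j ≤ J, bits (x ^ j) ≤ W) :
    Runs ev T (powLoop p q a b) σ ((14 + 10 * J) * (w * Λ)) fun σ' =>
      σ'.mem = σ.mem ∧ (∀ r, r ≠ a → r ≠ b → σ'.reg r = σ.reg r) ∧ σ'.reg a = x ^ J := by
  have hb1 : bits 1 = 2 := rfl
  have hbj : ∀ j ≤ J, bits (j : ℤ) ≤ W := fun j hj =>
    (bits_mono_of_nonneg (by positivity) (by exact_mod_cast hj)).trans hJW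
  refine Runs.assign_seq hs (by simp only [width]; omega) (by simp only [nodes]; omega) ?_
  refine Runs.assign_seq hs (by simp [width, hqa, hJ]; omega) (by simp only [nodes]; omega) ?_
  refine Runs.while_mul (fun j σ' => ∃ i, i + j = J ∧ σ'.mem = σ.mem ∧
    (∀ r, r ≠ a → r ≠ b → σ'.reg r = σ.reg r) ∧ σ'.reg a = x ^ i ∧ σ'.reg b = j)
    hs 8 ?_ ?_ ?_ J _ ?_ ?_
  · rintro j σ' ⟨i, hi, hm, hr, ha, hb⟩
    have := hbj j (by omega)
    simp only [width, hb]
    omega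
  · rintro j σ' ⟨i, hi, hm, hr, ha, hb⟩ hpos
    simp only [eval, hb] at hpos
    obtain ⟨j, rfl⟩ : ∃ j', j = j' + 1 := ⟨j - 1, by omega⟩
    refine ⟨j, rfl, ?_⟩
    have h1 := hpow i (by omega)
    have h2 := hbj (j + 1) (by omega)
    refine Runs.assign_seq hs (by simp only [width, ha, hr p hpa hpb, hx]; omega)
      (by simp only [nodes]; omega) ?_
    refine Runs.assign hs (by simp only [width, State.setReg_reg, hb, if_neg hab.symm]; omega)
      (by simp only [nodes]; omega) ?_
    refine ⟨i + 1, by omega, hm, fun r h1 h2 => ?_, ?_, ?_⟩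
    · simp [h1, h2, hr r h1 h2]
    · simp [eval, ha, hab, pow_succ, hr p hpa hpb, hx]
    · simp [eval, hb, hab.symm]
  · rintro j σ' ⟨i, hi, hm, hr, ha, hb⟩ hpos
    simp only [eval, hb] at hpos
    obtain rfl : i = J := by omega
    exact ⟨hm, hr, ha⟩
  · refine ⟨0, by simp, rfl, fun r h1 h2 => ?_, ?_, ?_⟩
    · simp [h1, h2]
    · simp [eval, hab]
    · simp [eval, hqa, hJ]
  · simp only [nodes]; omega

/-! ### Sums of fractions -/

/-- The memory holds the fractions `a i / b i` for `i < m`. -/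
def State.Holds (σ : State) (m : ℕ) (a b : ℕ → ℤ) : Prop :=
  ∀ i < m, σ.mem (2 * i) = a i ∧ σ.mem (2 * i + 1) = b i

/-- Replaces the `j`-th fraction by the sum of the fractions with indices `2 j` and `2 j + 1`. -/
def combineBody : Prog :=
  .seq (.assign 39 (.add
    (.mul (.mem (.mul (.const 4) (.reg 38))) (.mem (.add (.mul (.const 4) (.reg 38)) (.const 3))))
    (.mul (.mem (.add (.mul (.const 4) (.reg 38)) (.const 2)))
      (.mem (.add (.mul (.const 4) (.reg 38)) (.const 1)))))) <|
  .seq (.assign 40 (.mul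
    (.mem (.add (.mul (.const 4) (.reg 38)) (.const 1)))
      (.mem (.add (.mul (.const 4) (.reg 38)) (.const 3))))) <|
  .seq (.store (.mul (.const 2) (.reg 38)) (.reg 39)) <|
  .seq (.store (.add (.mul (.const 2) (.reg 38)) (.const 1)) (.reg 40))
    (.assign 38 (.add (.reg 38) (.const 1)))

/-- Numerator of the sum of two neighbouring fractions. -/
def pairNum (a b : ℕ → ℤ) (j : ℕ) : ℤ := a (2 * j) * b (2 * j + 1) + a (2 * j + 1) * b (2 * j)

/-- Denominator of the sum of two neighbouring fractions. -/
def pairDen (b : ℕ → ℤ) (j : ℕ) : ℤ := b (2 * j) * b (2 * j + 1)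

theorem bits_pairNum_le {a b : ℕ → ℤ} {w j : ℕ} (ha : ∀ i ≤ 2 * j + 1, bits (a i) ≤ w)
    (hb : ∀ i ≤ 2 * j + 1, bits (b i) ≤ w) : bits (pairNum a b j) ≤ 2 * w + 1 := by
  have h1 := bits_mul_le (a (2 * j)) (b (2 * j + 1))
  have h2 := bits_mul_le (a (2 * j + 1)) (b (2 * j))
  have h3 := bits_add_le_max (a (2 * j) * b (2 * j + 1)) (a (2 * j + 1) * b (2 * j))
  have := ha (2 * j) (by omega)
  have := ha (2 * j + 1) (by omega)
  have := hb (2 * j) (by omega)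
  have := hb (2 * j + 1) (by omega)
  rw [pairNum]; omega

/-- The halving is done in place. The `j`-th result goes to cells `2j` and `2j + 1`, while unread
inputs start at cell `4j + 4`; both results wait in registers until the reads are over, which
matters for `j = 0`. -/
theorem runs_combineBody {w' w Λ j h : ℕ} {a b : ℕ → ℤ} (hs : SlowTo w Λ) (hw : 64 * w' ≤ w)
    (hw4 : 4 ≤ w') (hj : j < h) (hjw : bits (h : ℤ) ≤ w') (ha : ∀ i < 2 * h, bits (a i) ≤ w')
    (hb : ∀ i < 2 * h, bits (b i) ≤ w') {σ : State} (h38 : σ.reg 38 = j)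
    (hold : ∀ i, 2 * j ≤ i → i < 2 * h → σ.mem (2 * i) = a i ∧ σ.mem (2 * i + 1) = b i) :
    Runs ev T combineBody σ (70 * (w * Λ)) fun σ' => σ'.Agree 38 σ ∧
      σ'.reg 38 = (j + 1 : ℕ) ∧ σ'.mem (2 * j) = pairNum a b j ∧
      σ'.mem (2 * j + 1) = pairDen b j ∧
      ∀ z : ℤ, z ≠ 2 * j → z ≠ 2 * j + 1 → σ'.mem z = σ.mem z := by
  have hb1 : bits 1 = 2 := rfl
  have hb2 : bits 2 = 3 := rfl
  have hb3 : bits 3 = 3 := rfl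
  have hb4 : bits 4 = 4 := rfl
  have hbj : bits (j : ℤ) ≤ w' :=
    (bits_mono_of_nonneg (by positivity) (by exact_mod_cast hj.le)).trans hjw
  obtain ⟨m0, m1⟩ := hold (2 * j) (by omega) (by omega)
  obtain ⟨m2, m3⟩ := hold (2 * j + 1) (by omega) (by omega)
  have ha0 := ha (2 * j) (by omega)
  have ha1 := ha (2 * j + 1) (by omega)
  have hb0 := hb (2 * j) (by omega)
  have hb1' := hb (2 * j + 1) (by omega)
  have e0 : (4 * (j : ℤ)) = 2 * ((2 * j : ℕ) : ℤ) := by push_cast; ring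
  have e2 : (4 * (j : ℤ)) + 2 = 2 * ((2 * j + 1 : ℕ) : ℤ) := by push_cast; ring
  have e1 : (4 * (j : ℤ)) + 1 = 2 * ((2 * j : ℕ) : ℤ) + 1 := by push_cast; ring
  have e3 : (4 * (j : ℤ)) + 3 = 2 * ((2 * j + 1 : ℕ) : ℤ) + 1 := by push_cast; ring
  rw [← e0] at m0
  rw [← e1] at m1
  rw [← e2] at m2
  rw [← e3] at m3
  have hnum : bits (pairNum a b j) ≤ 4 * w' := by
    have h1 := bits_mul_le (a (2 * j)) (b (2 * j + 1))
    have h2 := bits_mul_le (a (2 * j + 1)) (b (2 * j))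
    have h3 := bits_add_le (a (2 * j) * b (2 * j + 1)) (a (2 * j + 1) * b (2 * j))
    rw [pairNum]; omega
  have hden : bits (pairDen b j) ≤ 2 * w' := (bits_mul_le _ _).trans (by omega)
  refine Runs.assign_seq hs (by simp only [width, eval, h38, m0, m1, m2, m3]; omega)
    (by simp only [nodes]; omega) ?_
  have v39 : (Expr.add (.mul (.mem (.mul (.const 4) (.reg 38)))
      (.mem (.add (.mul (.const 4) (.reg 38)) (.const 3))))
      (.mul (.mem (.add (.mul (.const 4) (.reg 38)) (.const 2)))
      (.mem (.add (.mul (.const 4) (.reg 38)) (.const 1))))).eval σ = pairNum a b j := by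
    simp only [eval, h38, m0, m1, m2, m3, pairNum]
  rw [v39]
  refine Runs.assign_seq hs (by simp [width, eval, h38, m1, m3]; omega)
    (by simp only [nodes]; omega) ?_
  have v40 : (Expr.mul (.mem (.add (.mul (.const 4) (.reg 38)) (.const 1)))
      (.mem (.add (.mul (.const 4) (.reg 38)) (.const 3)))).eval (σ.setReg 39 (pairNum a b j))
      = pairDen b j := by
    simp [eval, h38, m1, m3, pairDen]
  rw [v40]
  refine Runs.store_seq hs (by simp [width, h38]; omega) (by simp [width]; omega)
    (by simp only [nodes]; omega) ?_
  refine Runs.store_seq hs (by simp [width, h38]; omega) (by simp [width]; omega)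
    (by simp only [nodes]; omega) ?_
  refine Runs.assign hs (by simp [width, h38]; omega) (by simp only [nodes]; omega) ?_
  refine ⟨(((((State.Agree.refl 38 σ).setReg (by norm_num) _).setReg (by norm_num) _).setMem
    _ _).setMem _ _).setReg le_rfl _, ?_, ?_, ?_, fun z h1 h2 => ?_⟩
  · simp [eval, h38]
  · simp [eval, h38]
  · simp [eval, h38]
  · simp [eval, h38, h1, h2]

/-- Halves the number of fractions in memory by adding neighbours. -/
def combinePass : Prog :=
  .seq (.assign 38 (.const 0)) <| .while (.sub (.reg 36) (.reg 38)) combineBody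

theorem runs_combinePass {w' w Λ h : ℕ} {a b : ℕ → ℤ} (hs : SlowTo w Λ) (hw : 64 * w' ≤ w)
    (hw4 : 4 ≤ w') (hhw : bits (h : ℤ) ≤ w') (ha : ∀ i < 2 * h, bits (a i) ≤ w')
    (hb : ∀ i < 2 * h, bits (b i) ≤ w') {σ : State} (h36 : σ.reg 36 = h)
    (hold : σ.Holds (2 * h) a b) :
    Runs ev T combinePass σ ((80 + 80 * h) * (w * Λ)) fun σ' => σ'.Agree 38 σ ∧
      σ'.Holds h (pairNum a b) (pairDen b) := by
  have hb0 : bits 0 = 1 := rfl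
  refine Runs.assign_seq hs (by simp only [width]; omega) (by simp only [nodes]; omega) ?_
  refine Runs.while_mul (fun j σ' => ∃ i : ℕ, i + j = h ∧ σ'.Agree 38 σ ∧ σ'.reg 38 = i ∧
    σ'.Holds i (pairNum a b) (pairDen b) ∧
    ∀ t, 2 * i ≤ t → t < 2 * h → σ'.mem (2 * t) = a t ∧ σ'.mem (2 * t + 1) = b t)
    hs 70 ?_ ?_ ?_ h _ ?_ ?_
  · rintro j σ' ⟨i, hi, hag, h38, hnew, hol⟩
    have : bits (i : ℤ) ≤ w' :=
      (bits_mono_of_nonneg (by positivity) (by exact_mod_cast (by omega : i ≤ h))).trans hhw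
    simp only [width, hag 36 (by norm_num), h36, h38]
    omega
  · rintro j σ' ⟨i, hi, hag, h38, hnew, hol⟩ hpos
    simp only [eval, hag 36 (by norm_num), h36, h38] at hpos
    refine ⟨j - 1, by omega, ?_⟩
    refine (runs_combineBody hs hw hw4 (by omega : i < h) hhw ha hb h38 hol).mono le_rfl ?_
    rintro σ'' ⟨hag', h38', hn, hd, hmem⟩
    refine ⟨i + 1, by omega, hag'.trans hag, h38', fun t ht => ?_, fun t ht ht' => ?_⟩
    · rcases Nat.lt_succ_iff_lt_or_eq.mp ht with h1 | rfl
      · rw [hmem _ (by omega) (by omega), hmem _ (by omega) (by omega)]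
        exact hnew t h1
      · exact ⟨hn, hd⟩
    · rw [hmem _ (by omega) (by omega), hmem _ (by omega) (by omega)]
      exact hol t (by omega) ht'
  · rintro j σ' ⟨i, hi, hag, h38, hnew, hol⟩ hpos
    simp only [eval, hag 36 (by norm_num), h36, h38] at hpos
    obtain rfl : i = h := by omega
    exact ⟨hag, hnew⟩
  · refine ⟨0, by simp, (State.Agree.refl 38 σ).setReg le_rfl _, by simp [eval], fun t ht => ?_,
      fun t _ ht => hold t ht⟩
    omega
  · simp only [nodes]; omega

/-- Adds the `reg 36` fractions in memory, where `reg 36` is a power of two. -/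
def treeSum : Prog :=
  .while (.sub (.reg 36) (.const 1)) <|
    .seq (.assign 36 (.div (.reg 36) (.const 2))) combinePass

theorem sum_pair (a b : ℕ → ℤ) (h : ℕ) (hb : ∀ i < 2 * h, 0 < b i) :
    ∑ i ∈ Finset.range h, (pairNum a b i : ℝ) / (pairDen b i : ℝ)
      = ∑ i ∈ Finset.range (2 * h), (a i : ℝ) / (b i : ℝ) := by
  induction h with
  | zero => simp
  | succ h ih =>
    have h1 : (b (2 * h) : ℝ) ≠ 0 := by exact_mod_cast (hb (2 * h) (by omega)).ne'
    have h2 : (b (2 * h + 1) : ℝ) ≠ 0 := by exact_mod_cast (hb (2 * h + 1) (by omega)).ne'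
    rw [Finset.sum_range_succ, ih fun i hi => hb i (by omega), show 2 * (h + 1) = 2 * h + 1 + 1 by ring,
      Finset.sum_range_succ, Finset.sum_range_succ, pairNum, pairDen]
    push_cast
    field_simp
    ring

/-- A pass halves the number of fractions and turns length `w` into `2w + 1`, so (number) × (`w +
1`) is the constant `Y`. Hence every pass costs `O(Y Λ)`, and there are `S` passes. Adding the
fractions one after another would cost a factor `2^S` instead of `S`. -/
theorem runs_treeSum {w₀ Y Λ S : ℕ} {a b : ℕ → ℤ} (hw4 : S + 4 ≤ w₀) (hY : 2 ^ S * (w₀ + 1) = Y)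
    (hs : SlowTo (64 * Y) Λ)
    (ha : ∀ i < 2 ^ S, bits (a i) ≤ w₀) (hb : ∀ i < 2 ^ S, bits (b i) ≤ w₀)
    (hpos : ∀ i < 2 ^ S, 0 < b i) {σ : State} (h36 : σ.reg 36 = 2 ^ S)
    (hold : σ.Holds (2 ^ S) a b) :
    Runs ev T treeSum σ ((S + 1) * (200 * (64 * Y * Λ))) fun σ' => σ'.Agree 36 σ ∧
      0 < σ'.mem 1 ∧ bits (σ'.mem 0) ≤ Y ∧ bits (σ'.mem 1) ≤ Y ∧
      (σ'.mem 0 : ℝ) / (σ'.mem 1 : ℝ) = ∑ i ∈ Finset.range (2 ^ S), (a i : ℝ) / (b i : ℝ) := by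
  have hb1 : bits 1 = 2 := rfl
  have hb2 : bits 2 = 3 := rfl
  set total := ∑ i ∈ Finset.range (2 ^ S), (a i : ℝ) / (b i : ℝ) with htot
  refine (Runs.while (fun s σ' => s ≤ S ∧ ∃ (w' : ℕ) (a b : ℕ → ℤ), σ'.Agree 36 σ ∧
    w₀ ≤ w' ∧ 2 ^ s * (w' + 1) = Y ∧
    (∀ i < 2 ^ s, bits (a i) ≤ w' ∧ bits (b i) ≤ w' ∧ 0 < b i) ∧
    σ'.reg 36 = 2 ^ s ∧ σ'.Holds (2 ^ s) a b ∧
    ∑ i ∈ Finset.range (2 ^ s), (a i : ℝ) / (b i : ℝ) = total)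
    (4 * (64 * Y * Λ)) (190 * (64 * Y * Λ)) ?_ ?_ ?_ S σ ?_).mono ?_ fun _ h => h
  · rintro s σ' ⟨hsS, w', a, b, hag, hw', hY', hab, h36, hold, hsum⟩
    have h1 : w' + 1 ≤ Y := hY' ▸ Nat.le_mul_of_pos_left _ (by positivity)
    refine Expr.cost_add_bits_le hs _ ?_
    simp only [width, h36, bits_two_pow]
    omega
  · rintro s σ' ⟨hsS, w', a, b, hag, hw', hY', hab, h36, hold, hsum⟩ hpos
    simp only [eval, h36] at hpos
    have hs0 : s ≠ 0 := by rintro rfl; simp at hpos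
    obtain ⟨s, rfl⟩ : ∃ s', s = s' + 1 := ⟨s - 1, by omega⟩
    refine ⟨s, rfl, ?_⟩
    have h1 : w' + 1 ≤ Y := hY' ▸ Nat.le_mul_of_pos_left _ (by positivity)
    have h2 : 2 ^ (s + 1) = 2 * 2 ^ s := by ring
    rw [h2] at hY' hab hold hsum
    have hdiv : ((2 : ℤ) ^ (s + 1)) / 2 = 2 ^ s := by
      rw [pow_succ]; exact Int.mul_ediv_cancel _ (by norm_num)
    -- The pass is charged at its own word length `w'`, not at `Y`; that is why its many operations
    -- cost only a multiple of `Y Λ` together.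
    have hs' : SlowTo (64 * w') Λ := hs.mono (by omega)
    refine Runs.seq (a := 4 * (64 * Y * Λ))
      (Runs.assign (Q := fun σ'' => σ'' = _) hs (by simp only [width, h36, bits_two_pow]; omega)
        (by simp only [nodes]; omega) rfl)
      (b := (80 + 80 * 2 ^ s) * (64 * w' * Λ)) ?_ ?_
    · rintro _ rfl
      refine (runs_combinePass (h := 2 ^ s) (a := a) (b := b) hs' le_rfl (by omega)
        (by push_cast; rw [bits_two_pow]; omega)
        (fun i hi => (hab i hi).1) (fun i hi => (hab i hi).2.1) ?_ (by exact hold)).mono le_rfl ?_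
      · simp [eval, h36, hdiv]
      · rintro σ'' ⟨hag', hhold'⟩
        refine ⟨by omega, 2 * w' + 1, pairNum a b, pairDen b, ?_, by omega, ?_, fun i hi => ?_, ?_,
          hhold', ?_⟩
        · exact (hag'.mono (by norm_num)).trans (hag.setReg le_rfl _)
        · rw [← hY']; ring
        · refine ⟨bits_pairNum_le (fun t ht => (hab t (by omega)).1)
            fun t ht => (hab t (by omega)).2.1, ?_, ?_⟩
          · have := (hab (2 * i) (by omega)).2.1
            have := (hab (2 * i + 1) (by omega)).2.1
            exact (bits_mul_le _ _).trans (by omega)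
          · exact mul_pos (hab _ (by omega)).2.2 (hab _ (by omega)).2.2
        · rw [hag' 36 (by norm_num)]
          simp [eval, h36, hdiv]
        · rw [sum_pair a b _ fun i hi => (hab i hi).2.2, hsum]
    · have h3 : 2 ^ s * w' ≤ Y := by rw [← hY']; exact Nat.mul_le_mul (by omega) (Nat.le_succ _)
      have h4 : (80 + 80 * 2 ^ s) * (64 * w' * Λ) ≤ 160 * (64 * Y * Λ) := by
        calc (80 + 80 * 2 ^ s) * (64 * w' * Λ) = (80 * w' + 80 * (2 ^ s * w')) * (64 * Λ) := by ring
          _ ≤ (80 * Y + 80 * Y) * (64 * Λ) := by gcongr; omega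
          _ = _ := by ring
      omega
  · rintro s σ' ⟨hsS, w', a, b, hag, hw', hY', hab, h36, hold, hsum⟩ hpos
    simp only [eval, h36] at hpos
    have hs0 : s = 0 := by
      by_contra hc
      have : (2 : ℤ) ≤ 2 ^ s := by
        simpa using pow_le_pow_right₀ (by norm_num : (1 : ℤ) ≤ 2) (Nat.one_le_iff_ne_zero.mpr hc)
      omega
    subst hs0
    obtain ⟨m0, m1⟩ := hold 0 (by norm_num)
    obtain ⟨b0, b1, b2⟩ := hab 0 (by norm_num)
    have h1 : w' + 1 ≤ Y := hY' ▸ Nat.le_mul_of_pos_left _ (by positivity)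
    simp only [Nat.cast_zero, mul_zero, zero_add] at m0 m1
    refine ⟨hag, by rw [m1]; exact b2, by rw [m0]; omega, by rw [m1]; omega, ?_⟩
    rw [m0, m1, ← hsum]
    simp
  · exact ⟨le_rfl, w₀, a, b, State.Agree.refl _ _, le_rfl, hY,
      fun i hi => ⟨ha i hi, hb i hi, hpos i hi⟩, h36, hold, rfl⟩
  · generalize 64 * Y * Λ = X
    nlinarith

end HigherOrderNewton

namespace HigherOrderNewton

open HigherOrderNewton.Expr

variable {ev : ℤ → ℤ → ℤ × ℤ} {T : ℕ → ℕ}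

/-! ### Finite differences -/

/-- Numerator of `c (y / z - 1)` for the values `y`, `z` at `(q + 1) / A` and `q / A`. -/
def slopeNum (ev : ℤ → ℤ → ℤ × ℤ) (A q c : ℤ) : ℤ :=
  c * ((ev (q + 1) A).1 * (ev q A).2 - (ev q A).1 * (ev (q + 1) A).2)

/-- Denominator of `c (y / z - 1)` for the values `y`, `z` at `(q + 1) / A` and `q / A`. -/
def slopeDen (ev : ℤ → ℤ → ℤ × ℤ) (A q : ℤ) : ℤ := (ev q A).1 * (ev (q + 1) A).2

/-- Stores the `reg 29`-th term of the finite difference. -/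
def fillBody : Prog :=
  .seq (.assign 31 (.add (.mul (.reg 19) (.reg 14)) (.mul (.sub (.reg 28) (.reg 29)) (.reg 15)))) <|
  .seq (.query (.add (.reg 31) (.const 1)) (.reg 16) 32 33) <|
  .seq (.query (.reg 31) (.reg 16) 34 35) <|
  .seq (.store (.mul (.const 2) (.reg 29))
    (.mul (.reg 30) (.sub (.mul (.reg 32) (.reg 35)) (.mul (.reg 34) (.reg 33))))) <|
  .seq (.store (.add (.mul (.const 2) (.reg 29)) (.const 1)) (.mul (.reg 34) (.reg 33))) <|
  .seq (.assign 30 (.sub (.const 0) (.div (.mul (.reg 30) (.sub (.reg 28) (.reg 29)))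
    (.add (.reg 29) (.const 1))))) <|
  .assign 29 (.add (.reg 29) (.const 1))

/-- The registers 14, 15, 16, 19, 28 describe the evaluation points. -/
structure FillInput (σ : State) (X AX AD A : ℤ) (l : ℕ) : Prop where
  h14 : σ.reg 14 = AX
  h15 : σ.reg 15 = AD
  h16 : σ.reg 16 = A
  h19 : σ.reg 19 = X
  h28 : σ.reg 28 = l

theorem FillInput.of_agree {σ σ' : State} {X AX AD A : ℤ} {l : ℕ} (h : FillInput σ X AX AD A l)
    (hag : σ'.Agree 29 σ) : FillInput σ' X AX AD A l :=
  ⟨(hag 14 (by norm_num)).trans h.h14, (hag 15 (by norm_num)).trans h.h15,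
    (hag 16 (by norm_num)).trans h.h16, (hag 19 (by norm_num)).trans h.h19,
    (hag 28 (by norm_num)).trans h.h28⟩

/-- Length bounds for the evaluation points and the values there. -/
structure FillBounds (ev : ℤ → ℤ → ℤ × ℤ) (T : ℕ → ℕ) (W : ℕ) (X AX AD A : ℤ) (l : ℕ) : Prop where
  hW : 4 ≤ W
  hA : 0 < A
  bX : bits X ≤ W
  bAX : bits AX ≤ W
  bAD : bits AD ≤ W
  bA : bits A ≤ W
  bl : l + 3 ≤ W
  bq : ∀ i ≤ l, bits (X * AX + ((l : ℤ) - i) * AD) ≤ W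
  hT : ∀ i ≤ l, T (bits (X * AX + ((l : ℤ) - i) * AD) + bits A) ≤ W
  hT1 : ∀ i ≤ l, T (bits (X * AX + ((l : ℤ) - i) * AD + 1) + bits A) ≤ W
  writes : ∀ u v : ℤ, 0 < v → bits (ev u v).1 + bits (ev u v).2 ≤ T (bits u + bits v)

/-- The division is exact, by `(i+1) C(l, i+1) = (l-i) C(l, i)`, so the signed binomial coefficients
can be updated with one integer division. -/
theorem choose_step (l i : ℕ) (hi : i ≤ l) :
    (0 : ℤ) - ((-1) ^ i * (l.choose i : ℤ)) * ((l : ℤ) - i) / ((i : ℤ) + 1)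
      = (-1) ^ (i + 1) * (l.choose (i + 1) : ℤ) := by
  have h1 : ((l.choose i : ℤ)) * ((l : ℤ) - i) = (l.choose (i + 1) : ℤ) * ((i : ℤ) + 1) := by
    rw [← Nat.cast_sub hi]
    exact_mod_cast (Nat.choose_succ_right_eq l i).symm
  rw [mul_assoc, h1, ← mul_assoc, Int.mul_ediv_cancel _ (by positivity)]
  ring

theorem bits_signed_choose_le (l i : ℕ) : bits ((-1) ^ i * (l.choose i : ℤ)) ≤ l + 2 := by
  refine (bits_mono (b := 2 ^ l) ?_).trans (bits_two_pow l).le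
  rw [Int.natAbs_mul, Int.natAbs_pow, Int.natAbs_neg, Int.natAbs_one, one_pow, one_mul,
    Int.natAbs_natCast, Int.natAbs_pow]
  exact Nat.choose_le_two_pow l i

theorem bits_natCast_le {i l : ℕ} (h : i ≤ l) : bits (i : ℤ) ≤ l + 2 :=
  bits_le_of_le_two_pow (by positivity) (by exact_mod_cast h.trans Nat.lt_two_pow_self.le)

theorem runs_fillBody {W w Λ l i : ℕ} {X AX AD A : ℤ} (hs : SlowTo w Λ) (hw : 16 * W ≤ w)
    (hB : FillBounds ev T W X AX AD A l) (hi : i ≤ l) {σ : State} (hσ : FillInput σ X AX AD A l)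
    (h29 : σ.reg 29 = i) (h30 : σ.reg 30 = (-1) ^ i * (l.choose i : ℤ)) :
    Runs ev T fillBody σ (70 * (w * Λ)) fun σ' => σ'.Agree 29 σ ∧
      σ'.reg 29 = (i + 1 : ℕ) ∧ σ'.reg 30 = (-1) ^ (i + 1) * (l.choose (i + 1) : ℤ) ∧
      σ'.mem (2 * i) = slopeNum ev A (X * AX + ((l : ℤ) - i) * AD) ((-1) ^ i * (l.choose i : ℤ)) ∧
      σ'.mem (2 * i + 1) = slopeDen ev A (X * AX + ((l : ℤ) - i) * AD) ∧
      ∀ z : ℤ, z ≠ 2 * i → z ≠ 2 * i + 1 → σ'.mem z = σ.mem z := by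
  obtain ⟨h14, h15, h16, h19, h28⟩ := hσ
  obtain ⟨hW, hA, bX, bAX, bAD, bA, bl, bq, hT, hT1, writes⟩ := hB
  have hb0 : bits 0 = 1 := rfl
  have hb1 : bits 1 = 2 := rfl
  have hb2 : bits 2 = 3 := rfl
  have hbl := bits_natCast_le (le_refl l)
  have hbi := bits_natCast_le hi
  have hbc := bits_signed_choose_le l i
  have hbq := bq i hi
  have hTq := hT i hi
  have hTq1 := hT1 i hi
  have hstep := choose_step l i hi
  set q : ℤ := X * AX + ((l : ℤ) - i) * AD with hq
  have wr := writes q A hA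
  have wr1 := writes (q + 1) A hA
  set c : ℤ := (-1) ^ i * (l.choose i : ℤ) with hc
  refine Runs.assign_seq hs (by simp only [width, h14, h15, h19, h28, h29]; omega)
    (by simp only [nodes]; omega) ?_
  have e31 : (Expr.add (.mul (.reg 19) (.reg 14)) (.mul (.sub (.reg 28) (.reg 29)) (.reg 15))).eval σ
      = q := by simp only [eval, h14, h15, h19, h28, h29, hq]
  rw [e31]
  refine Runs.query_seq hs (by simp [width]; omega) (by simp [width, h16]; omega)
    (by simp [eval, h16, hA]) (by simp [eval, h16]; omega) (by simp [eval, h16]; omega)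
    (by simp only [nodes]; omega) ?_
  simp only [eval, State.setReg_reg, h16, reduceIte, Nat.reduceEqDiff]
  refine Runs.query_seq hs (by simp [width]; omega) (by simp [width, h16]; omega)
    (by simp [eval, h16, hA]) (by simp [eval, h16]; omega) (by simp [eval, h16]; omega)
    (by simp only [nodes]; omega) ?_
  simp only [eval, State.setReg_reg, h16, reduceIte, Nat.reduceEqDiff]
  refine Runs.store_seq hs (by simp [width, h29]; omega) (by simp [width, h30]; omega)
    (by simp only [nodes]; omega) ?_
  simp only [eval, State.setReg_reg, h29, h30, reduceIte, Nat.reduceEqDiff]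
  refine Runs.store_seq hs (by simp [width, h29]; omega) (by simp [width]; omega)
    (by simp only [nodes]; omega) ?_
  simp only [eval, State.setReg_reg, State.setMem_reg, h29, reduceIte, Nat.reduceEqDiff]
  refine Runs.assign_seq hs (by simp [width, h28, h29, h30]; omega)
    (by simp only [nodes]; omega) ?_
  simp only [eval, State.setReg_reg, State.setMem_reg, h28, h29, h30, reduceIte, Nat.reduceEqDiff]
  rw [hstep]
  refine Runs.assign hs (by simp [width, h29]; omega) (by simp only [nodes]; omega) ?_
  refine ⟨fun r hr => ?_, ?_, ?_, ?_, ?_, fun z h1 h2 => ?_⟩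
  · simp only [State.setReg_reg, State.setMem_reg]
    repeat rw [if_neg (by omega)]
  · simp [eval, h29]
  · simp
  · simp [slopeNum]
  · simp [slopeDen]
  · simp [h1, h2]

/-- Stores all `reg 25 = reg 28 + 1` terms of the finite difference. -/
def fillLoop : Prog :=
  .seq (.assign 29 (.const 0)) <| .seq (.assign 30 (.const 1)) <|
    .while (.sub (.reg 25) (.reg 29)) fillBody

/-- After `i` repetitions the first `i` fractions are in memory and register 30 holds the
coefficient of the next one. -/
theorem runs_fillLoop {W w Λ l : ℕ} {X AX AD A : ℤ} (hs : SlowTo w Λ) (hw : 16 * W ≤ w)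
    (hB : FillBounds ev T W X AX AD A l) {σ : State} (hσ : FillInput σ X AX AD A l)
    (h25 : σ.reg 25 = (l + 1 : ℕ)) :
    Runs ev T fillLoop σ ((80 + 80 * (l + 1)) * (w * Λ)) fun σ' => σ'.Agree 29 σ ∧
      σ'.reg 29 = (l + 1 : ℕ) ∧ σ'.Holds (l + 1)
        (fun i => slopeNum ev A (X * AX + ((l : ℤ) - i) * AD) ((-1) ^ i * (l.choose i : ℤ)))
        (fun i => slopeDen ev A (X * AX + ((l : ℤ) - i) * AD)) := by
  have hb0 : bits 0 = 1 := rfl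
  have hb1 : bits 1 = 2 := rfl
  have hW := hB.hW
  have hlW := hB.bl
  refine Runs.assign_seq hs (by simp only [width]; omega) (by simp only [nodes]; omega) ?_
  refine Runs.assign_seq hs (by simp only [width]; omega) (by simp only [nodes]; omega) ?_
  refine Runs.while_mul (fun j σ' => ∃ i : ℕ, i + j = l + 1 ∧ σ'.Agree 29 σ ∧ σ'.reg 29 = i ∧
    σ'.reg 30 = (-1) ^ i * (l.choose i : ℤ) ∧ σ'.Holds i
        (fun i => slopeNum ev A (X * AX + ((l : ℤ) - i) * AD) ((-1) ^ i * (l.choose i : ℤ)))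
        (fun i => slopeDen ev A (X * AX + ((l : ℤ) - i) * AD)))
    hs 70 ?_ ?_ ?_ (l + 1) _ ?_ ?_
  · rintro j σ' ⟨i, hi, hag, h29, h30, hh⟩
    have h1 := bits_natCast_le (by omega : i ≤ l + 1)
    have h2 := bits_natCast_le (le_refl (l + 1))
    simp only [width, hag 25 (by norm_num), h25, h29]
    omega
  · rintro j σ' ⟨i, hi, hag, h29, h30, hh⟩ hpos
    simp only [eval, hag 25 (by norm_num), h25, h29] at hpos
    refine ⟨j - 1, by omega, ?_⟩
    refine (runs_fillBody hs hw hB (by omega : i ≤ l) (hσ.of_agree hag) h29 h30).mono le_rfl ?_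
    rintro σ'' ⟨hag', h29', h30', hn, hd, hmem⟩
    refine ⟨i + 1, by omega, hag'.trans hag, h29', h30', fun t ht => ?_⟩
    rcases Nat.lt_succ_iff_lt_or_eq.mp ht with h1 | rfl
    · rw [hmem _ (by omega) (by omega), hmem _ (by omega) (by omega)]
      exact hh t h1
    · exact ⟨hn, hd⟩
  · rintro j σ' ⟨i, hi, hag, h29, h30, hh⟩ hpos
    simp only [eval, hag 25 (by norm_num), h25, h29] at hpos
    obtain rfl : i = l + 1 := by omega
    exact ⟨hag, h29, hh⟩
  · refine ⟨0, by simp, ((State.Agree.refl 29 σ).setReg le_rfl _).setReg (by norm_num) _,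
      by simp [eval], by simp [eval], fun t ht => ?_⟩
    omega
  · simp only [nodes]; omega

/-- Fills the memory with fractions `0 / 1` up to the index `reg 36`. -/
def padLoop : Prog :=
  .while (.sub (.reg 36) (.reg 29)) <|
    .seq (.store (.mul (.const 2) (.reg 29)) (.const 0)) <|
    .seq (.store (.add (.mul (.const 2) (.reg 29)) (.const 1)) (.const 1))
      (.assign 29 (.add (.reg 29) (.const 1)))

/-- Zero fractions bring the number of summands up to a power of two, so that halving is always
exact. -/
theorem runs_padLoop {W w Λ m M : ℕ} {a b : ℕ → ℤ} (hs : SlowTo w Λ) (hw : 16 * W ≤ w)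
    (hW : 4 ≤ W) (hMW : bits (M : ℤ) ≤ W) (hmM : m ≤ M) {σ : State} (h29 : σ.reg 29 = m)
    (h36 : σ.reg 36 = M) (hh : σ.Holds m a b) :
    Runs ev T padLoop σ ((25 + 25 * M) * (w * Λ)) fun σ' => σ'.Agree 29 σ ∧ σ'.reg 36 = M ∧
      σ'.Holds M (fun i => if i < m then a i else 0) (fun i => if i < m then b i else 1) := by
  have hb0 : bits 0 = 1 := rfl
  have hb1 : bits 1 = 2 := rfl
  have hb2 : bits 2 = 3 := rfl
  refine Runs.while_mul (fun j σ' => ∃ i : ℕ, i + j = M ∧ m ≤ i ∧ σ'.Agree 29 σ ∧ σ'.reg 29 = i ∧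
    σ'.reg 36 = M ∧ σ'.Holds i (fun i => if i < m then a i else 0)
      (fun i => if i < m then b i else 1))
    hs 20 ?_ ?_ ?_ (M - m) _ ?_ ?_
  · rintro j σ' ⟨i, hi, hmi, hag, h29, h36, hh⟩
    have : bits (i : ℤ) ≤ W :=
      (bits_mono_of_nonneg (by positivity) (by exact_mod_cast (by omega : i ≤ M))).trans hMW
    simp only [width, h36, h29]
    omega
  · rintro j σ' ⟨i, hi, hmi, hag, h29, h36, hh⟩ hpos
    simp only [eval, h36, h29] at hpos
    refine ⟨j - 1, by omega, ?_⟩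
    have : bits (i : ℤ) ≤ W :=
      (bits_mono_of_nonneg (by positivity) (by exact_mod_cast (by omega : i ≤ M))).trans hMW
    refine Runs.store_seq hs (by simp [width, h29]; omega) (by simp [width]; omega)
      (by simp only [nodes]; omega) ?_
    refine Runs.store_seq hs (by simp [width, h29]; omega) (by simp [width]; omega)
      (by simp only [nodes]; omega) ?_
    refine Runs.assign hs (by simp [width, h29]; omega) (by simp only [nodes]; omega) ?_
    refine ⟨i + 1, by omega, by omega, State.Agree.setReg (m := 29) (by exact hag) le_rfl _,
      by simp [eval, h29], by simp [h36], fun t ht => ?_⟩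
    rcases Nat.lt_succ_iff_lt_or_eq.mp ht with h1 | rfl
    · have e1 : (2 * (t : ℤ)) ≠ 2 * i := by omega
      have e2 : (2 * (t : ℤ)) ≠ 2 * i + 1 := by omega
      have e3 : (2 * (t : ℤ)) + 1 ≠ 2 * i := by omega
      have e4 : (2 * (t : ℤ)) + 1 ≠ 2 * i + 1 := by omega
      simp only [eval, State.setReg_mem, State.setMem_mem, State.setMem_reg, h29, if_neg e1,
        if_neg e2, if_neg e3, if_neg e4]
      exact hh t h1
    · simp [eval, h29, hmi.not_gt]
  · rintro j σ' ⟨i, hi, hmi, hag, h29, h36, hh⟩ hpos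
    simp only [eval, h36, h29] at hpos
    obtain rfl : i = M := by omega
    exact ⟨hag, h36, hh⟩
  · refine ⟨m, by omega, le_rfl, State.Agree.refl _ _, h29, h36, fun t ht => ?_⟩
    simp only [if_pos ht]
    exact hh t ht
  · simp only [nodes]
    have h1 : (M - m + 1) * (20 + (1 + 1 + 1 + 1)) ≤ (M + 1) * 25 :=
      Nat.mul_le_mul (by omega) (by norm_num)
    omega

/-- Computes `l !` and `(-D) ^ l` for `l = reg 28` and `D = reg 17`. -/
def factLoop : Prog :=
  .seq (.assign 29 (.const 0)) <| .seq (.assign 41 (.const 1)) <| .seq (.assign 42 (.const 1)) <|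
    .while (.sub (.reg 28) (.reg 29)) <|
      .seq (.assign 29 (.add (.reg 29) (.const 1))) <|
      .seq (.assign 41 (.mul (.reg 41) (.reg 29)))
        (.assign 42 (.sub (.const 0) (.mul (.reg 42) (.reg 17))))

/-- With `δ = 1/D`, the power `(-D)^l` is the prefactor `(-1)^l/δ^l` of the finite difference. -/
theorem runs_factLoop {W w Λ l : ℕ} {D : ℤ} (hs : SlowTo w Λ) (hw : 16 * W ≤ w) (hlW : l + 4 ≤ W)
    (hD : bits D ≤ W) (hf : ∀ i ≤ l, bits (i.factorial : ℤ) ≤ W)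
    (hp : ∀ i ≤ l, bits ((-D) ^ i) ≤ W) {σ : State} (h28 : σ.reg 28 = l) (h17 : σ.reg 17 = D) :
    Runs ev T factLoop σ ((25 + 25 * l) * (w * Λ)) fun σ' => σ'.Agree 29 σ ∧ σ'.mem = σ.mem ∧
      σ'.reg 41 = l.factorial ∧ σ'.reg 42 = (-D) ^ l := by
  have hb0 : bits 0 = 1 := rfl
  have hb1 : bits 1 = 2 := rfl
  have hbl := bits_natCast_le (le_refl l)
  refine Runs.assign_seq hs (by simp only [width]; omega) (by simp only [nodes]; omega) ?_
  refine Runs.assign_seq hs (by simp only [width]; omega) (by simp only [nodes]; omega) ?_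
  refine Runs.assign_seq hs (by simp only [width]; omega) (by simp only [nodes]; omega) ?_
  refine Runs.while_mul (fun j σ' => ∃ i : ℕ, i + j = l ∧ σ'.Agree 29 σ ∧ σ'.mem = σ.mem ∧
    σ'.reg 29 = i ∧ σ'.reg 41 = i.factorial ∧ σ'.reg 42 = (-D) ^ i)
    hs 15 ?_ ?_ ?_ l _ ?_ ?_
  · rintro j σ' ⟨i, hi, hag, hm, h29, h41, h42⟩
    have h1 := bits_natCast_le (by omega : i ≤ l)
    simp only [width, hag 28 (by norm_num), h28, h29]
    omega
  · rintro j σ' ⟨i, hi, hag, hm, h29, h41, h42⟩ hpos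
    simp only [eval, hag 28 (by norm_num), h28, h29] at hpos
    refine ⟨j - 1, by omega, ?_⟩
    have h1 := bits_natCast_le (by omega : i ≤ l)
    have h2 := bits_natCast_le (by omega : i + 1 ≤ l)
    have h3 := hf i (by omega)
    have h4 := hp i (by omega)
    push_cast at h2
    refine Runs.assign_seq hs (by simp [width, h29]; omega) (by simp only [nodes]; omega) ?_
    refine Runs.assign_seq hs (by simp [width, eval, h29, h41]; omega)
      (by simp only [nodes]; omega) ?_
    refine Runs.assign hs (by simp [width, h42, hag 17 (by norm_num), h17]; omega)
      (by simp only [nodes]; omega) ?_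
    refine ⟨i + 1, by omega, ((hag.setReg le_rfl _).setReg (by norm_num) _).setReg (by norm_num) _,
      hm, by simp [eval, h29], ?_, ?_⟩
    · simp [eval, h29, h41, Nat.factorial_succ, mul_comm]
    · simp [eval, h42, hag 17 (by norm_num), h17, pow_succ]
  · rintro j σ' ⟨i, hi, hag, hm, h29, h41, h42⟩ hpos
    simp only [eval, hag 28 (by norm_num), h28, h29] at hpos
    obtain rfl : i = l := by omega
    exact ⟨hag, hm, h41, h42⟩
  · exact ⟨0, by simp, (((State.Agree.refl 29 σ).setReg le_rfl _).setReg (by norm_num) _).setReg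
      (by norm_num) _, rfl, by simp [eval], by simp [eval], by simp [eval]⟩
  · simp only [nodes]; omega

end HigherOrderNewton

namespace HigherOrderNewton

open HigherOrderNewton.Expr

variable {ev : ℤ → ℤ → ℤ × ℤ} {T : ℕ → ℕ}

/-! ### The approximate power sums -/

/-- Computes `g̃_l` for `l = reg 25` as the fraction `reg 26 / reg 27`. -/
def gProg : Prog :=
  .ite (.reg 25)
    (.seq (.assign 28 (.sub (.reg 25) (.const 1))) <|
      .seq fillLoop <| .seq (upLoop 25 20 36 37) <| .seq padLoop <| .seq treeSum <| .seq factLoop <|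
      .seq (.assign 26 (.mul (.mul (.reg 42) (.reg 16)) (.mem (.const 0))))
        (.assign 27 (.mul (.reg 41) (.mem (.const 1)))))
    (.seq (.assign 26 (.reg 0)) (.assign 27 (.const 1)))

/-- The integers `GP`, `A`, `D` are the inverses of the accuracy and the two steps of `P`, and the
numbers in the computation have length at most `W`. -/
structure Consts (n k : ℕ) (P : Params) (W : ℕ) (GP AX AD A D : ℤ) : Prop where
  hk : 1 ≤ k
  hGP : 0 < GP
  hD : 0 < D
  hA : 0 < A
  hAX : A = AX * GP
  hAD : A = AD * D
  delta : P.delta = 1 / D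
  alpha : P.alpha = 1 / A
  bn : bits n ≤ W
  bGP : bits GP ≤ W
  bAX : bits AX ≤ W
  bAD : bits AD ≤ W
  bA : bits A ≤ W
  bD : bits D ≤ W
  bk : k + 6 ≤ W
  bfact : ∀ i < k, bits (i.factorial : ℤ) ≤ W
  bpow : ∀ i < k, bits ((-D) ^ i) ≤ W

/-- The evaluation points near `X / GP` have short coordinates, and the polynomial is positive
there. -/
structure GoodPoint (ev : ℤ → ℤ → ℤ × ℤ) (T : ℕ → ℕ) (k W : ℕ) (X AX AD A : ℤ) : Prop where
  bX : bits X ≤ W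
  bq : ∀ j < k, bits (X * AX + (j : ℤ) * AD) ≤ W
  hT : ∀ j < k, T (bits (X * AX + (j : ℤ) * AD) + bits A) ≤ W
  hT1 : ∀ j < k, T (bits (X * AX + (j : ℤ) * AD + 1) + bits A) ≤ W
  pos : ∀ j < k, 0 < (ev (X * AX + (j : ℤ) * AD) A).1

/-- The subroutine `ev` computes the function `f`. -/
structure Evaluates (ev : ℤ → ℤ → ℤ × ℤ) (T : ℕ → ℕ) (f : ℝ → ℝ) : Prop where
  den_pos : ∀ u v : ℤ, 0 < v → 0 < (ev u v).2
  correct : ∀ u v : ℤ, 0 < v → f ((u : ℝ) / (v : ℝ)) = ((ev u v).1 : ℝ) / ((ev u v).2 : ℝ)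
  writes : ∀ u v : ℤ, 0 < v → bits (ev u v).1 + bits (ev u v).2 ≤ T (bits u + bits v)

section

variable {n k W : ℕ} {P : Params} {GP AX AD A D X : ℤ} {f : ℝ → ℝ}

theorem GoodPoint.fillBounds (hP : Consts n k P W GP AX AD A D) (hev : Evaluates ev T f)
    (hX : GoodPoint ev T k W X AX AD A) {l : ℕ} (hl : l < k) : FillBounds ev T W X AX AD A l := by
  have hk := hP.bk
  have key : ∀ i ≤ l, ((l : ℤ) - i) = ((l - i : ℕ) : ℤ) := fun i hi => by omega
  refine ⟨by omega, hP.hA, hX.bX, hP.bAX, hP.bAD, hP.bA, by omega, fun i hi => ?_, fun i hi => ?_,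
    fun i hi => ?_, hev.writes⟩
  · rw [key i hi]; exact hX.bq _ (by omega)
  · rw [key i hi]; exact hX.hT _ (by omega)
  · rw [key i hi]; exact hX.hT1 _ (by omega)

/-- The number `A` is a multiple of `GP` and of `D`, so every evaluation point is some `q/A`, and
adding `α = 1/A` raises the numerator by one. The factor `1/α = A` is kept out of the stored
fractions and restored after the summation. -/
theorem run_gTildeOne_eq (hP : Consts n k P W GP AX AD A D) (hev : Evaluates ev T f) (l i : ℕ)
    (c : ℤ) (hpos : (ev (X * AX + ((l : ℤ) - i) * AD) A).1 ≠ 0) :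
    (c : ℝ) * (gTildeOne P ((X : ℝ) / GP + ((l : ℝ) - i) * P.delta)).run f
      = A * ((slopeNum ev A (X * AX + ((l : ℤ) - i) * AD) c : ℝ) /
        (slopeDen ev A (X * AX + ((l : ℤ) - i) * AD) : ℝ)) := by
  set q : ℤ := X * AX + ((l : ℤ) - i) * AD with hq
  have hGP : (GP : ℝ) ≠ 0 := by exact_mod_cast hP.hGP.ne'
  have hD : (D : ℝ) ≠ 0 := by exact_mod_cast hP.hD.ne'
  have hA : (A : ℝ) ≠ 0 := by exact_mod_cast hP.hA.ne'
  have e1 : (X : ℝ) / GP = X * AX / A := by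
    rw [div_eq_div_iff hGP hA, hP.hAX]; push_cast; ring
  have e2 : 1 / (D : ℝ) = AD / A := by
    rw [div_eq_div_iff hD hA, hP.hAD]; push_cast; ring
  have hx : (X : ℝ) / GP + ((l : ℝ) - i) * P.delta = (q : ℝ) / A := by
    rw [e1, hP.delta, e2, hq]; push_cast; ring
  have hx1 : (q : ℝ) / A + P.alpha = ((q + 1 : ℤ) : ℝ) / A := by
    rw [hP.alpha]; push_cast; ring
  rw [run_gTildeOne, hx, hx1, hev.correct _ _ hP.hA, hev.correct _ _ hP.hA, slopeNum, slopeDen,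
    hP.alpha]
  have d1 : ((ev q A).2 : ℝ) ≠ 0 := by exact_mod_cast (hev.den_pos q A hP.hA).ne'
  have d2 : ((ev (q + 1) A).2 : ℝ) ≠ 0 := by exact_mod_cast (hev.den_pos (q + 1) A hP.hA).ne'
  have d3 : ((ev q A).1 : ℝ) ≠ 0 := by exact_mod_cast hpos
  push_cast
  field_simp

theorem run_gTilde_eq (hP : Consts n k P W GP AX AD A D) (hev : Evaluates ev T f)
    (hX : GoodPoint ev T k W X AX AD A) {l : ℕ} (hl : l < k) :
    (gTilde n P (l + 1) ((X : ℝ) / GP)).run f = ((-D) ^ l * A : ℝ) / l.factorial *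
      ∑ i ∈ Finset.range (l + 1),
        (slopeNum ev A (X * AX + ((l : ℤ) - i) * AD) ((-1) ^ i * (l.choose i : ℤ)) : ℝ) /
        (slopeDen ev A (X * AX + ((l : ℤ) - i) * AD) : ℝ) := by
  have hD : (D : ℝ) ≠ 0 := by exact_mod_cast hP.hD.ne'
  rw [run_gTilde_succ]
  have h1 : ∀ i ∈ Finset.range (l + 1), (-1 : ℝ) ^ i * (l.choose i : ℝ) *
      (gTildeOne P ((X : ℝ) / GP + ((l : ℝ) - i) * P.delta)).run f
      = A * ((slopeNum ev A (X * AX + ((l : ℤ) - i) * AD) ((-1) ^ i * (l.choose i : ℤ)) : ℝ) /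
        (slopeDen ev A (X * AX + ((l : ℤ) - i) * AD) : ℝ)) := fun i hi => by
    have hi' : i ≤ l := by simpa [Nat.lt_succ_iff] using hi
    rw [← run_gTildeOne_eq hP hev l i]
    · push_cast; rfl
    · rw [← Nat.cast_sub hi']; exact (hX.pos _ (by omega)).ne'
  rw [Finset.sum_congr rfl h1, ← Finset.mul_sum, hP.delta, neg_pow (D : ℝ), one_div_pow,
    one_div_one_div]
  have hf : (l.factorial : ℝ) ≠ 0 := by exact_mod_cast l.factorial_ne_zero
  field_simp

/-- The contents of the registers in front of a call of `gProg`. -/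
structure GInput (σ : State) (n : ℕ) (X AX AD A D : ℤ) : Prop where
  h0 : σ.reg 0 = n
  h14 : σ.reg 14 = AX
  h15 : σ.reg 15 = AD
  h16 : σ.reg 16 = A
  h17 : σ.reg 17 = D
  h19 : σ.reg 19 = X
  h20 : σ.reg 20 = 1

theorem GInput.of_agree {σ σ' : State} (h : GInput σ n X AX AD A D) {m : ℕ} (hm : 21 ≤ m)
    (hag : σ'.Agree m σ) : GInput σ' n X AX AD A D :=
  ⟨(hag 0 (by omega)).trans h.h0, (hag 14 (by omega)).trans h.h14,
    (hag 15 (by omega)).trans h.h15, (hag 16 (by omega)).trans h.h16,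
    (hag 17 (by omega)).trans h.h17, (hag 19 (by omega)).trans h.h19,
    (hag 20 (by omega)).trans h.h20⟩

theorem two_pow_clog_le (m : ℕ) (hm : 1 ≤ m) : 2 ^ Nat.clog 2 m ≤ 2 * m := by
  rcases hm.eq_or_lt with rfl | hm
  · simp
  · have h1 := Nat.pow_pred_clog_lt_self (by norm_num : 1 < 2) hm
    have h2 := Nat.clog_pos (by norm_num : 1 < 2) hm
    have h3 : 2 ^ Nat.clog 2 m = 2 * 2 ^ (Nat.clog 2 m - 1) := by
      rw [← pow_succ']; congr 1; omega
    rw [Nat.pred_eq_sub_one] at h1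
    omega

/-- The filling, padding and factorial loops take `O(k)` operations on numbers of length `O(W)`. The
tree dominates, with at most `s` passes of cost `O(k W Λ)`. The output length `14 k W` is `Y ≤ 12 k
W` plus the factors `(-D)^l` and `A`. -/
theorem runs_gProg {s Λ : ℕ} (hs : SlowTo (800 * (k * W)) Λ) (hsk : Nat.clog 2 k + 1 ≤ s)
    (hP : Consts n k P W GP AX AD A D) (hev : Evaluates ev T f)
    (hX : GoodPoint ev T k W X AX AD A) {L : ℕ} (hL : L ≤ k) {σ : State}
    (hσ : GInput σ n X AX AD A D) (h25 : σ.reg 25 = L) :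
    Runs ev T gProg σ (200000 * (k * s * W * Λ)) fun σ' => σ'.Agree 26 σ ∧ 0 < σ'.reg 27 ∧
      bits (σ'.reg 26) ≤ 14 * (k * W) ∧ bits (σ'.reg 27) ≤ 14 * (k * W) ∧
      (σ'.reg 26 : ℝ) / (σ'.reg 27 : ℝ) = (gTilde n P L ((X : ℝ) / GP)).run f := by
  have hb0 : bits 0 = 1 := rfl
  have hb1 : bits 1 = 2 := rfl
  have hk := hP.hk
  have hkW := hP.bk
  have hWkW : W ≤ k * W := Nat.le_mul_of_pos_left _ hk
  have hs1 : SlowTo (16 * W) Λ := hs.mono (by omega)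
  have hkZ : k ≤ k * s := Nat.le_mul_of_pos_right _ (by omega)
  have hsZ : s ≤ k * s := Nat.le_mul_of_pos_left _ hk
  have hbL : bits (L : ℤ) ≤ W := (bits_natCast_le hL).trans (by omega)
  have hcost : 12500 * (k * s) * (16 * W * Λ) = 200000 * (k * s * W * Λ) := by ring
  rw [← hcost]
  refine Runs.ite hs1 (by simp only [width, h25]; omega)
    (by simp only [nodes]; omega) (fun hpos => ?_) fun hneg => ?_
  swap
  -- Depth 1 also needs `g̃_0`, which is the number `n` and takes no evaluation.
  · simp only [eval, h25] at hneg
    obtain rfl : L = 0 := by omega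
    have := hP.bn
    refine Runs.assign_seq hs1 (by simp only [width, hσ.h0]; omega) (by simp only [nodes]; omega) ?_
    refine Runs.assign hs1 (by simp only [width]; omega) (by simp only [nodes]; omega) ?_
    refine ⟨((State.Agree.refl 26 σ).setReg le_rfl _).setReg (by norm_num) _, ?_, ?_, ?_, ?_⟩
    · simp [eval]
    · simp [eval, hσ.h0]; omega
    · simp [eval]; omega
    · simp [eval, hσ.h0, run_gTilde_zero]
  simp only [eval, h25] at hpos
  obtain ⟨l, rfl⟩ : ∃ l, L = l + 1 := ⟨L - 1, by omega⟩
  have hl : l < k := hL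
  have hfb := hX.fillBounds hP hev hl
  set S := Nat.clog 2 (l + 1) with hS
  have hSk : S + 1 ≤ s := (Nat.add_le_add_right (Nat.clog_mono_right 2 hL) 1).trans hsk
  have hSle : l + 1 ≤ 2 ^ S := Nat.le_pow_clog (by norm_num) _
  have hSge : 2 ^ S ≤ 2 * (l + 1) := two_pow_clog_le _ (by omega)
  have hSl : S ≤ l + 1 := Nat.clog_le_of_le_pow Nat.lt_two_pow_self.le
  set a : ℕ → ℤ := fun i =>
    slopeNum ev A (X * AX + ((l : ℤ) - i) * AD) ((-1) ^ i * (l.choose i : ℤ)) with ha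
  set b : ℕ → ℤ := fun i => slopeDen ev A (X * AX + ((l : ℤ) - i) * AD) with hb
  set Y := 2 ^ S * (5 * W + 1) with hY
  clear_value Y
  have hYk : Y ≤ 12 * (k * W) := by
    calc Y = 2 ^ S * (5 * W + 1) := hY
      _ ≤ (2 * k) * (6 * W) := Nat.mul_le_mul (by omega) (by omega)
      _ = _ := by ring
  have hWY : 5 * W + 1 ≤ Y := hY ▸ Nat.le_mul_of_pos_left _ (by positivity)
  have hs2 : SlowTo (64 * Y) Λ := hs.mono (by omega)
  have hYu : 64 * Y * Λ ≤ 48 * k * (16 * W * Λ) := by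
    calc 64 * Y * Λ ≤ 64 * (12 * (k * W)) * Λ := by gcongr
      _ = _ := by ring
  have hbits : ∀ i < l + 1, bits (a i) ≤ 5 * W ∧ bits (b i) ≤ 5 * W ∧ 0 < b i := by
    intro i hi
    have h1 := bits_signed_choose_le l i
    have hT := hfb.hT i (by omega)
    have hT1 := hfb.hT1 i (by omega)
    have hp : 0 < (ev (X * AX + ((l : ℤ) - i) * AD) A).1 := by
      have := hX.pos (l - i) (by omega)
      rwa [Nat.cast_sub (by omega)] at this
    simp only [ha, hb, slopeNum, slopeDen]
    set q := X * AX + ((l : ℤ) - i) * AD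
    have w0 := hev.writes q A hP.hA
    have w1 := hev.writes (q + 1) A hP.hA
    have m1 := bits_mul_le ((-1) ^ i * (l.choose i : ℤ))
      ((ev (q + 1) A).1 * (ev q A).2 - (ev q A).1 * (ev (q + 1) A).2)
    have m2 := bits_sub_le ((ev (q + 1) A).1 * (ev q A).2) ((ev q A).1 * (ev (q + 1) A).2)
    have m3 := bits_mul_le (ev (q + 1) A).1 (ev q A).2
    have m4 := bits_mul_le (ev q A).1 (ev (q + 1) A).2
    exact ⟨by omega, by omega, mul_pos hp (hev.den_pos _ _ hP.hA)⟩
  refine Runs.assign_seq hs1 (by simp only [width, h25]; omega) (by simp only [nodes]; omega) ?_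
  have e28 : (Expr.sub (.reg 25) (.const 1)).eval σ = l := by
    simp only [eval, h25]; push_cast; ring
  rw [e28]
  refine Runs.seq_mul (a := 160 * (k * s)) ((runs_fillLoop hs1 le_rfl hfb
    ⟨by simp [hσ.h14], by simp [hσ.h15], by simp [hσ.h16], by simp [hσ.h19], by simp⟩
    (by simp [h25])).mono (Nat.mul_le_mul_right _ (by omega)) fun _ h => h)
    (by simp only [nodes]; omega) ?_
  rintro σ₁ ⟨hag₁, h29₁, hh₁⟩
  have hag₁' : σ₁.Agree 28 σ :=
    (hag₁.mono (by norm_num)).trans ((State.Agree.refl 28 σ).setReg le_rfl _)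
  have h28₁ : σ₁.reg 28 = l := by rw [hag₁ 28 (by norm_num)]; simp
  refine Runs.seq_mul (a := 32 * (k * s)) ((runs_upLoop (W := W) (J := S) (x := (l + 1 : ℕ)) (y := 1)
    (by norm_num) (by norm_num) (by norm_num) (by norm_num) (by norm_num) hs1 (by omega)
    ((hag₁' 25 (by norm_num)).trans h25) ((hag₁' 20 (by norm_num)).trans hσ.h20) hbL (by omega)
    (by omega) (by rw [one_mul]; exact_mod_cast hSle)
    fun j hj => by rw [one_mul]; exact_mod_cast Nat.pow_lt_of_lt_clog hj).mono
    (Nat.mul_le_mul_right _ (by omega)) fun _ h => h)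
    (by simp only [nodes]; omega) ?_
  rintro σ₂ ⟨hm₂, hr₂, h36₂, -⟩
  have hag₂ : σ₂.Agree 28 σ := fun r hr => (hr₂ r (by omega) (by omega)).trans (hag₁' r hr)
  have h28₂ : σ₂.reg 28 = l := (hr₂ 28 (by norm_num) (by norm_num)).trans h28₁
  have hh₂ : σ₂.Holds (l + 1) a b := fun i hi => by rw [hm₂]; exact hh₁ i hi
  refine Runs.seq_mul (a := 75 * (k * s)) ((runs_padLoop (M := 2 ^ S) (W := W) hs1 le_rfl (by omega)
    (by push_cast; rw [bits_two_pow]; omega) hSle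
    ((hr₂ 29 (by norm_num) (by norm_num)).trans h29₁) (by rw [h36₂]; push_cast; rfl) hh₂).mono
    (Nat.mul_le_mul_right _ (by omega)) fun _ h => h)
    (by simp only [nodes]; omega) ?_
  rintro σ₃ ⟨hag₃, h36₃, hh₃⟩
  push_cast at h36₃
  have hag₃' : σ₃.Agree 28 σ := (hag₃.mono (by norm_num)).trans hag₂
  refine Runs.seq_mul (a := 9600 * (k * s)) ((runs_treeSum (w₀ := 5 * W) (S := S) (by omega) hY.symm
    hs2 (fun i hi => ?_) (fun i hi => ?_) (fun i hi => ?_) h36₃ hh₃).mono ?_ fun _ h => h)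
    (by simp only [nodes]; omega) ?_
  · split_ifs with h
    · exact (hbits i h).1
    · omega
  · split_ifs with h
    · exact (hbits i h).2.1
    · omega
  · split_ifs with h
    · exact (hbits i h).2.2
    · norm_num
  · calc (S + 1) * (200 * (64 * Y * Λ)) ≤ s * (200 * (48 * k * (16 * W * Λ))) := by gcongr
      _ = _ := by ring
  rintro σ₄ ⟨hag₄, hpos₄, hb0₄, hb1₄, hsum₄⟩
  have hag₄' : σ₄.Agree 28 σ := (hag₄.mono (by norm_num)).trans hag₃'
  have h28₄ : σ₄.reg 28 = l := by
    rw [hag₄ 28 (by norm_num), hag₃ 28 (by norm_num), h28₂]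
  refine Runs.seq_mul (a := 25 * (k * s)) ((runs_factLoop (W := W) hs1 le_rfl (by omega) hP.bD
    (fun i hi => hP.bfact i (by omega)) (fun i hi => hP.bpow i (by omega)) h28₄
    ((hag₄' 17 (by norm_num)).trans hσ.h17)).mono
    (Nat.mul_le_mul_right _ (by omega)) fun _ h => h)
    (by simp only [nodes]; omega) ?_
  rintro σ₅ ⟨hag₅, hm₅, h41₅, h42₅⟩
  have hag₅' : σ₅.Agree 28 σ := (hag₅.mono (by norm_num)).trans hag₄'
  have h16₅ : σ₅.reg 16 = A := (hag₅' 16 (by norm_num)).trans hσ.h16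
  have bA := hP.bA
  have bf := hP.bfact l hl
  have bp := hP.bpow l hl
  -- The tree sum has length up to `Y`, so the last two operations are charged at word length `64 Y`
  -- instead of `16 W`.
  refine Runs.mono (a := 12 * (64 * Y * Λ)) (R := _) ?_ ?_ fun _ h => h
  swap
  · refine (Nat.mul_le_mul_left 12 hYu).trans ?_
    rw [← mul_assoc]
    exact Nat.mul_le_mul_right _ (by simp only [nodes]; omega)
  refine Runs.assign_seq hs2 (by simp only [width, eval, h42₅, h16₅, hm₅]; omega)
    (by simp only [nodes]; omega) ?_
  refine Runs.assign hs2 (by simp [width, eval, h41₅, hm₅]; omega) (by simp only [nodes]; omega) ?_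
  refine ⟨(((hag₅'.mono (by norm_num)).setReg le_rfl _).setReg (by norm_num) _), ?_, ?_, ?_, ?_⟩
  · simp only [eval, State.setReg_reg, State.setReg_mem, h41₅, hm₅, reduceIte, Nat.reduceEqDiff]
    exact mul_pos (by exact_mod_cast l.factorial_pos) hpos₄
  · simp only [eval, State.setReg_reg, h42₅, h16₅, hm₅, reduceIte, Nat.reduceEqDiff]
    have m1 := bits_mul_le ((-D) ^ l * A) (σ₄.mem 0)
    have m2 := bits_mul_le ((-D) ^ l) A
    omega
  · simp only [eval, State.setReg_reg, State.setReg_mem, h41₅, hm₅, reduceIte, Nat.reduceEqDiff]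
    have m1 := bits_mul_le (l.factorial : ℤ) (σ₄.mem 1)
    omega
  · simp only [eval, State.setReg_reg, State.setReg_mem, h41₅, h42₅, h16₅, hm₅, reduceIte,
      Nat.reduceEqDiff]
    rw [run_gTilde_eq hP hev hX hl]
    -- The padding contributes only terms `0/1`.
    have hsub : ∑ i ∈ Finset.range (2 ^ S), (((if i < l + 1 then a i else 0 : ℤ)) : ℝ) /
        ((if i < l + 1 then b i else 1 : ℤ) : ℝ) = ∑ i ∈ Finset.range (l + 1), (a i : ℝ) / b i := by
      rw [← Finset.sum_subset (Finset.range_mono hSle)]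
      · refine Finset.sum_congr rfl fun i hi => ?_
        rw [if_pos (Finset.mem_range.mp hi), if_pos (Finset.mem_range.mp hi)]
      · intro i _ hi
        rw [if_neg (fun h => hi (Finset.mem_range.mpr h))]
        simp
    rw [← hsub, ← hsum₄]
    push_cast
    ring

end

end HigherOrderNewton

namespace HigherOrderNewton

open HigherOrderNewton.Expr

variable {ev : ℤ → ℤ → ℤ × ℤ} {T : ℕ → ℕ}

/-! ### Rounds -/

/-- The test `an * bd * EP - 4 * R * (ad * bn)` of a round. -/
def testExpr : Expr :=
  .sub (.mul (.mul (.reg 21) (.reg 24)) (.reg 12))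
    (.mul (.mul (.const 4) (.reg 11)) (.mul (.reg 22) (.reg 23)))

/-- The rounded update, in units of the accuracy. -/
def floorExpr : Expr :=
  .div (.mul (.mul (.reg 21) (.reg 24)) (.reg 13))
    (.mul (.mul (.const 4) (.reg 11)) (.mul (.reg 22) (.reg 23)))

/-- The end of a round, when the two approximate power sums are known. -/
def roundEnd : Prog :=
  .ite testExpr
    (.seq (.assign 19 (.sub (.reg 19) floorExpr)) (.assign 18 (.sub (.reg 18) (.const 1))))
    (.assign 18 (.const 0))

/-- One round. -/
def roundBody : Prog :=
  .seq (.assign 25 (.sub (.reg 1) (.const 1))) <| .seq gProg <|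
  .seq (.assign 21 (.reg 26)) <| .seq (.assign 22 (.reg 27)) <|
  .seq (.assign 25 (.reg 1)) <| .seq gProg <|
  .seq (.assign 23 (.reg 26)) <| .seq (.assign 24 (.reg 27)) roundEnd

/-- The integers `R` and `EP` are the root parameter and the inverse of the threshold. -/
structure RoundConsts (P : Params) (k W : ℕ) (GP R EP : ℤ) : Prop where
  hR : 0 < R
  hEP : 0 < EP
  root : P.root = R
  threshold : P.threshold = 1 / EP
  grid : P.grid = 1 / GP
  bR : bits R ≤ W
  bEP : bits EP ≤ W

/-- The contents of the registers in front of a round. -/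
structure RoundInput (σ : State) (n k : ℕ) (X AX AD A D GP R EP : ℤ) : Prop
    extends GInput σ n X AX AD A D where
  h1 : σ.reg 1 = k
  h11 : σ.reg 11 = R
  h12 : σ.reg 12 = EP
  h13 : σ.reg 13 = GP

section

variable {n k W : ℕ} {P : Params} {GP AX AD A D X R EP : ℤ} {f : ℝ → ℝ}

theorem RoundInput.of_agree {σ σ' : State} (h : RoundInput σ n k X AX AD A D GP R EP) {m : ℕ}
    (hm : 21 ≤ m) (hag : σ'.Agree m σ) : RoundInput σ' n k X AX AD A D GP R EP :=
  ⟨h.toGInput.of_agree hm hag, (hag 1 (by omega)).trans h.h1, (hag 11 (by omega)).trans h.h11,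
    (hag 12 (by omega)).trans h.h12, (hag 13 (by omega)).trans h.h13⟩

theorem update_eq_div {an ad bn bd : ℤ} (hr : P.root = R)
    (ha : (an : ℝ) / ad = (gTilde n P (k - 1) ((X : ℝ) / GP)).run f)
    (hb : (bn : ℝ) / bd = (gTilde n P k ((X : ℝ) / GP)).run f) :
    update n k P f ((X : ℝ) / GP) = ((an * bd : ℤ) : ℝ) / ((4 * R * (ad * bn) : ℤ) : ℝ) := by
  rw [update, ← ha, ← hb, hr]
  push_cast
  rw [div_div_div_eq, div_mul_div_comm, one_mul]

/-- Cross-multiplication with positive denominators turns the real stopping test into the sign of an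
integer, so the machine branches exactly as the iteration does. -/
theorem lt_update_iff {P : Params} {u : ℝ} {N M EP : ℤ} (hEP : 0 < EP) (hM : 0 < M)
    (ht : P.threshold = 1 / EP) (hu : u = (N : ℝ) / M) : P.threshold < u ↔ 0 < N * EP - M := by
  have h1 : (0 : ℝ) < EP := by exact_mod_cast hEP
  have h2 : (0 : ℝ) < M := by exact_mod_cast hM
  rw [ht, hu, div_lt_div_iff₀ h1 h2, one_mul, sub_pos]
  exact_mod_cast Iff.rfl

/-- For a positive divisor integer division is the floor of the quotient; no rounding error enters.
-/
theorem floor_update {P : Params} {u : ℝ} {N M GP : ℤ} (hM : 0 < M) (hg : P.grid = 1 / GP)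
    (hu : u = (N : ℝ) / M) : ⌊u / P.grid⌋ = N * GP / M := by
  have h2 : (0 : ℝ) < M := by exact_mod_cast hM
  have h3 : u / P.grid = ((N * GP : ℤ) : ℝ) / M := by
    rw [hu, hg]; push_cast; rw [div_div_eq_mul_div, div_one]; ring
  rw [h3]
  refine Int.floor_eq_iff.mpr ⟨?_, ?_⟩
  · rw [le_div_iff₀ h2]
    exact_mod_cast Int.ediv_mul_le _ hM.ne'
  · rw [div_lt_iff₀ h2]
    exact_mod_cast Int.lt_ediv_add_one_mul_self _ hM

theorem runs_roundEnd {w Λ B N : ℕ} {an ad bn bd : ℤ} (hs : SlowTo w Λ) (hw : 4 * B + 4 * W ≤ w)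
    (hW : 6 ≤ W) (hR : RoundConsts P k W GP R EP) (bGP : bits GP ≤ W)
    (bX : bits X ≤ W) (bN : bits (N : ℤ) ≤ W) (ban : bits an ≤ B) (bad : bits ad ≤ B)
    (bbn : bits bn ≤ B) (bbd : bits bd ≤ B) (hM : 0 < 4 * R * (ad * bn))
    (hu : update n k P f ((X : ℝ) / GP) = ((an * bd : ℤ) : ℝ) / ((4 * R * (ad * bn) : ℤ) : ℝ))
    {σ : State} (hσ : RoundInput σ n k X AX AD A D GP R EP) (h18 : σ.reg 18 = (N + 1 : ℕ))
    (h21 : σ.reg 21 = an) (h22 : σ.reg 22 = ad) (h23 : σ.reg 23 = bn) (h24 : σ.reg 24 = bd) :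
    Runs ev T roundEnd σ (40 * (w * Λ)) fun σ' => σ'.Agree 18 σ ∧ σ'.reg 20 = 1 ∧
      ((update n k P f ((X : ℝ) / GP) ≤ P.threshold ∧ σ'.reg 18 = 0 ∧ σ'.reg 19 = X) ∨
      (P.threshold < update n k P f ((X : ℝ) / GP) ∧ σ'.reg 18 = N ∧
        σ'.reg 19 = X - ⌊update n k P f ((X : ℝ) / GP) / P.grid⌋)) := by
  have hb0 : bits 0 = 1 := rfl
  have hb1 : bits 1 = 2 := rfl
  have hb4 : bits 4 = 4 := rfl
  have bR := hR.bR
  have bEP := hR.bEP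
  have bN1 : bits ((N + 1 : ℕ) : ℤ) ≤ 2 * W := by
    push_cast
    exact (bits_add_le _ _).trans (by omega)
  have htest : testExpr.eval σ = an * bd * EP - 4 * R * (ad * bn) := by
    simp only [testExpr, eval, h21, h22, h23, h24, hσ.h11, hσ.h12]
  have hfloor : floorExpr.eval σ = an * bd * GP / (4 * R * (ad * bn)) := by
    simp only [floorExpr, eval, h21, h22, h23, h24, hσ.h11, hσ.h13]
  have hiff := lt_update_iff hR.hEP hM hR.threshold hu
  refine Runs.ite hs
    (by simp only [testExpr, width, h21, h22, h23, h24, hσ.h11, hσ.h12]; omega)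
    (by simp only [testExpr, nodes]; omega) (fun hpos => ?_) fun hneg => ?_
  · rw [htest] at hpos
    refine Runs.assign_seq hs
      (by simp only [floorExpr, width, h21, h22, h23, h24, hσ.h11, hσ.h13, hσ.h19]; omega)
      (by simp only [testExpr, floorExpr, nodes]; omega) ?_
    refine Runs.assign hs (by simp [width, h18]; push_cast at bN1; omega)
      (by simp only [testExpr, floorExpr, nodes]; omega) ?_
    refine ⟨((State.Agree.refl 18 σ).setReg (by norm_num) _).setReg le_rfl _,
      by simp [hσ.h20], Or.inr ⟨hiff.mpr hpos, ?_, ?_⟩⟩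
    · simp [eval, h18]
    · rw [floor_update hM hR.grid hu, ← hfloor]
      simp [eval, hσ.h19]
  · rw [htest] at hneg
    refine Runs.assign hs (by simp only [width]; omega)
      (by simp only [testExpr, nodes]; omega) ?_
    exact ⟨(State.Agree.refl 18 σ).setReg le_rfl _, by simp [hσ.h20],
      Or.inl ⟨not_lt.mp fun h => hneg (hiff.mp h), by simp [eval], by simp [hσ.h19]⟩⟩

theorem runs_roundBody {s Λ N : ℕ} (hs : SlowTo (800 * (k * W)) Λ) (hsk : Nat.clog 2 k + 1 ≤ s)
    (hP : Consts n k P W GP AX AD A D) (hev : Evaluates ev T f) (hR : RoundConsts P k W GP R EP)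
    (hX : GoodPoint ev T k W X AX AD A) (hpos : 0 < (gTilde n P k ((X : ℝ) / GP)).run f)
    (bN : bits (N : ℤ) ≤ W)
    {σ : State} (hσ : RoundInput σ n k X AX AD A D GP R EP) (h18 : σ.reg 18 = (N + 1 : ℕ)) :
    Runs ev T roundBody σ (500000 * (k * s * W * Λ)) fun σ' => σ'.Agree 18 σ ∧ σ'.reg 20 = 1 ∧
      ((update n k P f ((X : ℝ) / GP) ≤ P.threshold ∧ σ'.reg 18 = 0 ∧ σ'.reg 19 = X) ∨
      (P.threshold < update n k P f ((X : ℝ) / GP) ∧ σ'.reg 18 = N ∧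
        σ'.reg 19 = X - ⌊update n k P f ((X : ℝ) / GP) / P.grid⌋)) := by
  have hb1 : bits 1 = 2 := rfl
  have hk := hP.hk
  have hkW := hP.bk
  have hWkW : W ≤ k * W := Nat.le_mul_of_pos_left _ hk
  have hbk := (bits_natCast_le (le_refl k))
  have hs3 : SlowTo (100 * (k * W)) Λ := hs.mono (by omega)
  have hZ : 100 * (k * W) * Λ ≤ 100 * (k * s * W * Λ) := by
    calc 100 * (k * W) * Λ = 100 * (k * 1 * W * Λ) := by ring
      _ ≤ 100 * (k * s * W * Λ) := by gcongr; omega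
  refine Runs.seq (a := 20 * (100 * (k * W) * Λ)) (b := 480000 * (k * s * W * Λ))
    (R := fun σ' => σ' = σ.setReg 25 ((k - 1 : ℕ) : ℤ)) (Runs.assign hs3
      (by simp only [width, hσ.h1]; omega) (by simp only [nodes]; omega) ?_) ?_ (by omega)
  · have : (Expr.sub (.reg 1) (.const 1)).eval σ = ((k - 1 : ℕ) : ℤ) := by
      simp only [eval, hσ.h1]; push_cast [hk]; ring
    rw [this]
  rintro _ rfl
  have hσ₀ := hσ.of_agree (m := 25) (by norm_num)
    ((State.Agree.refl 25 σ).setReg le_rfl ((k - 1 : ℕ) : ℤ))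
  refine Runs.seq (b := 280000 * (k * s * W * Λ)) (runs_gProg hs hsk hP hev hX
    (Nat.sub_le k 1) hσ₀.toGInput (by simp)) ?_ (by omega)
  rintro σ₁ ⟨hag₁, hp₁, bn₁, bd₁, hv₁⟩
  have hag₁' : σ₁.Agree 25 σ :=
    (hag₁.mono (by norm_num)).trans ((State.Agree.refl 25 σ).setReg le_rfl _)
  have hσ₁ := hσ.of_agree (by norm_num) hag₁'
  set an := σ₁.reg 26
  set ad := σ₁.reg 27
  set σ₂ := ((σ₁.setReg 21 an).setReg 22 ad).setReg 25 (k : ℤ) with hσ₂d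
  refine Runs.seq (a := 20 * (100 * (k * W) * Λ)) (b := 278000 * (k * s * W * Λ))
    (R := fun σ' => σ' = σ₁.setReg 21 an) (Runs.assign hs3 (by change bits an ≤ _; omega)
    (by simp only [nodes]; omega) rfl) ?_ (by omega)
  rintro _ rfl
  refine Runs.seq (a := 20 * (100 * (k * W) * Λ)) (b := 276000 * (k * s * W * Λ))
    (R := fun σ' => σ' = (σ₁.setReg 21 an).setReg 22 ad) (Runs.assign hs3
    (by change bits ad ≤ _; omega) (by simp only [nodes]; omega) rfl) ?_ (by omega)
  rintro _ rfl
  refine Runs.seq (a := 20 * (100 * (k * W) * Λ)) (b := 270000 * (k * s * W * Λ))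
    (R := fun σ' => σ' = σ₂) (Runs.assign hs3 (by simp [width, hσ₁.h1]; omega)
    (by simp only [nodes]; omega) (by simp [hσ₂d, eval, hσ₁.h1])) ?_ (by omega)
  rintro _ rfl
  have h18₂ : σ₂.reg 18 = (N + 1 : ℕ) := by
    simp [hσ₂d, hag₁' 18 (by norm_num), h18]
  have hσ₂ : RoundInput σ₂ n k X AX AD A D GP R EP :=
    hσ₁.of_agree (m := 21) le_rfl ((((State.Agree.refl 21 σ₁).setReg le_rfl _).setReg
      (by norm_num) _).setReg (by norm_num) _)
  refine Runs.seq (b := 70000 * (k * s * W * Λ)) (runs_gProg hs hsk hP hev hX le_rfl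
    hσ₂.toGInput (by simp [hσ₂d])) ?_ (by omega)
  rintro σ₃ ⟨hag₃, hp₃, bn₃, bd₃, hv₃⟩
  have hσ₃ := hσ₂.of_agree (by norm_num) hag₃
  have h21₃ : σ₃.reg 21 = an := by rw [hag₃ 21 (by norm_num)]; simp [hσ₂d]
  have h22₃ : σ₃.reg 22 = ad := by rw [hag₃ 22 (by norm_num)]; simp [hσ₂d]
  have hag₃' : σ₃.Agree 18 σ := (hag₃.mono (by norm_num)).trans
    ((((hag₁'.mono (by norm_num : 18 ≤ 25)).setReg (by norm_num) _).setReg (by norm_num) _).setReg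
      (by norm_num) _)
  refine Runs.mono (a := 60 * (100 * (k * W) * Λ)) (R := _) ?_ (by omega) fun _ h => h
  refine Runs.assign_seq hs3 (by simp only [width]; omega) (by simp only [nodes]; omega) ?_
  refine Runs.assign_seq hs3 (by simp [width]; omega) (by simp only [nodes]; omega) ?_
  -- The numerator of `g̃_k` is a factor of the divisor in `floorExpr`, so its sign matters.
  have hbn : 0 < σ₃.reg 26 := by
    rw [← hv₃] at hpos
    have h1 : (0 : ℝ) < σ₃.reg 27 := by exact_mod_cast hp₃
    have := (div_pos_iff_of_pos_right h1).mp hpos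
    exact_mod_cast this
  have hrR := hR.hR
  refine (runs_roundEnd (W := W) (B := 14 * (k * W)) (N := N) (X := X) (AX := AX) (AD := AD) (A := A)
    (D := D) (n := n) (k := k) (f := f) hs3 (by omega) (by omega) hR hP.bGP hX.bX bN bn₁
    bd₁ bn₃ bd₃ (by positivity) (update_eq_div hR.root hv₁ hv₃)
    (hσ₃.of_agree (m := 21) le_rfl
      (((State.Agree.refl 21 σ₃).setReg (by norm_num) _).setReg (by norm_num) _)) ?_ ?_ ?_ ?_
    ?_).mono (Nat.mul_le_mul_right _ (by simp only [nodes]; omega)) ?_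
  · simp [hag₃ 18 (by norm_num), h18₂]
  · simp [h21₃]
  · simp [h22₃]
  · simp [eval]
  · simp [eval]
  · rintro σ₄ ⟨hag₄, h⟩
    exact ⟨hag₄.trans ((hag₃'.setReg (by norm_num) _).setReg (by norm_num) _), h⟩

/-- The loop invariant contains the invariant of the convergence proof: the iterate stays at least
the threshold to the right of `λ_1` and at most 1. This keeps all evaluation points short, with `p`
positive there. -/
theorem runs_rounds {s Λ N : ℕ} (hs : SlowTo (800 * (k * W)) Λ) (hsk : Nat.clog 2 k + 1 ≤ s)
    (hP : Consts n k P W GP AX AD A D) (hev : Evaluates ev T f) (hR : RoundConsts P k W GP R EP)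
    (z : Fin n → ℝ) (hf : ∀ x, f x = ∏ i, (x - z i)) {err : ℝ} (hG : P.Good n k err)
    (i₀ : Fin n) (hi₀ : ∀ i, z i ≤ z i₀) (hz0 : 0 ≤ z i₀)
    (hgood : ∀ X : ℤ, P.threshold ≤ (X : ℝ) / GP - z i₀ → (X : ℝ) / GP ≤ 1 →
      GoodPoint ev T k W X AX AD A)
    (bN : bits (N : ℤ) ≤ W) (hX0 : P.threshold ≤ (X : ℝ) / GP - z i₀) (hX1 : (X : ℝ) / GP ≤ 1)
    {σ : State} (hσ : RoundInput σ n k X AX AD A D GP R EP) (h18 : σ.reg 18 = N) :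
    Runs ev T (.while (.reg 18) roundBody) σ ((N + 1) * (600000 * (k * s * W * Λ))) fun σ' =>
      σ'.Agree 18 σ ∧ bits (σ'.reg 19) ≤ W ∧
        (σ'.reg 19 : ℝ) / GP = (iterate n k P N ((X : ℝ) / GP)).run f := by
  have hk := hP.hk
  have hkW := hP.bk
  have hGP : (GP : ℝ) ≠ 0 := by exact_mod_cast hP.hGP.ne'
  have hWkW : W ≤ k * W := Nat.le_mul_of_pos_left _ hk
  have hs3 : SlowTo W Λ := hs.mono (by omega)
  have hZ : W * Λ ≤ k * s * W * Λ := by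
    calc W * Λ = 1 * 1 * W * Λ := by ring
      _ ≤ k * s * W * Λ := by gcongr; omega
  -- Register 18 holds `c ≤ j` rather than `j`, because stopping sets it to 0 at once.
  refine (Runs.while (fun j σ' => ∃ (c : ℕ) (Y : ℤ), c ≤ j ∧ j ≤ N ∧ σ'.Agree 18 σ ∧
    σ'.reg 18 = c ∧ σ'.reg 19 = Y ∧ σ'.reg 20 = 1 ∧
    (P.threshold ≤ (Y : ℝ) / GP - z i₀ ∧ (Y : ℝ) / GP ≤ 1) ∧
    (iterate n k P c ((Y : ℝ) / GP)).run f = (iterate n k P N ((X : ℝ) / GP)).run f)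
    (2 * (W * Λ)) (500000 * (k * s * W * Λ)) ?_ ?_ ?_ N σ ?_).mono ?_ fun _ h => h
  · rintro j σ' ⟨c, Y, hc, hj, hag, h18, h19, h20, hY, hit⟩
    refine Expr.cost_add_bits_le hs3 _ ?_
    simp only [width, h18]
    exact (bits_mono_of_nonneg (by positivity) (by exact_mod_cast hc.trans hj)).trans bN
  · rintro j σ' ⟨c, Y, hc, hj, hag, h18, h19, h20, hY, hit⟩ hpos
    simp only [eval, h18] at hpos
    obtain ⟨c, rfl⟩ : ∃ c', c = c' + 1 := ⟨c - 1, by omega⟩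
    refine ⟨j - 1, by omega, ?_⟩
    have hbc : bits (c : ℤ) ≤ W :=
      (bits_mono_of_nonneg (by positivity) (by exact_mod_cast (by omega : c ≤ N))).trans bN
    have hin : RoundInput σ' n k Y AX AD A D GP R EP :=
      ⟨⟨(hag 0 (by norm_num)).trans hσ.h0, (hag 14 (by norm_num)).trans hσ.h14,
        (hag 15 (by norm_num)).trans hσ.h15, (hag 16 (by norm_num)).trans hσ.h16,
        (hag 17 (by norm_num)).trans hσ.h17, h19, h20⟩, (hag 1 (by norm_num)).trans hσ.h1,
        (hag 11 (by norm_num)).trans hσ.h11, (hag 12 (by norm_num)).trans hσ.h12,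
        (hag 13 (by norm_num)).trans hσ.h13⟩
    have hd1 : (Y : ℝ) / GP - z i₀ ≤ 1 := by linarith [hY.2]
    have hx : ∀ i, (Y : ℝ) / GP - z i₀ ≤ (Y : ℝ) / GP - z i := fun i => by linarith [hi₀ i]
    have hpos' := gTilde_pos z f hf hG _ _ hx i₀ rfl hY.1 hd1 k le_rfl
    have hrb := round_bounds z f hf hG _ _ hx i₀ rfl hY.1 hd1 hk
    rw [run_iterate_succ] at hit
    refine (runs_roundBody hs hsk hP hev hR (hgood Y hY.1 hY.2) hpos' hbc hin h18).mono le_rfl ?_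
    rintro σ'' ⟨hag', h20', ⟨hu, h18', h19'⟩ | ⟨hu, h18', h19'⟩⟩
    · rw [if_pos hu] at hit
      exact ⟨0, Y, by omega, by omega, hag'.trans hag, h18', h19', h20', hY, hit⟩
    · rw [if_neg hu.not_ge] at hit
      obtain ⟨r1, r2, -⟩ := hrb.2 hu
      -- The grid is `1/GP`, so subtracting grid units keeps the denominator of the iterate.
      have hxe : (Y : ℝ) / GP - P.grid * (⌊update n k P f ((Y : ℝ) / GP) / P.grid⌋ : ℝ)
          = ((Y - ⌊update n k P f ((Y : ℝ) / GP) / P.grid⌋ : ℤ) : ℝ) / GP := by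
        generalize ⌊update n k P f ((Y : ℝ) / GP) / P.grid⌋ = F
        rw [hR.grid]
        push_cast
        ring
      rw [hxe] at hit
      refine ⟨c, _, by omega, by omega, hag'.trans hag, h18', h19', h20', ⟨?_, ?_⟩, hit⟩
      · rw [← hxe]; linarith
      · rw [← hxe]; linarith [hY.2]
  · rintro j σ' ⟨c, Y, hc, hj, hag, h18, h19, h20, hY, hit⟩ hpos
    simp only [eval, h18] at hpos
    obtain rfl : c = 0 := by omega
    refine ⟨hag, h19 ▸ (hgood Y hY.1 hY.2).bX, ?_⟩
    rw [h19, ← hit]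
    rfl
  · exact ⟨N, X, le_rfl, le_rfl, State.Agree.refl _ _, h18, hσ.h19, hσ.h20, ⟨hX0, hX1⟩, rfl⟩
  · generalize k * s * W * Λ = Z at *
    nlinarith [Nat.mul_le_mul_left N hZ]

end

end HigherOrderNewton

namespace HigherOrderNewton

open HigherOrderNewton.Expr

variable {ev : ℤ → ℤ → ℤ × ℤ} {T : ℕ → ℕ}

/-! ### The parameters -/

/-- The new state is known only by the changed register and a frame condition; the long setup then
never handles nested register updates. -/
theorem Runs.assign_frame {d : Prog} {σ : State} {m : ℕ} {Q : State → Prop} {w Λ : ℕ} {e : Expr}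
    {i : ℕ} {v : ℤ} (hs : SlowTo w Λ) (hw : e.width σ ≤ w) (hm : e.nodes + 1 ≤ m)
    (hv : e.eval σ = v) (h : ∀ σ' : State, (∀ r, r ≠ i → σ'.reg r = σ.reg r) → σ'.reg i = v →
      Runs ev T d σ' ((m - (e.nodes + 1)) * (w * Λ)) Q) :
    Runs ev T (.seq (.assign i e) d) σ (m * (w * Λ)) Q := by
  refine Runs.assign_seq hs hw hm (h _ (fun r hr => ?_) ?_)
  · simp [hr]
  · simp [hv]

/-- Computes the parameters. -/
def setup : Prog :=
  .seq (.assign 20 (.const 1)) <|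
  .seq (upLoop 3 2 4 5) <| .seq (upLoop 0 20 6 7) <| .seq (upLoop 1 20 8 9) <|
  .seq (.assign 10 (.div (.sub (.add (.reg 7) (.reg 1)) (.const 1)) (.reg 1))) <|
  .seq (.assign 43 (.const 2)) <| .seq (powLoop 43 10 11 44) <|
  .seq (.assign 43 (.const 8)) <| .seq (powLoop 43 1 45 44) <|
  .seq (.assign 12 (.mul (.const 8) (.mul (.reg 11) (.reg 4)))) <|
  .seq (.assign 13 (.mul (.reg 12) (.reg 6))) <|
  .seq (.assign 17 (.mul (.mul (.const 16) (.reg 12)) (.mul (.reg 45) (.reg 8)))) <|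
  .seq (powLoop 17 1 46 44) <|
  .seq (.assign 15 (.mul (.mul (.const 2) (.mul (.reg 6) (.reg 6)))
    (.mul (.mul (.reg 12) (.reg 12)) (.reg 46)))) <|
  .seq (.assign 16 (.mul (.reg 15) (.reg 17))) <|
  .seq (.assign 14 (.mul (.mul (.const 2) (.mul (.reg 6) (.reg 12))) (.mul (.reg 46) (.reg 17)))) <|
  .seq (.assign 18 (.mul (.mul (.const 16) (.reg 11)) (.reg 5))) <|
  .seq (.assign 19 (.reg 13)) .skip

theorem runs_skip {σ : State} {m w Λ : ℕ} {Q : State → Prop} (hs : SlowTo w Λ) (hw : 1 ≤ w)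
    (hm : 1 ≤ m) (hQ : Q σ) : Runs ev T .skip σ (m * (w * Λ)) Q :=
  ⟨σ, 1, .skip σ, Nat.mul_le_mul hm (Nat.mul_le_mul hw hs.1), hQ⟩

/-- Only exponents are searched for, by doubling, and `⌈V/k⌉` replaces the extraction of a root.
Register 19 starts at `GP`, which represents `x = 1`. -/
theorem runs_setup {w Λ W n k E V K R : ℕ} {ε : ℚ} {EP GP D AX AD A : ℤ} (hs : SlowTo w Λ)
    (hw : 16 * W ≤ w) (hk : 1 ≤ k)
    (hE : (ε.den : ℤ) ≤ ε.num * 2 ^ E) (hE' : ∀ j < E, ε.num * 2 ^ j < (ε.den : ℤ))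
    (hV : (n : ℤ) ≤ 1 * 2 ^ V) (hV' : ∀ j < V, 1 * 2 ^ j < (n : ℤ))
    (hK : (k : ℤ) ≤ 1 * 2 ^ K) (hK' : ∀ j < K, 1 * 2 ^ j < (k : ℤ))
    (hR : R = (V + k - 1) / k)
    (hEP : EP = 8 * (2 ^ R * 2 ^ E)) (hGP : GP = EP * 2 ^ V) (hD : D = 16 * EP * (8 ^ k * 2 ^ K))
    (hAD : AD = 2 * (2 ^ V * 2 ^ V) * (EP * EP * D ^ k)) (hA : A = AD * D)
    (hAX : AX = 2 * (2 ^ V * EP) * (D ^ k * D))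
    (bW : 8 ≤ W) (bnum : bits ε.num ≤ W) (bden : bits ε.den ≤ W) (bn : bits n ≤ W) (bk : bits k ≤ W)
    (bE : E + 2 ≤ W) (bV : V + 2 ≤ W) (bK : K + 2 ≤ W) (bR : R + 2 ≤ W) (b8 : 3 * k + 2 ≤ W)
    (bEP : bits EP ≤ W) (bGP : bits GP ≤ W) (bD : ∀ j ≤ k, bits (D ^ j) ≤ W) (bAD : bits AD ≤ W) :
    Runs ev T setup (initState n k ε) ((300 + 14 * (E + V + K) + 10 * (R + k + k)) * (w * Λ))
      fun σ => RoundInput σ n k GP AX AD A D GP (2 ^ R) EP ∧ σ.reg 18 = 16 * 2 ^ R * E := by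
  have r0 : (initState n k ε).reg 0 = n := rfl
  have r1 : (initState n k ε).reg 1 = k := rfl
  have r2 : (initState n k ε).reg 2 = ε.num := rfl
  have r3 : (initState n k ε).reg 3 = ε.den := rfl
  generalize initState n k ε = σ at *
  have c1 : bits 1 = 2 := rfl
  have c2 : bits 2 = 3 := rfl
  have c8 : bits 8 = 5 := rfl
  have c16 : bits 16 = 6 := rfl
  have bVz : bits (V : ℤ) ≤ W := (bits_natCast_le le_rfl).trans bV
  have bEz : bits (E : ℤ) ≤ W := (bits_natCast_le le_rfl).trans bE
  have bRz : bits (R : ℤ) ≤ W := (bits_natCast_le le_rfl).trans bR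
  have b2E := bits_two_pow E
  have b2V := bits_two_pow V
  have b2K := bits_two_pow K
  have b2R := bits_two_pow R
  have b8j : ∀ j ≤ k, bits ((8 : ℤ) ^ j) ≤ W := fun j hj => by
    rw [show (8 : ℤ) = 2 ^ 3 by norm_num, ← pow_mul, bits_two_pow]; omega
  have b8k := b8j k le_rfl
  have bDk := bD k le_rfl
  have bD1 : bits D ≤ W := by simpa using bD 1 hk
  refine Runs.assign_frame (v := 1) hs (by simp only [width]; omega) (by simp only [nodes]; omega)
    rfl fun σ₁ f₁ v₁ => ?_
  refine Runs.seq_mul (runs_upLoop (J := E) (by norm_num) (by norm_num) (by norm_num) (by norm_num)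
    (by norm_num) hs (by omega : 4 * W ≤ w) ((f₁ 3 (by norm_num)).trans r3)
    ((f₁ 2 (by norm_num)).trans r2) bden bnum bE hE hE') (by simp only [nodes]; omega) ?_
  rintro σ₂ ⟨-, f₂, v₂, v₂'⟩
  refine Runs.seq_mul (runs_upLoop (J := V) (by norm_num) (by norm_num) (by norm_num) (by norm_num)
    (by norm_num) hs (by omega : 4 * W ≤ w) (by simp [f₂, f₁, r0]) (by simp [f₂, v₁])
    bn (by omega) bV hV hV') (by simp only [nodes]; omega) ?_
  rintro σ₃ ⟨-, f₃, v₃, v₃'⟩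
  refine Runs.seq_mul (runs_upLoop (J := K) (by norm_num) (by norm_num) (by norm_num) (by norm_num)
    (by norm_num) hs (by omega : 4 * W ≤ w) (by simp [f₃, f₂, f₁, r1])
    (by simp [f₃, f₂, v₁]) bk (by omega) bK hK hK') (by simp only [nodes]; omega) ?_
  rintro σ₄ ⟨-, f₄, v₄, v₄'⟩
  have k₄ : σ₄.reg 1 = k := by simp [f₄, f₃, f₂, f₁, r1]
  have V₄ : σ₄.reg 7 = V := by simp [f₄, v₃']
  refine Runs.assign_frame (v := R) hs (by simp only [width, k₄, V₄]; omega)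
    (by simp only [nodes]; omega) ?_ fun σ₅ f₅ v₅ => ?_
  · simp only [eval, k₄, V₄, hR]
    push_cast [show 1 ≤ V + k by omega]
    rfl
  refine Runs.assign_frame (v := 2) hs (by simp only [width]; omega)
    (by simp only [nodes]; omega) rfl fun σ₆ f₆ v₆ => ?_
  refine Runs.seq_mul (runs_powLoop (W := W) (J := R) (x := 2) (by norm_num) (by norm_num)
    (by norm_num) (by norm_num) hs (by omega) v₆ (by simp [f₆, v₅]) (by omega) (by omega) bRz
    (fun j hj => by rw [bits_two_pow]; omega)) (by simp only [nodes]; omega) ?_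
  rintro σ₇ ⟨-, f₇, v₇⟩
  refine Runs.assign_frame (v := 8) hs (by simp only [width]; omega)
    (by simp only [nodes]; omega) rfl fun σ₈ f₈ v₈ => ?_
  refine Runs.seq_mul (runs_powLoop (W := W) (J := k) (x := 8) (by norm_num) (by norm_num)
    (by norm_num) (by norm_num) hs (by omega) v₈ (by simp [f₈, f₇, f₆, f₅, k₄]) (by omega)
    (by omega) bk b8j) (by simp only [nodes]; omega) ?_
  rintro σ₉ ⟨-, f₉, v₉⟩
  have E₉ : σ₉.reg 4 = 2 ^ E := by simp [f₉, f₈, f₇, f₆, f₅, f₄, f₃, v₂]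
  have R₉ : σ₉.reg 11 = 2 ^ R := by simp [f₉, f₈, v₇]
  have V₉ : σ₉.reg 6 = 2 ^ V := by simp [f₉, f₈, f₇, f₆, f₅, f₄, v₃]
  have K₉ : σ₉.reg 8 = 2 ^ K := by simp [f₉, f₈, f₇, f₆, f₅, v₄]
  have k₉ : σ₉.reg 1 = k := by simp [f₉, f₈, f₇, f₆, f₅, k₄]
  have n₉ : σ₉.reg 0 = n := by simp [f₉, f₈, f₇, f₆, f₅, f₄, f₃, f₂, f₁, r0]
  have o₉ : σ₉.reg 20 = 1 := by simp [f₉, f₈, f₇, f₆, f₅, f₄, f₃, f₂, v₁]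
  have e₉ : σ₉.reg 5 = E := by simp [f₉, f₈, f₇, f₆, f₅, f₄, f₃, v₂']
  refine Runs.assign_frame (v := EP) hs (by simp only [width, E₉, R₉]; omega)
    (by simp only [nodes]; omega) (by simp only [eval, E₉, R₉, hEP]) fun σ₁₀ f₁₀ v₁₀ => ?_
  have V₁₀ : σ₁₀.reg 6 = 2 ^ V := by simp [f₁₀, V₉]
  refine Runs.assign_frame (v := GP) hs (by simp only [width, v₁₀, V₁₀]; omega)
    (by simp only [nodes]; omega) (by simp only [eval, v₁₀, V₁₀, hGP]) fun σ₁₁ f₁₁ v₁₁ => ?_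
  have EP₁₁ : σ₁₁.reg 12 = EP := by simp [f₁₁, v₁₀]
  have q₁₁ : σ₁₁.reg 45 = 8 ^ k := by simp [f₁₁, f₁₀, v₉]
  have K₁₁ : σ₁₁.reg 8 = 2 ^ K := by simp [f₁₁, f₁₀, K₉]
  refine Runs.assign_frame (v := D) hs (by simp only [width, EP₁₁, q₁₁, K₁₁]; omega)
    (by simp only [nodes]; omega) (by simp only [eval, EP₁₁, q₁₁, K₁₁, hD]) fun σ₁₂ f₁₂ v₁₂ => ?_
  refine Runs.seq_mul (runs_powLoop (W := W) (J := k) (x := D) (by norm_num) (by norm_num)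
    (by norm_num) (by norm_num) hs (by omega) v₁₂ (by simp [f₁₂, f₁₁, f₁₀, k₉]) (by omega)
    bD1 bk bD) (by simp only [nodes]; omega) ?_
  rintro σ₁₃ ⟨-, f₁₃, v₁₃⟩
  have EP₁₃ : σ₁₃.reg 12 = EP := by simp [f₁₃, f₁₂, EP₁₁]
  have V₁₃ : σ₁₃.reg 6 = 2 ^ V := by simp [f₁₃, f₁₂, f₁₁, V₁₀]
  refine Runs.assign_frame (v := AD) hs (by simp only [width, EP₁₃, V₁₃, v₁₃]; omega)
    (by simp only [nodes]; omega) (by simp only [eval, EP₁₃, V₁₃, v₁₃, hAD]) fun σ₁₄ f₁₄ v₁₄ => ?_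
  have D₁₄ : σ₁₄.reg 17 = D := by simp [f₁₄, f₁₃, v₁₂]
  refine Runs.assign_frame (v := A) hs (by simp only [width, v₁₄, D₁₄]; omega)
    (by simp only [nodes]; omega) (by simp only [eval, v₁₄, D₁₄, hA]) fun σ₁₅ f₁₅ v₁₅ => ?_
  have D₁₅ : σ₁₅.reg 17 = D := by simp [f₁₅, D₁₄]
  have V₁₅ : σ₁₅.reg 6 = 2 ^ V := by simp [f₁₅, f₁₄, V₁₃]
  have EP₁₅ : σ₁₅.reg 12 = EP := by simp [f₁₅, f₁₄, EP₁₃]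
  have q₁₅ : σ₁₅.reg 46 = D ^ k := by simp [f₁₅, f₁₄, v₁₃]
  refine Runs.assign_frame (v := AX) hs (by simp only [width, V₁₅, EP₁₅, q₁₅, D₁₅]; omega)
    (by simp only [nodes]; omega) (by simp only [eval, V₁₅, EP₁₅, q₁₅, D₁₅, hAX])
    fun σ₁₆ f₁₆ v₁₆ => ?_
  have R₁₆ : σ₁₆.reg 11 = 2 ^ R := by simp [f₁₆, f₁₅, f₁₄, f₁₃, f₁₂, f₁₁, f₁₀, R₉]
  have e₁₆ : σ₁₆.reg 5 = E := by simp [f₁₆, f₁₅, f₁₄, f₁₃, f₁₂, f₁₁, f₁₀, e₉]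
  refine Runs.assign_frame (v := 16 * 2 ^ R * E) hs (by simp only [width, R₁₆, e₁₆]; omega)
    (by simp only [nodes]; omega) (by simp only [eval, R₁₆, e₁₆]) fun σ₁₇ f₁₇ v₁₇ => ?_
  have GP₁₇ : σ₁₇.reg 13 = GP := by simp [f₁₇, f₁₆, f₁₅, f₁₄, f₁₃, f₁₂, v₁₁]
  refine Runs.assign_frame (v := GP) hs (by simp only [width, GP₁₇]; omega)
    (by simp only [nodes]; omega) (by simp only [eval, GP₁₇]) fun σ₁₈ f₁₈ v₁₈ => ?_
  refine runs_skip hs (by omega) (by simp only [nodes]; omega) ⟨⟨⟨?_, ?_, ?_, ?_, ?_, v₁₈, ?_⟩,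
    ?_, ?_, ?_, ?_⟩, ?_⟩
  · simp [f₁₈, f₁₇, f₁₆, f₁₅, f₁₄, f₁₃, f₁₂, f₁₁, f₁₀, n₉]
  · simp [f₁₈, f₁₇, v₁₆]
  · simp [f₁₈, f₁₇, f₁₆, f₁₅, v₁₄]
  · simp [f₁₈, f₁₇, f₁₆, v₁₅]
  · simp [f₁₈, f₁₇, f₁₆, D₁₅]
  · simp [f₁₈, f₁₇, f₁₆, f₁₅, f₁₄, f₁₃, f₁₂, f₁₁, f₁₀, o₉]
  · simp [f₁₈, f₁₇, f₁₆, f₁₅, f₁₄, f₁₃, f₁₂, f₁₁, f₁₀, k₉]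
  · simp [f₁₈, f₁₇, R₁₆]
  · simp [f₁₈, f₁₇, f₁₆, EP₁₅]
  · simp [f₁₈, GP₁₇]
  · simp [f₁₈, v₁₇]

/-- The whole program. -/
def newtonProg : Prog :=
  .seq setup <| .seq (.while (.reg 18) roundBody) <|
    .seq (.assign 0 (.reg 19)) (.assign 1 (.reg 13))

end HigherOrderNewton

namespace HigherOrderNewton

open HigherOrderNewton.Expr

variable {ev : ℤ → ℤ → ℤ × ℤ} {T : ℕ → ℕ}

/-! ### The dyadic parameters as integers -/

theorem up2_eq_pow {y : ℝ} {j : ℕ} (hy : 1 ≤ y) (h : y ≤ 2 ^ j) (h' : ∀ i < j, 2 ^ i < y) :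
    up2 y = 2 ^ j := by
  have hc : ⌈Real.logb 2 y⌉ = j := by
    refine Int.ceil_eq_iff.mpr ⟨?_, ?_⟩
    -- For `j = 0` there is no smaller power to compare with, and `1 ≤ y` takes over.
    · rcases j with _ | j
      · have := Real.logb_nonneg (b := 2) (by norm_num) hy
        push_cast
        linarith
      · have := h' j (Nat.lt_succ_self j)
        rw [Real.lt_logb_iff_rpow_lt (by norm_num) (by linarith)]
        push_cast
        rw [add_sub_cancel_right, Real.rpow_natCast]
        exact this
    · rw [Real.logb_le_iff_le_rpow (by norm_num) (by linarith)]
      simpa using h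
  rw [up2, hc, zpow_natCast]

/-- The binary logarithms of the rounded parameters. -/
structure Exponents (n k : ℕ) (ε : ℚ) (E V K R : ℕ) : Prop where
  hE : (ε.den : ℤ) ≤ ε.num * 2 ^ E
  hE' : ∀ j < E, ε.num * 2 ^ j < (ε.den : ℤ)
  hV : (n : ℤ) ≤ 1 * 2 ^ V
  hV' : ∀ j < V, 1 * 2 ^ j < (n : ℤ)
  hK : (k : ℤ) ≤ 1 * 2 ^ K
  hK' : ∀ j < K, 1 * 2 ^ j < (k : ℤ)
  hR : R = (V + k - 1) / k

theorem exists_exponents (n k : ℕ) (ε : ℚ) (hε : 0 < ε) : ∃ E V K R, Exponents n k ε E V K R := by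
  classical
  have hnum : 1 ≤ ε.num := Rat.num_pos.mpr hε
  have hex : ∃ E : ℕ, (ε.den : ℤ) ≤ ε.num * 2 ^ E := by
    refine ⟨ε.den, ?_⟩
    have h1 : (ε.den : ℤ) ≤ 2 ^ ε.den := by exact_mod_cast Nat.lt_two_pow_self.le
    nlinarith [pow_pos (by norm_num : (0 : ℤ) < 2) ε.den]
  refine ⟨Nat.find hex, Nat.clog 2 n, Nat.clog 2 k, _, Nat.find_spec hex,
    fun j hj => not_le.mp (Nat.find_min hex hj), ?_, fun j hj => ?_, ?_, fun j hj => ?_, rfl⟩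
  · rw [one_mul]; exact_mod_cast Nat.le_pow_clog (by norm_num) n
  · rw [one_mul]; exact_mod_cast Nat.pow_lt_of_lt_clog hj
  · rw [one_mul]; exact_mod_cast Nat.le_pow_clog (by norm_num) k
  · rw [one_mul]; exact_mod_cast Nat.pow_lt_of_lt_clog hj

section

variable {n k E V K R : ℕ} {ε : ℚ}

theorem Exponents.one_div_le (h : Exponents n k ε E V K R) (hε : 0 < ε) :
    1 / (ε : ℝ) ≤ 2 ^ E := by
  have hnum : (0 : ℝ) < ε.num := by exact_mod_cast Rat.num_pos.mpr hε
  have h1 : (ε.den : ℝ) ≤ ε.num * 2 ^ E := by exact_mod_cast h.hE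
  rw [Rat.cast_def, one_div_div, div_le_iff₀ hnum]
  linarith

theorem Exponents.lt_one_div (h : Exponents n k ε E V K R) (hε : 0 < ε) {j : ℕ} (hj : j < E) :
    2 ^ j < 1 / (ε : ℝ) := by
  have hnum : (0 : ℝ) < ε.num := by exact_mod_cast Rat.num_pos.mpr hε
  have h1 : ε.num * 2 ^ j < (ε.den : ℝ) := by exact_mod_cast h.hE' j hj
  rw [Rat.cast_def, one_div_div, lt_div_iff₀ hnum]
  linarith

theorem Exponents.V_le (h : Exponents n k ε E V K R) (hk : 1 ≤ k) : V ≤ k * R := by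
  have h1 := Nat.lt_div_mul_add (a := V + k - 1) hk
  rw [← h.hR] at h1
  rw [mul_comm]
  omega

theorem Exponents.R_le (h : Exponents n k ε E V K R) (hk : 1 ≤ k) : R ≤ V := by
  rw [h.hR, ← Nat.lt_succ_iff, Nat.div_lt_iff_lt_mul hk]
  nlinarith [Nat.sub_add_cancel (by omega : 1 ≤ V + k)]

theorem Exponents.K_le (h : Exponents n k ε E V K R) : K ≤ k := by
  by_contra hc
  have h1 := h.hK' k (by omega)
  have h2 : (k : ℤ) < 2 ^ k := by exact_mod_cast Nat.lt_two_pow_self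
  omega

/-- The inequality `n^(1/k) ≤ 2^j` means `n ≤ 2^(jk)`, that is `V ≤ jk`. So the least such `j` is
`⌈V/k⌉`. -/
theorem Exponents.up2_root (h : Exponents n k ε E V K R) (hn : 1 ≤ n) (hk : 1 ≤ k) :
    up2 ((n : ℝ) ^ (1 / (k : ℝ))) = 2 ^ R := by
  have hr := one_le_rpow_inv (k := k) hn
  have hp := rpow_inv_pow (n := n) hk
  refine up2_eq_pow hr ?_ fun j hj => ?_
  · refine le_of_pow_le_pow_left₀ (by omega : k ≠ 0) (by positivity) ?_
    rw [hp, ← pow_mul]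
    have h1 : (n : ℝ) ≤ 2 ^ V := by exact_mod_cast (one_mul ((2 : ℤ) ^ V)) ▸ h.hV
    refine h1.trans (pow_le_pow_right₀ (by norm_num) ?_)
    rw [mul_comm]
    exact h.V_le hk
  · refine lt_of_pow_lt_pow_left₀ k (by positivity) ?_
    rw [hp, ← pow_mul]
    have hjV : j * k < V := by
      rw [h.hR] at hj
      have := (Nat.le_div_iff_mul_le hk).mp (Nat.succ_le_of_lt hj)
      rw [Nat.succ_mul] at this
      omega
    have := h.hV' _ hjV
    rw [one_mul] at this
    exact_mod_cast this

/-- The integers in the computation. -/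
structure Ints (k E V K R : ℕ) (EP GP D AD A AX : ℤ) : Prop where
  hEP : EP = 8 * (2 ^ R * 2 ^ E)
  hGP : GP = EP * 2 ^ V
  hD : D = 16 * EP * (8 ^ k * 2 ^ K)
  hAD : AD = 2 * (2 ^ V * 2 ^ V) * (EP * EP * D ^ k)
  hA : A = AD * D
  hAX : AX = 2 * (2 ^ V * EP) * (D ^ k * D)

variable {EP GP D AD A AX : ℤ}

theorem dyadicParams_eq (h : Exponents n k ε E V K R) (hI : Ints k E V K R EP GP D AD A AX)
    (hn : 1 ≤ n) (hk : 1 ≤ k) (hε : 0 < ε) (hε2 : ε ≤ 1 / 2) :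
    dyadicParams n k ε =
      { rounds := 16 * 2 ^ R * E
        root := ((2 ^ R : ℤ) : ℝ)
        threshold := 1 / EP
        delta := 1 / D
        alpha := 1 / A
        grid := 1 / GP } := by
  have hε' : (0 : ℝ) < ε := by exact_mod_cast hε
  have hε2' : (ε : ℝ) ≤ 1 / 2 := by
    have : ((ε : ℚ) : ℝ) ≤ ((1 / 2 : ℚ) : ℝ) := by exact_mod_cast hε2
    simpa using this
  have h2 : 1 ≤ 1 / (ε : ℝ) := by rw [le_div_iff₀ hε']; linarith
  have e1 : up2 (1 / (ε : ℝ)) = 2 ^ E := up2_eq_pow h2 (h.one_div_le hε) fun _ => h.lt_one_div hε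
  have e2 := h.up2_root hn hk
  -- Because `4 < 2e < 8`.
  have e3 : up2 (2 * Real.exp 1) = 8 := by
    rw [up2_eq_pow (j := 3)]
    · norm_num
    · linarith [four_le_two_mul_exp]
    · linarith [Real.exp_one_lt_d9]
    · intro i hi
      have : (2 : ℝ) ^ i ≤ 2 ^ 2 := pow_le_pow_right₀ (by norm_num) (by omega)
      linarith [Real.exp_one_gt_d9]
  have e4 : up2 (k : ℝ) = 2 ^ K := up2_eq_pow (by exact_mod_cast hk)
    (by exact_mod_cast (one_mul ((2 : ℤ) ^ K)) ▸ h.hK) fun j hj => by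
      exact_mod_cast (one_mul ((2 : ℤ) ^ j)) ▸ h.hK' j hj
  have e5 : up2 (n : ℝ) = 2 ^ V := up2_eq_pow (by exact_mod_cast hn)
    (by exact_mod_cast (one_mul ((2 : ℤ) ^ V)) ▸ h.hV) fun j hj => by
      exact_mod_cast (one_mul ((2 : ℤ) ^ j)) ▸ h.hV' j hj
  have e6 : Real.logb 2 (2 ^ E : ℝ) = E := by
    rw [← Real.rpow_natCast, Real.logb_rpow (by norm_num) (by norm_num)]
  rw [dyadicParams, e1, e2, e3, e4, e5, e6, mkParams]
  have t1 : (1 / 2 ^ E : ℝ) / (8 * 2 ^ R) = 1 / EP := by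
    rw [hI.hEP]; push_cast; rw [div_div]; ring
  have hEP0 : (EP : ℝ) ≠ 0 := by rw [hI.hEP]; push_cast; positivity
  have t2 : (1 / (EP : ℝ)) / (16 * 8 ^ k * 2 ^ K) = 1 / D := by
    rw [hI.hD]; push_cast; rw [div_div]; ring
  have hD0 : (D : ℝ) ≠ 0 := by rw [hI.hD]; push_cast; positivity
  rw [t1, t2]
  congr 1
  -- The number under the ceiling is already an integer.
  · have : (16 * 2 ^ R * (E : ℝ)) = ((16 * 2 ^ R * E : ℕ) : ℝ) := by push_cast; ring
    rw [this, Nat.ceil_natCast]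
  · push_cast; rfl
  · rw [hI.hA, hI.hAD]; push_cast
    rw [one_div_pow, one_div_pow, one_div_mul_one_div, div_div]
    ring
  · rw [hI.hGP]; push_cast; rw [div_div]

end

end HigherOrderNewton

namespace HigherOrderNewton

open HigherOrderNewton.Expr

variable {ev : ℤ → ℤ → ℤ × ℤ} {T : ℕ → ℕ}

section

variable {n k E V K R W : ℕ} {ε : ℚ} {EP GP D AD A AX : ℤ}

/-! ### Lengths of the parameters, and the complete program. -/

/-- The binary logarithm of the inverse of the step `δ`. -/
def deltaExp (k E K R : ℕ) : ℕ := 7 + R + E + 3 * k + K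

/-- The binary logarithm of the inverse of the step `α`. -/
def alphaExp (k E V K R : ℕ) : ℕ := 7 + 2 * V + 2 * R + 2 * E + deltaExp k E K R * (k + 1)

theorem Ints.EP_eq (hI : Ints k E V K R EP GP D AD A AX) : EP = 2 ^ (3 + R + E) := by
  rw [hI.hEP]; ring

theorem Ints.GP_eq (hI : Ints k E V K R EP GP D AD A AX) : GP = 2 ^ (3 + R + E + V) := by
  rw [hI.hGP, hI.EP_eq]; ring

theorem Ints.D_eq (hI : Ints k E V K R EP GP D AD A AX) : D = 2 ^ deltaExp k E K R := by
  rw [hI.hD, hI.EP_eq, deltaExp, show (8 : ℤ) = 2 ^ 3 by norm_num, ← pow_mul]; ring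

theorem Ints.D_pow (hI : Ints k E V K R EP GP D AD A AX) (j : ℕ) :
    D ^ j = 2 ^ (deltaExp k E K R * j) := by
  rw [hI.D_eq, pow_mul]

theorem Ints.AD_eq (hI : Ints k E V K R EP GP D AD A AX) :
    AD = 2 ^ (7 + 2 * V + 2 * R + 2 * E + deltaExp k E K R * k) := by
  rw [hI.hAD, hI.EP_eq, hI.D_pow]; ring

theorem Ints.A_eq (hI : Ints k E V K R EP GP D AD A AX) : A = 2 ^ alphaExp k E V K R := by
  rw [hI.hA, hI.AD_eq, hI.D_eq, alphaExp]; ring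

theorem Ints.AX_eq (hI : Ints k E V K R EP GP D AD A AX) :
    AX = 2 ^ (4 + V + R + E + deltaExp k E K R * (k + 1)) := by
  rw [hI.hAX, hI.EP_eq, hI.D_pow, hI.D_eq]; ring

theorem bits_factorial_le {i k : ℕ} (hi : i < k) : bits (i.factorial : ℤ) ≤ k ^ 2 + 2 := by
  refine bits_le_of_le_two_pow (by positivity) ?_
  have h1 : i.factorial ≤ 2 ^ (k ^ 2) := by
    calc i.factorial ≤ i ^ i := Nat.factorial_le_pow i
      _ ≤ (2 ^ k) ^ i := Nat.pow_le_pow_left (hi.le.trans Nat.lt_two_pow_self.le) _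
      _ = 2 ^ (k * i) := by rw [pow_mul]
      _ ≤ 2 ^ (k ^ 2) := Nat.pow_le_pow_right (by norm_num) (by rw [pow_two]; gcongr)
  exact_mod_cast h1

theorem bits_neg_pow (D : ℤ) (i : ℕ) : bits ((-D) ^ i) = bits (D ^ i) := by
  simp [bits, Int.natAbs_pow]

theorem Ints.consts (hI : Ints k E V K R EP GP D AD A AX) (h : Exponents n k ε E V K R)
    (hn : 1 ≤ n) (hk : 1 ≤ k) (hε : 0 < ε) (hε2 : ε ≤ 1 / 2)
    (hW : alphaExp k E V K R + k ^ 2 + 10 ≤ W) :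
    Consts n k (dyadicParams n k ε) W GP AX AD A D := by
  have hP := dyadicParams_eq h hI hn hk hε hε2
  have hdk : deltaExp k E K R * (k + 1) = deltaExp k E K R * k + deltaExp k E K R := by ring
  have hd : 7 ≤ deltaExp k E K R := by rw [deltaExp]; omega
  rw [alphaExp] at hW
  refine ⟨hk, ?_, ?_, ?_, ?_, hI.hA, by rw [hP], by rw [hP], ?_, ?_, ?_, ?_, ?_, ?_, ?_, ?_, ?_⟩
  · rw [hI.GP_eq]; positivity
  · rw [hI.D_eq]; positivity
  · rw [hI.A_eq]; positivity
  · rw [hI.hA, hI.hAD, hI.hAX, hI.hGP]; ring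
  · have := h.hV
    rw [one_mul] at this
    exact (bits_le_of_le_two_pow (by positivity) this).trans (by omega)
  · rw [hI.GP_eq, bits_two_pow]; omega
  · rw [hI.AX_eq, bits_two_pow]; omega
  · rw [hI.AD_eq, bits_two_pow]; omega
  · rw [hI.A_eq, bits_two_pow, alphaExp]; omega
  · rw [hI.D_eq, bits_two_pow]; omega
  · nlinarith
  · exact fun i hi => (bits_factorial_le hi).trans (by omega)
  · intro i hi
    rw [bits_neg_pow, hI.D_pow, bits_two_pow]
    have : deltaExp k E K R * i ≤ deltaExp k E K R * k := Nat.mul_le_mul_left _ hi.le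
    omega

theorem Ints.roundConsts (hI : Ints k E V K R EP GP D AD A AX) (h : Exponents n k ε E V K R)
    (hn : 1 ≤ n) (hk : 1 ≤ k) (hε : 0 < ε) (hε2 : ε ≤ 1 / 2)
    (hW : alphaExp k E V K R + k ^ 2 + 10 ≤ W) :
    RoundConsts (dyadicParams n k ε) k W GP (2 ^ R) EP := by
  have hP := dyadicParams_eq h hI hn hk hε hε2
  rw [alphaExp] at hW
  refine ⟨by positivity, ?_, by rw [hP], by rw [hP], by rw [hP], ?_, ?_⟩
  · rw [hI.EP_eq]; positivity
  · rw [bits_two_pow]; omega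
  · rw [hI.EP_eq, bits_two_pow]; omega

/-- From `0 < X ≤ GP` and `j < k ≤ D` both summands of the numerator `q` are at most `A`, so `q + 1
≤ 4A`. The point lies to the right of every root, whence the positive value. -/
theorem Ints.goodPoint (hI : Ints k E V K R EP GP D AD A AX) {P : Params}
    (hP : Consts n k P W GP AX AD A D) (ht : 0 < P.threshold) {f : ℝ → ℝ}
    (hev : Evaluates ev T f) (hT : Monotone T) (hW2 : 2 * alphaExp k E V K R + 6 ≤ W)
    (hTW : T (2 * alphaExp k E V K R + 6) ≤ W) (z : Fin n → ℝ) (hf : ∀ x, f x = ∏ i, (x - z i)) (i₀ : Fin n) (hi₀ : ∀ i, z i ≤ z i₀)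
    (hz0 : 0 ≤ z i₀) (X : ℤ) (hX0 : P.threshold ≤ (X : ℝ) / GP - z i₀) (hX1 : (X : ℝ) / GP ≤ 1) :
    GoodPoint ev T k W X AX AD A := by
  have hGP : (0 : ℝ) < GP := by exact_mod_cast hP.hGP
  have hA : (0 : ℝ) < A := by exact_mod_cast hP.hA
  have hXpos : 0 < X := by
    have h1 : 0 < (X : ℝ) / GP := by linarith
    have h2 := (div_pos_iff_of_pos_right hGP).mp h1
    exact_mod_cast h2
  have hXle : X ≤ GP := by
    rw [div_le_one hGP] at hX1
    exact_mod_cast hX1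
  have hAX0 : 0 ≤ AX := by rw [hI.AX_eq]; positivity
  have hAD0 : 0 ≤ AD := by rw [hI.AD_eq]; positivity
  have hkD : (k : ℤ) ≤ D := by
    rw [hI.D_eq]
    have h1 : k ≤ 2 ^ deltaExp k E K R := by
      refine Nat.lt_two_pow_self.le.trans (Nat.pow_le_pow_right (by norm_num) ?_)
      rw [deltaExp]; omega
    exact_mod_cast h1
  have hq : ∀ j < k, 0 ≤ X * AX + (j : ℤ) * AD ∧ X * AX + (j : ℤ) * AD + 1 ≤
      2 ^ (alphaExp k E V K R + 2) := by
    intro j hj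
    have h1 : X * AX ≤ A := by
      rw [hP.hAX, mul_comm AX]
      exact mul_le_mul_of_nonneg_right hXle hAX0
    have h2 : (j : ℤ) * AD ≤ A := by
      rw [hP.hAD, mul_comm AD]
      exact mul_le_mul_of_nonneg_right (le_trans (by exact_mod_cast hj.le) hkD) hAD0
    have h3 : 1 ≤ A := hP.hA
    have h4 : (2 : ℤ) ^ (alphaExp k E V K R + 2) = 4 * A := by rw [hI.A_eq]; ring
    exact ⟨by positivity, by rw [h4]; linarith⟩
  have bA : bits A = alphaExp k E V K R + 2 := by rw [hI.A_eq, bits_two_pow]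
  have bq1 : ∀ j < k, bits (X * AX + (j : ℤ) * AD + 1) ≤ alphaExp k E V K R + 4 := fun j hj =>
    bits_le_of_le_two_pow (by linarith [(hq j hj).1]) (hq j hj).2
  have bq : ∀ j < k, bits (X * AX + (j : ℤ) * AD) ≤ alphaExp k E V K R + 4 := fun j hj =>
    bits_le_of_le_two_pow (hq j hj).1 (by linarith [(hq j hj).2])
  refine ⟨(bits_mono_of_nonneg hXpos.le hXle).trans hP.bGP, fun j hj => (bq j hj).trans (by omega),
    fun j hj => (hT ?_).trans hTW, fun j hj => (hT ?_).trans hTW, fun j hj => ?_⟩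
  · have := bq j hj; omega
  · have := bq1 j hj; omega
  · have hpos : 0 < f (((X * AX + (j : ℤ) * AD : ℤ) : ℝ) / A) := by
      rw [hf]
      refine Finset.prod_pos fun i _ => ?_
      have h1 : (X : ℝ) / GP ≤ ((X * AX + (j : ℤ) * AD : ℤ) : ℝ) / A := by
        have h2 : (X : ℝ) / GP = ((X * AX : ℤ) : ℝ) / A := by
          rw [div_eq_div_iff hGP.ne' hA.ne', hP.hAX]; push_cast; ring
        rw [h2]
        gcongr
        have : 0 ≤ (j : ℤ) * AD := by positivity
        linarith
      linarith [hi₀ i]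
    rw [hev.correct _ _ hP.hA] at hpos
    have h3 : (0 : ℝ) < (ev (X * AX + (j : ℤ) * AD) A).2 := by exact_mod_cast hev.den_pos _ _ hP.hA
    have := (div_pos_iff_of_pos_right h3).mp hpos
    exact_mod_cast this

theorem exists_ints (k E V K R : ℕ) : ∃ EP GP D AD A AX, Ints k E V K R EP GP D AD A AX :=
  ⟨_, _, _, _, _, _, rfl, rfl, rfl, rfl, rfl, rfl⟩

/-- Setup and final assignments are absorbed in the cost of the rounds; `s` and `Λ` are left open
for logarithmic bounds. -/
theorem runs_newtonProg {Λ s : ℕ} (hs : SlowTo (800 * (k * W)) Λ) (hsk : Nat.clog 2 k + 1 ≤ s)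
    (h : Exponents n k ε E V K R) (hn : 1 ≤ n) (hk : 1 ≤ k) (hε : 0 < ε) (hε2 : ε ≤ 1 / 2)
    (hW : alphaExp k E V K R + k ^ 2 + 10 ≤ W) (hT : Monotone T)
    (hW2 : 2 * alphaExp k E V K R + 6 ≤ W)
    (hTW : T (2 * alphaExp k E V K R + 6) ≤ W) (bnum : bits ε.num ≤ W) (bden : bits ε.den ≤ W)
    {f : ℝ → ℝ} (hev : Evaluates ev T f) (z : Fin n → ℝ) (hf : ∀ x, f x = ∏ i, (x - z i))
    (i₀ : Fin n) (hi₀ : ∀ i, z i ≤ z i₀) (hz0 : 0 ≤ z i₀) (hz1 : z i₀ ≤ 1 / 2) :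
    Runs ev T newtonProg (initState n k ε)
      (2000000 * ((dyadicParams n k ε).rounds * k * s * W * Λ)) fun σ => 0 < σ.reg 1 ∧
        (σ.reg 0 : ℝ) / (σ.reg 1 : ℝ) = (newton n k (dyadicParams n k ε)).run f := by
  obtain ⟨EP, GP, D, AD, A, AX, hI⟩ := exists_ints k E V K R
  have hε' : (0 : ℝ) < ε := by exact_mod_cast hε
  have hε2' : (ε : ℝ) ≤ 1 / 2 := by
    have : ((ε : ℚ) : ℝ) ≤ ((1 / 2 : ℚ) : ℝ) := by exact_mod_cast hε2
    simpa using this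
  have hC := hI.consts h hn hk hε hε2 hW
  have hR := hI.roundConsts h hn hk hε hε2 hW
  have hG := dyadicParams_good hn hk hε' hε2'
  have hrounds : (dyadicParams n k ε).rounds = 16 * 2 ^ R * E := by
    rw [dyadicParams_eq h hI hn hk hε hε2]
  set P := dyadicParams n k (ε : ℝ) with hPdef
  set N := P.rounds with hN
  -- Without this the number `N` of rounds could be 0. With it, `N k` dominates `E, V, K, R` and
  -- `k`, hence the cost of the setup.
  have hE1 : 1 ≤ E := by
    by_contra hc
    obtain rfl : E = 0 := by omega
    have h1 := h.one_div_le hε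
    rw [pow_zero, div_le_one hε'] at h1
    linarith
  have hWk : W ≤ k * W := Nat.le_mul_of_pos_left _ hk
  have hs1 : SlowTo (16 * W) Λ := hs.mono (by omega)
  have hdk : deltaExp k E K R * (k + 1) = deltaExp k E K R * k + deltaExp k E K R := by ring
  have hd : deltaExp k E K R = 7 + R + E + 3 * k + K := rfl
  have ha : alphaExp k E V K R = 7 + 2 * V + 2 * R + 2 * E + deltaExp k E K R * (k + 1) := rfl
  have hGPR : (GP : ℝ) ≠ 0 := by exact_mod_cast hC.hGP.ne'
  have h2R : 1 ≤ 2 ^ R := Nat.one_le_two_pow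
  have hNE : E ≤ N := by rw [hrounds]; nlinarith
  have hNR : 2 ^ R ≤ N := by rw [hrounds]; nlinarith
  have hRN : R ≤ N := Nat.lt_two_pow_self.le.trans hNR
  have hN1 : 1 ≤ N := h2R.trans hNR
  have hkN : k ≤ N * k := Nat.le_mul_of_pos_left _ hN1
  have hNk : N ≤ N * k := Nat.le_mul_of_pos_right _ hk
  have hVN : V ≤ N * k := (h.V_le hk).trans (by rw [mul_comm]; gcongr)
  have hKN : K ≤ N * k := h.K_le.trans hkN
  have bN : bits (N : ℤ) ≤ W := by
    have h1 : N ≤ 2 ^ (4 + R + E) := by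
      rw [hrounds, pow_add, pow_add]
      gcongr
      · norm_num
      · exact Nat.lt_two_pow_self.le
    exact (bits_le_of_le_two_pow (by positivity) (by exact_mod_cast h1)).trans (by omega)
  have hsetup := runs_setup (ev := ev) (T := T) (W := W) (n := n) (ε := ε) hs1 le_rfl hk h.hE h.hE'
    h.hV h.hV' h.hK h.hK' h.hR hI.hEP hI.hGP hI.hD hI.hAD hI.hA hI.hAX (by omega) bnum bden hC.bn
    ((bits_natCast_le le_rfl).trans (by have := hC.bk; omega)) (by omega) (by omega) (by omega)
    (by omega) (by omega) hR.bEP hC.bGP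
    (fun j hj => by
      rw [hI.D_pow, bits_two_pow]
      have : deltaExp k E K R * j ≤ deltaExp k E K R * k := Nat.mul_le_mul_left _ hj
      omega) hC.bAD
  have hZ : 16 * W * Λ ≤ 16 * (k * s * W * Λ) := by
    have : W * Λ ≤ k * s * W * Λ := by
      calc W * Λ = 1 * 1 * W * Λ := by ring
        _ ≤ k * s * W * Λ := by gcongr; omega
    rw [mul_assoc]; omega
  have hZ' : W * Λ * (N * k) ≤ N * k * s * W * Λ := by
    calc W * Λ * (N * k) = N * k * 1 * W * Λ := by ring
      _ ≤ N * k * s * W * Λ := by gcongr; omega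
  have hZ'' : N * (k * s * W * Λ) = N * k * s * W * Λ := by ring
  have hZ3 : k * s * W * Λ ≤ N * k * s * W * Λ := by
    rw [← hZ'']; exact Nat.le_mul_of_pos_left _ hN1
  refine Runs.seq (a := 400 * 16 * (N * k * s * W * Λ))
    (b := 1500000 * (N * k * s * W * Λ)) (hsetup.mono ?_ fun _ h => h) ?_ (by omega)
  · calc (300 + 14 * (E + V + K) + 10 * (R + k + k)) * (16 * W * Λ)
        ≤ (400 * (N * k)) * (16 * W * Λ) := Nat.mul_le_mul_right _ (by omega)
      _ = 400 * 16 * (W * Λ * (N * k)) := by ring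
      _ ≤ _ := Nat.mul_le_mul_left _ hZ'
  rintro σ₁ ⟨hin, h18⟩
  have h18' : σ₁.reg 18 = N := by rw [h18, hrounds]; push_cast; ring
  have ht := hG.threshold_pos
  have ht1 := hG.threshold_le
  have hone : (GP : ℝ) / GP = 1 := div_self hGPR
  refine Runs.seq (a := 1200000 * (N * k * s * W * Λ)) (b := 100 * (N * k * s * W * Λ))
    ((runs_rounds hs hsk hC hev hR z hf hG i₀ hi₀ hz0
    (fun X hX0 hX1 => hI.goodPoint hC ht hev hT hW2 hTW z hf i₀ hi₀ hz0 X hX0 hX1) bN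
    (by rw [hone]; linarith) hone.le hin h18').mono ?_ fun _ h => h) ?_ (by omega)
  · calc (N + 1) * (600000 * (k * s * W * Λ)) ≤ (N + N) * (600000 * (k * s * W * Λ)) := by gcongr
      _ = 1200000 * (N * (k * s * W * Λ)) := by ring
      _ = _ := by rw [hZ'']
  rintro σ₂ ⟨hag, bX, hx⟩
  have h13 : σ₂.reg 13 = GP := (hag 13 (by norm_num)).trans hin.h13
  refine Runs.mono (a := 5 * (16 * W * Λ)) (R := _) ?_ (by omega) fun _ h => h
  have bGP := hC.bGP
  refine Runs.assign_seq hs1 (by simp only [width]; omega) (by simp only [nodes]; omega) ?_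
  refine Runs.assign hs1 (by simp [width, h13]; omega) (by simp only [nodes]; omega) ?_
  constructor
  · simpa [eval, h13] using hC.hGP
  · rw [newton, ← hone, ← hx]
    simp [eval, h13]

end

end HigherOrderNewton

namespace HigherOrderNewton

variable {ev : ℤ → ℤ → ℤ × ℤ} {T : ℕ → ℕ}

/-! ### The running time in terms of `T`. -/

theorem apply_two_pow_mul_le {D : ℕ} (hD : ∀ m, T (2 * m) ≤ D * T m) (j m : ℕ) :
    T (2 ^ j * m) ≤ D ^ j * T m := by
  induction j with
  | zero => simp
  | succ j ih =>
    calc T (2 ^ (j + 1) * m) = T (2 * (2 ^ j * m)) := by rw [pow_succ']; ring_nf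
      _ ≤ D * T (2 ^ j * m) := hD _
      _ ≤ D * (D ^ j * T m) := Nat.mul_le_mul_left _ ih
      _ = D ^ (j + 1) * T m := by rw [pow_succ']; ring

theorem Exponents.E_le {n k E V K R M : ℕ} {ε : ℚ} (h : Exponents n k ε E V K R) (hε : 0 < ε)
    (hM : 1 / (ε : ℝ) ≤ 2 ^ M) : E ≤ M := by
  by_contra hc
  exact absurd (h.lt_one_div hε (not_le.mp hc)) (not_lt.mpr hM)

theorem Exponents.V_le_of_le {n k E V K R M : ℕ} {ε : ℚ} (h : Exponents n k ε E V K R)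
    (hM : n ≤ 2 ^ M) : V ≤ M := by
  by_contra hc
  have h1 := h.hV' M (not_le.mp hc)
  rw [one_mul] at h1
  exact absurd (by exact_mod_cast h1 : 2 ^ M < n) (not_lt.mpr hM)

/-- Here `k² + k log(n/ε)` originates: `log₂(1/δ) = O(k + M)`, and `α` contains `δ^(k+1)`. -/
theorem Exponents.alphaExp_le {n k E V K R M : ℕ} {ε : ℚ} (h : Exponents n k ε E V K R)
    (hk : 1 ≤ k) (hE : E ≤ M) (hV : V ≤ M) :
    alphaExp k E V K R ≤ 29 * (k ^ 2 + k * M) := by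
  have hR := (h.R_le hk).trans hV
  have hK := h.K_le
  have hd : deltaExp k E K R ≤ 7 + 2 * M + 4 * k := by rw [deltaExp]; omega
  have h1 : deltaExp k E K R * (k + 1) ≤ (7 + 2 * M + 4 * k) * (2 * k) :=
    Nat.mul_le_mul hd (by omega)
  have h2 : M ≤ k * M := Nat.le_mul_of_pos_left _ hk
  have h3 : k ≤ k ^ 2 := Nat.le_self_pow (by norm_num) k
  have h4 : (7 + 2 * M + 4 * k) * (2 * k) = 14 * k + 4 * (k * M) + 8 * k ^ 2 := by ring
  rw [alphaExp]
  omega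

theorem size_add_one_le_log {x : ℕ} {y : ℝ} (hx : 1 ≤ x) (hy : (x : ℝ) ≤ y) :
    ((Nat.size x + 1 : ℕ) : ℝ) ≤ 2 + 2 * Real.log y := by
  have h1 : 1 ≤ Nat.size x := Nat.size_pos.mpr hx
  have h2 : 2 ^ (Nat.size x - 1) ≤ x := Nat.lt_size.mp (by omega)
  have h3 : (2 : ℝ) ^ (Nat.size x - 1) ≤ y := le_trans (by exact_mod_cast h2) hy
  have h4 := Real.log_le_log (by positivity) h3
  rw [Real.log_pow, Nat.cast_sub h1] at h4
  push_cast at h4 ⊢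
  have h5 : (1 : ℝ) ≤ Nat.size x := by exact_mod_cast h1
  nlinarith [Real.log_two_gt_d9]

theorem size_add_one_le_mul_log {x : ℕ} {c G : ℝ} (hx : 1 ≤ x) (hc : 1 ≤ c) (hG : 0 ≤ G)
    (hxG : (x : ℝ) ≤ c * (2 + G)) :
    ((Nat.size x + 1 : ℕ) : ℝ) ≤ (6 + 4 * Real.log c) * Real.log (2 + G) := by
  have h1 := size_add_one_le_log hx hxG
  rw [Real.log_mul (by linarith) (by linarith)] at h1
  have h2 : 1 / 2 ≤ Real.log (2 + G) := by
    linarith [Real.log_two_gt_d9, Real.log_le_log (by norm_num) (by linarith : 2 ≤ 2 + G)]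
  nlinarith [Real.log_nonneg hc]

theorem clog_two_add_one_le {k x : ℕ} (hkx : k ≤ x) : Nat.clog 2 k + 1 ≤ Nat.size x + 1 :=
  Nat.succ_le_succ (Nat.clog_le_of_le_pow (hkx.trans (Nat.lt_size_self x).le))

/-- Of the three logarithmic factors two come from multiplication and division (`slowTo_sq_size`)
and one from the depth of the summation tree. -/
theorem newtonProg_time {D B n k : ℕ} {ε : ℚ} (p : Polynomial ℝ) (hn : 1 ≤ n) (hk : 1 ≤ k)
    (hε : 0 < ε) (hε2 : ε ≤ 1 / 2)
    (hB : ((bits ε.num + bits ε.den : ℕ) : ℝ) ≤ B * Real.logb 2 (1 / (ε : ℝ)))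
    (hm : p.Monic) (hdeg : p.natDegree = n) (hs : p.Splits)
    (hroots : ∀ x, p.IsRoot x → x ∈ Set.Icc (0 : ℝ) (1 / 2))
    (hT : Monotone T) (hD : ∀ m, T (2 * m) ≤ D * T m) (hev : IsEvaluator p ev T) :
    ∃ (W : ℕ), 1 ≤ W ∧
      W ≤ (B + 1) * (D ^ 7 * T (k ^ 2 + k * ⌈Real.logb 2 ((n : ℝ) / ε)⌉₊)) ∧
      Runs ev T newtonProg (initState n k ε)
        (2000000 * ((dyadicParams n k ε).rounds * k * W * (Nat.size (800 * (k * W)) + 1) ^ 3))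
        fun σ => 0 < σ.reg 1 ∧ (σ.reg 0 : ℝ) / (σ.reg 1 : ℝ) =
          (newton n k (dyadicParams n k ε)).run fun x => p.eval x := by
  obtain ⟨z, hz, hzr⟩ := exists_roots_fun p n hdeg hm hs
  have : Nonempty (Fin n) := ⟨⟨0, hn⟩⟩
  obtain ⟨i₀, hi₀⟩ := Finite.exists_max z
  have hz01 := hroots (z i₀) ((hzr _).mpr ⟨i₀, rfl⟩)
  obtain ⟨E, V, K, R, h⟩ := exists_exponents n k ε hε
  have hε' : (0 : ℝ) < ε := by exact_mod_cast hε
  have hε2' : (ε : ℝ) ≤ 1 / 2 := by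
    have : ((ε : ℚ) : ℝ) ≤ ((1 / 2 : ℚ) : ℝ) := by exact_mod_cast hε2
    simpa using this
  have hn' : (1 : ℝ) ≤ n := by exact_mod_cast hn
  set M := ⌈Real.logb 2 ((n : ℝ) / ε)⌉₊ with hMdef
  set m := k ^ 2 + k * M with hmdef
  have hlog : Real.logb 2 ((n : ℝ) / ε) ≤ M := Nat.le_ceil _
  have hle : (n : ℝ) / ε ≤ 2 ^ M := by
    rw [Real.logb_le_iff_le_rpow (by norm_num) (by positivity)] at hlog
    simpa using hlog
  have h1ε : 1 / (ε : ℝ) ≤ n / ε := by gcongr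
  have hEM : E ≤ M := h.E_le hε (h1ε.trans hle)
  have hnM : (n : ℝ) ≤ 2 ^ M := by
    refine le_trans ?_ hle
    rw [le_div_iff₀ hε']
    nlinarith
  have hVM : V ≤ M := h.V_le_of_le (by exact_mod_cast hnM)
  have ha := h.alphaExp_le hk hEM hVM
  have hk2 : 1 ≤ k ^ 2 := Nat.one_le_pow _ _ hk
  have hMm : M ≤ m := le_trans (Nat.le_mul_of_pos_left _ hk) (Nat.le_add_left _ _)
  have hmT : 128 * m ≤ T (128 * m) := hev.reads _
  -- Evaluation costs and values are covered by `T`, with `128 m` above the argument lengths; the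
  -- parameters by `m ≤ T m`; numerator and denominator of `ε` by the factor `B + 1`.
  set W := (B + 1) * T (128 * m) with hW
  have hTW : T (128 * m) ≤ W := Nat.le_mul_of_pos_left _ (Nat.succ_pos B)
  have hbits : bits ε.num + bits ε.den ≤ W := by
    have h1 : Real.logb 2 (1 / (ε : ℝ)) ≤ M :=
      (Real.logb_le_logb_of_le (by norm_num) (by positivity) h1ε).trans hlog
    have h2 : ((bits ε.num + bits ε.den : ℕ) : ℝ) ≤ (B * M : ℕ) := by
      push_cast at hB ⊢
      exact hB.trans (by gcongr)
    have h3 : bits ε.num + bits ε.den ≤ B * M := by exact_mod_cast h2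
    exact h3.trans (Nat.mul_le_mul (Nat.le_succ B) (by omega))
  have hm1 : 1 ≤ m := by omega
  have hkk : k ^ 2 ≤ m := Nat.le_add_right _ _
  have hW1 : 1 ≤ W := by omega
  have hkx : k ≤ 800 * (k * W) := by nlinarith
  refine ⟨W, hW1, Nat.mul_le_mul_left _ (apply_two_pow_mul_le hD 7 m), ?_⟩
  refine (runs_newtonProg (W := W) (slowTo_sq_size (800 * (k * W))) (clog_two_add_one_le hkx) h hn hk
    hε hε2 (by omega) hT (by omega) ((hT (by omega)).trans hTW) (by omega) (by omega)
    ⟨hev.den_pos, hev.correct, hev.writes⟩ z hz i₀ hi₀ hz01.1 hz01.2).mono (le_of_eq ?_)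
    fun _ h => h
  ring

theorem newton_bit_complexity (D B : ℕ) : ∃ C : ℝ,
    ∀ (n k : ℕ) (ε : ℚ) (p : Polynomial ℝ) (T : ℕ → ℕ) (ev : ℤ → ℤ → ℤ × ℤ),
      1 ≤ n → 1 ≤ k → 0 < ε → ε ≤ 1 / 2 →
      ((bits ε.num + bits ε.den : ℕ) : ℝ) ≤ B * Real.logb 2 (1 / (ε : ℝ)) →
      p.Monic → p.natDegree = n → p.Splits → (∀ x, p.IsRoot x → x ∈ Set.Icc (0 : ℝ) (1 / 2)) →
      Monotone T → (∀ m, T (2 * m) ≤ D * T m) →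
      IsEvaluator p ev T →
      ∃ (σ : State) (t : ℕ), Exec ev T newtonProg (initState n k ε) σ t ∧ 0 < σ.reg 1 ∧
        (σ.reg 0 : ℝ) / (σ.reg 1 : ℝ)
          = (newton n k (dyadicParams n k (ε : ℝ))).run (fun x => p.eval x) ∧
        (t : ℝ) ≤ C * timeBound T n k (ε : ℝ) * Real.log (2 + timeBound T n k (ε : ℝ)) ^ 3 := by
  -- Using `D + 1` ensures `q ≥ 1` even for `D = 0`; the exponent is `log₂ 128`.
  set q : ℝ := (B + 1) * (D + 1) ^ 7 with hq
  have hq1 : 1 ≤ q := by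
    have h1 : (1 : ℝ) ≤ B + 1 := by linarith [Nat.cast_nonneg (α := ℝ) B]
    have h2 : (1 : ℝ) ≤ (D + 1) ^ 7 := one_le_pow₀ (by linarith [Nat.cast_nonneg (α := ℝ) D])
    nlinarith
  refine ⟨2000000 * (130 * q) * (6 + 4 * Real.log (1600 * q)) ^ 3, ?_⟩
  intro n k ε p T ev hn hk hε hε2 hB hm hdeg hs hroots hT hD hev
  obtain ⟨W, hW1, hW, σ, t, hex, ht, hpos, hout⟩ :=
    newtonProg_time p hn hk hε hε2 hB hm hdeg hs hroots hT hD hev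
  refine ⟨σ, t, hex, hpos, hout, ?_⟩
  have hε' : (0 : ℝ) < ε := by exact_mod_cast hε
  have hε2' : (ε : ℝ) ≤ 1 / 2 := by
    have : ((ε : ℚ) : ℝ) ≤ ((1 / 2 : ℚ) : ℝ) := by exact_mod_cast hε2
    simpa using this
  have hN := rounds_le (k := k) hn hε' hε2' (Or.inr rfl)
  have hr1 := one_le_rpow_inv (k := k) hn
  have hl := half_le_log hε' hε2'
  set N := (dyadicParams n k (ε : ℝ)).rounds
  set lam := Nat.size (800 * (k * W)) + 1 with hlam
  set G := timeBound T n k (ε : ℝ) with hG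
  rw [timeBound] at hG
  set τ : ℝ := (T (k ^ 2 + k * ⌈Real.logb 2 ((n : ℝ) / ε)⌉₊) : ℝ)
  set ρ := (n : ℝ) ^ (1 / (k : ℝ))
  set l := Real.log (1 / (ε : ℝ))
  have hτ : 0 ≤ τ := Nat.cast_nonneg _
  have hk0 : (0 : ℝ) ≤ k := Nat.cast_nonneg _
  have hWτ : (W : ℝ) ≤ q * τ := by
    have h1 : (W : ℝ) ≤ (B + 1) * (D ^ 7 * τ) := by
      have h2 := (Nat.cast_le (α := ℝ)).mpr hW
      push_cast at h2
      exact h2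
    refine h1.trans ?_
    rw [hq, mul_assoc]
    gcongr
    linarith
  have hρl : 1 / 2 ≤ ρ * l := by nlinarith
  have hG0 : 0 ≤ G := by rw [hG]; positivity
  -- The remaining factor `n^(1/k) log(1/ε)` of `G` is at least `1/2`. So `k W` is at most a
  -- constant times `G`, and its logarithm is `O(log(2 + G))`.
  have hkτ : k * τ ≤ 2 * G := by
    have : G = (k * τ) * (ρ * l) := by rw [hG]; ring
    rw [this]
    nlinarith [mul_nonneg hk0 hτ]
  have hNkW : (N : ℝ) * k * W ≤ 130 * q * G := by
    calc (N : ℝ) * k * W ≤ 130 * (ρ * l) * k * (q * τ) := by gcongr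
      _ = 130 * q * G := by rw [hG]; ring
  have hx : ((800 * (k * W) : ℕ) : ℝ) ≤ 1600 * q * (2 + G) := by
    have h1 : (k : ℝ) * W ≤ k * (q * τ) := by gcongr
    push_cast
    nlinarith
  have hlog := size_add_one_le_mul_log (by nlinarith) (by linarith) hG0 hx
  rw [← hlam] at hlog
  calc (t : ℝ) ≤ (2000000 * (N * k * W * lam ^ 3) : ℕ) := by exact_mod_cast ht
    _ = 2000000 * (N * k * W) * (lam : ℝ) ^ 3 := by push_cast; ring
    _ ≤ 2000000 * (130 * q * G) *
        ((6 + 4 * Real.log (1600 * q)) * Real.log (2 + G)) ^ 3 := by gcongr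
    _ = _ := by ring

end HigherOrderNewton
theorem mainTheorem2 :
    -- output guarantee and number of evaluations
    (∃ C : ℝ, ∀ (n k : ℕ) (ε : ℝ) (p : Polynomial ℝ) (lam : ℝ),
      1 ≤ n → 1 ≤ k → 0 < ε → ε ≤ 1 / 2 →
      p.Monic → p.natDegree = n → p.Splits → (∀ x, p.IsRoot x → x ∈ Set.Icc (0 : ℝ) (1 / 2)) →
      IsGreatest {x : ℝ | p.IsRoot x} lam →
      ∀ P : HigherOrderNewton.Params,
        (P = HigherOrderNewton.exactParams n k ε ∨ P = HigherOrderNewton.dyadicParams n k ε) →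
        0 ≤ (HigherOrderNewton.newton n k P).run (fun x => p.eval x) - lam ∧
        (HigherOrderNewton.newton n k P).run (fun x => p.eval x) - lam ≤ ε ∧
        ((HigherOrderNewton.newton n k P).queries (fun x => p.eval x) : ℝ)
          ≤ C * ((k : ℝ) * (n : ℝ) ^ (1 / (k : ℝ)) * Real.log (1 / ε))) ∧
    -- bit complexity
    (∃ (prog : HigherOrderNewton.Prog) (c : ℕ), ∀ D B : ℕ, ∃ C : ℝ,
      ∀ (n k : ℕ) (ε : ℚ) (p : Polynomial ℝ) (T : ℕ → ℕ) (ev : ℤ → ℤ → ℤ × ℤ),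
      1 ≤ n → 1 ≤ k → 0 < ε → ε ≤ 1 / 2 →
      ((HigherOrderNewton.bits ε.num + HigherOrderNewton.bits ε.den : ℕ) : ℝ)
        ≤ B * Real.logb 2 (1 / (ε : ℝ)) →
      p.Monic → p.natDegree = n → p.Splits → (∀ x, p.IsRoot x → x ∈ Set.Icc (0 : ℝ) (1 / 2)) →
      Monotone T → (∀ m, T (2 * m) ≤ D * T m) →
      HigherOrderNewton.IsEvaluator p ev T →
      ∃ (σ : HigherOrderNewton.State) (t : ℕ),
        HigherOrderNewton.Exec ev T prog (HigherOrderNewton.initState n k ε) σ t ∧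
        0 < σ.reg 1 ∧
        (σ.reg 0 : ℝ) / (σ.reg 1 : ℝ)
          = (HigherOrderNewton.newton n k (HigherOrderNewton.dyadicParams n k (ε : ℝ))).run
              (fun x => p.eval x) ∧
        (t : ℝ) ≤ C * HigherOrderNewton.timeBound T n k (ε : ℝ)
          * Real.log (2 + HigherOrderNewton.timeBound T n k (ε : ℝ)) ^ c) :=
  ⟨HigherOrderNewton.newton_guarantee, HigherOrderNewton.newtonProg, 3,
    HigherOrderNewton.newton_bit_complexity⟩
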